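/- **Setting.** $G=(V,E)$ is a simple connected undirected graph with $n=|V|$ nodes, $\log$ is the logarithm to base $2$, and $k,h$ are integers. An $\alpha$-spanner of $G$ is a graph $H=(V,S)$ with $S\subseteq E$ and $\mathrm{dist}_H(u,v)\le\alpha\,\mathrm{dist}_G(u,v)$ for all $u,v\in V$. In the randomized (synchronous, unbounded message size) LOCAL model with unique edge IDs, every edge of $G$ has an ID, distinct edges have distinct IDs, and each node initially knows $n$ and the algorithm's parameters, the IDs of its incident edges, and a private random seed, independent of the seeds of the other nodes. In each round every node that has not halted sends at most one message over each incident edge. When a node halts it outputs a set of IDs of incident edges. **Algorithm Sampler** with parameters $c,k,h$. Put $\delta=1/(2^{k+1}-1)$, $\tau_j=c\,n^{2^j\delta}\log n$, $t_j=\lceil c^2\,n^{2^j\delta+1/h}\log^3 n\rceil$ and $p_j=n^{-2^j\delta}$. Start from $G_0=G$. At level $j=0,\dots,k$, every node $v$ of the (multi)graph $G_j$ keeps a set $X_v$ of unexplored edges, initially all edges of $G_j$ at $v$, and a list $F_v$, initially empty. It performs up to $2h$ trials, as long as $X_v\ne\emptyset$ and $|F_v|<\tau_j$. In a trial it draws $t_j$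 edges from $X_v$ independently and uniformly with replacement, and processes them in the order in which they were drawn: as long as $|F_v|<\tau_j$, if the drawn edge leads to a neighbour to which no edge of $F_v$ leads, then the edge is appended to $F_v$ and all edges between $v$ and that neighbour are deleted from $X_v$. If $j<k$, then, after that, every node of $G_j$ becomes a center independently with probability $p_j$, every non-center $v$ with an edge in $F_v$ leading to a center joins the first such center in $F_v$, and $G_{j+1}$ is the cluster graph of the resulting clusters: its nodes are the centers together with the nodes that joined them, its edges are the edges of $G$ between different clusters, and nodes of $G_j$ that are in no cluster are dropped. The output $S$ is the union of all lists $F_v$ over all levels. **Theorem.** There are universal constants $A,b\in\mathbb N$ such that for every $d\in\mathbb R$ there is $c_0$ such that for every $c\ge c_0$ there is $B$ such that for all integers $n,k,h$ with $1\le k\le\log\log n$ and $1\le h\le\log n$ there is a LOCAL algorithm $\mathcal A$ with the following properties, for every connected simple graph $G$ on $n$ nodes and all unique edge IDs. 1. With probability at least $1-n^{-d}$, the edge set $S$ returned by Sampler with parameters $c,k,h$ is such that $(V,S)$ is an $A\,3^k$-spanner of $G$ and $|S|\le B\,(\log n)^b\,n^{1+1/(2^{k+1}-1)}$. 2. $\mathcal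 A$ is a distributed implementation of Sampler: all nodes halt within $A\,3^k h$ rounds; for some edge set $S_{\mathcal A}$, every node outputs precisely the IDs of its incident edges in $S_{\mathcal A}$; and the law of $S_{\mathcal A}$ is at total variation distance at most $n^{-d}$ from the law of the output of Sampler. 3. With probability at least $1-n^{-d}$, $(V,S_{\mathcal A})$ is an $A\,3^k$-spanner of $G$, $|S_{\mathcal A}|\le B\,(\log n)^b\,n^{1+1/(2^{k+1}-1)}$, and $\mathcal A$ sends at most $B\,(\log n)^b\,n^{1+1/(2^{k+1}-1)+1/h}$ messages in total. -/

import Mathlib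

open scoped ENNReal NNReal

noncomputable section

open scoped Classical in
/-- The joint law of a finite family of independent discrete random variables. -/
def PMF.indep {ι : Type} [Fintype ι] {α : ι → Type} (p : ∀ i, PMF (α i)) : PMF (∀ i, α i) :=
  ⟨fun f => ∏ i, p i (f i), by
    have h : ∑' f : (∀ i, α i), ∏ i, p i (f i) = 1 := by
      apply le_antisymm
      · rw [ENNReal.tsum_eq_iSup_sum]
        refine iSup_le fun s => ?_
        calc ∑ f ∈ s, ∏ i, p i (f i)
            ≤ ∑ f ∈ Fintype.piFinset (fun i => s.image (fun f => f i)), ∏ i, p i (f i) := by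
              refine Finset.sum_le_sum_of_subset ?_
              intro f hf
              simp only [Fintype.mem_piFinset, Finset.mem_image]
              exact fun i => ⟨f, hf, rfl⟩
          _ = ∏ i, ∑ a ∈ s.image (fun f => f i), p i a := (Finset.prod_univ_sum _ _).symm
          _ ≤ ∏ _i : ι, (1 : ℝ≥0∞) := by
              refine Finset.prod_le_prod' fun i _ => ?_
              rw [← (p i).tsum_coe]
              exact ENNReal.sum_le_tsum _
          _ = 1 := by simp
      · have ht : Filter.Tendsto (fun t : ∀ i, Finset (α i) => ∏ i, ∑ a ∈ t i, p i a)
            (Filter.pi fun _ => Filter.atTop) (nhds (∏ i, ∑' a, p i a)) := by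
          refine ENNReal.tendsto_finsetProd_of_ne_top _ (fun i _ => ?_) (fun i _ => ?_)
          · exact (ENNReal.summable.hasSum (f := p i)).comp (Filter.tendsto_eval_pi _ i)
          · rw [(p i).tsum_coe]; exact ENNReal.one_ne_top
        have h1 : ∏ i, ∑' a, p i a = 1 := by simp [PMF.tsum_coe]
        rw [h1] at ht
        refine le_of_tendsto ht (Filter.Eventually.of_forall fun t => ?_)
        rw [Finset.prod_univ_sum]
        exact ENNReal.sum_le_tsum _
    rw [← h]
    exact ENNReal.summable.hasSum⟩

/-- A coin that shows `true` with probability `min q 1`. -/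
def PMF.coin (q : ℝ≥0) : PMF Bool :=
  PMF.ofFintype (fun b => if b then ((min q 1 : ℝ≥0) : ℝ≥0∞) else 1 - ((min q 1 : ℝ≥0) : ℝ≥0∞)) (by
    rw [Fintype.sum_bool]
    simp only [if_true, Bool.false_eq_true, if_false]
    exact add_tsub_cancel_of_le (by exact_mod_cast min_le_right q 1))

/-- The property `P` fails with probability at most `η` under the law `p`. -/
def PMF.HoldsUpTo {α : Type} (p : PMF α) (η : ℝ) (P : α → Prop) : Prop :=
  p.toOuterMeasure {x | ¬ P x} ≤ ENNReal.ofReal η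

/-- The laws `p` and `q` are at total variation distance at most `η`. -/
def PMF.CloseTo {α : Type} (p q : PMF α) (η : ℝ) : Prop :=
  ∀ A : Set α, |(p.toOuterMeasure A).toReal - (q.toOuterMeasure A).toReal| ≤ η

/-- `S` is a set of edges of `G`, and all distances in `(V, S)` are at most `α` times those in
`G`. -/
def IsSpanner {V : Type} (G : SimpleGraph V) (α : ℕ) (S : Finset (Sym2 V)) : Prop :=
  (S : Set (Sym2 V)) ⊆ G.edgeSet ∧
    ∀ u v : V, (SimpleGraph.fromEdgeSet (S : Set (Sym2 V))).edist u v ≤ (α : ℕ∞) * G.edist u v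

/-! ### The LOCAL model with unique edge IDs -/

/-- A randomized LOCAL algorithm. A node starts from the set of IDs of its incident edges and a
private random seed. In every round a node that has not halted sends, over each incident edge
(addressed by its ID), at most one message of unbounded size, and then updates its state from the
messages that it received. It halts when its state has an output, which is a set of edge IDs. -/
structure LocalAlgorithm where
  Seed : Type
  seedLaw : PMF Seed
  State : Type
  Msg : Type
  start : Finset ℕ → Seed → State
  send : State → ℕ → Option Msg
  receive : State → (ℕ → Option Msg) → State
  output : State → Option (Finset ℕ)

namespace LocalAlgorithm

variable {V : Type} [Fintype V] (𝒜 : LocalAlgorithm) (G : SimpleGraph V) (ident : Sym2 V → ℕ)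

open scoped Classical in
/-- The IDs of the edges of `T` that are incident to `v`. -/
def idsAt (ident : Sym2 V → ℕ) (T : Set (Sym2 V)) (v : V) : Finset ℕ :=
  (Finset.univ.filter fun e : Sym2 V => e ∈ T ∧ v ∈ e).image ident

/-- The message that a node in state `s` puts on its incident edge with ID `i`. -/
def outgoing (s : 𝒜.State) (i : ℕ) : Option 𝒜.Msg :=
  if (𝒜.output s).isSome then none else 𝒜.send s i

open scoped Classical in
/-- The messages that reach `v` in one round, by the ID of the edge over which they arrive. -/
def inbox (σ : V → 𝒜.State) (v : V) (i : ℕ) : Option 𝒜.Msg :=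
  if h : ∃ u, G.Adj v u ∧ ident s(v, u) = i then 𝒜.outgoing (σ h.choose) i else none

/-- One synchronous round. -/
def round (σ : V → 𝒜.State) (v : V) : 𝒜.State :=
  if (𝒜.output (σ v)).isSome then σ v else 𝒜.receive (σ v) (𝒜.inbox G ident σ v)

/-- The states of all nodes after `t` rounds. -/
def run (ω : V → 𝒜.Seed) (t : ℕ) : V → 𝒜.State :=
  (𝒜.round G ident)^[t] fun v => 𝒜.start (idsAt ident G.edgeSet v) (ω v)

open scoped Classical in
/-- The number of messages that are sent in one round. -/
def roundMessages (σ : V → 𝒜.State) : ℕ :=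
  (Finset.univ.filter fun p : V × V =>
    G.Adj p.1 p.2 ∧ (𝒜.outgoing (σ p.1) (ident s(p.1, p.2))).isSome).card

/-- The number of messages that are sent in the first `t` rounds. -/
def messages (ω : V → 𝒜.Seed) (t : ℕ) : ℕ :=
  ∑ r ∈ Finset.range t, 𝒜.roundMessages G ident (𝒜.run G ident ω r)

open scoped Classical in
/-- The set of edges that some endpoint has put into its output by the end of round `t`. -/
def result (t : ℕ) (ω : V → 𝒜.Seed) : Finset (Sym2 V) :=
  Finset.univ.filter fun e => e ∈ G.edgeSet ∧
    ∃ v ∈ e, ∃ O, 𝒜.output (𝒜.run G ident ω t v) = some O ∧ ident e ∈ O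

/-- All nodes have halted after at most `t` rounds, and the output of each of them is exactly the
set of IDs of those edges of the resulting edge set that are incident to it. -/
def HaltsBy (t : ℕ) (ω : V → 𝒜.Seed) : Prop :=
  ∀ v, 𝒜.output (𝒜.run G ident ω t v) = some (idsAt ident (𝒜.result G ident t ω) v)

/-- The seeds of the nodes are independent. -/
def seeds (V : Type) [Fintype V] : PMF (V → 𝒜.Seed) := PMF.indep fun _ : V => 𝒜.seedLaw

end LocalAlgorithm

/-! ### Algorithm Sampler -/

namespace Sampler

/-- `δ = 1 / (2 ^ (k + 1) - 1)`. -/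
def delta (k : ℕ) : ℝ := 1 / ((2 : ℝ) ^ (k + 1) - 1)

/-- The number `c · n ^ (2 ^ j · δ) · log n` of neighbours that a node of `G_j` tries to find. -/
def target (c : ℝ) (n k j : ℕ) : ℝ :=
  c * (n : ℝ) ^ ((2 : ℝ) ^ j * delta k) * Real.logb 2 n

/-- The number `c ^ 2 · n ^ (2 ^ j · δ + 1 / h) · log ^ 3 n` of query edges in one trial. -/
def numQueries (c : ℝ) (n k h j : ℕ) : ℕ :=
  ⌈c ^ 2 * (n : ℝ) ^ ((2 : ℝ) ^ j * delta k + 1 / (h : ℝ)) * Real.logb 2 n ^ 3⌉₊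

/-- The probability `n ^ (- 2 ^ j · δ)` with which a node of `G_j` becomes a center. -/
def centerProb (n k j : ℕ) : ℝ≥0 := (n : ℝ≥0) ^ (-((2 : ℝ) ^ j * delta k))

variable {V : Type} [Fintype V] (G : SimpleGraph V)

/- A node of the cluster graph `G_j` is named by the vertex of `G` that is the center of all its
stages. The graph `G_j` is encoded by `cl : V → Option V`: `cl x = some v` if `x` lies in the
cluster `v`, and `cl x = none` if `x` lies in a cluster that stayed unclustered before level `j`. -/

open scoped Classical in
/-- The node of the cluster graph to which the edge `e` leads from the node `v`; there is none if
`e` does not correspond to an edge at `v` in the cluster graph. -/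
def leadsTo (cl : V → Option V) (v : V) (e : Sym2 V) : Option V :=
  if h : ∃ u, u ≠ v ∧ ∃ x y, G.Adj x y ∧ e = s(x, y) ∧ cl x = some v ∧ cl y = some u
  then some h.choose else none

open scoped Classical in
/-- The edges at the node `v` of the cluster graph. -/
def edgesAt (cl : V → Option V) (v : V) : Finset (Sym2 V) :=
  Finset.univ.filter fun e => (leadsTo G cl v e).isSome

/-- `t` independent uniform samples from the nonempty set `X`. -/
def draw {α : Type} (X : Finset α) (hX : X.Nonempty) : ℕ → PMF (List α)
  | 0 => PMF.pure []
  | t + 1 => (PMF.uniformOfFinset X hX).bind fun e => (draw X hX t).bind fun l => PMF.pure (e :: l)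

open scoped Classical in
/-- The node `v` processes the query edge `e`. Here `s.1` is the set `X_v` of unexplored edges and
`s.2` is the list `F_v` of edges that `v` contributes to the spanner. If the neighbour to which `e`
leads has not been found before, and the target has not been reached, then `e` is added to `F_v`
and all edges to this neighbour are removed from `X_v`. -/
def explore (cl : V → Option V) (v : V) (τ : ℝ) (s : Finset (Sym2 V) × List (Sym2 V))
    (e : Sym2 V) : Finset (Sym2 V) × List (Sym2 V) :=
  if e ∈ s.1 ∧ (s.2.length : ℝ) < τ then
    (s.1.filter fun e' => leadsTo G cl v e' ≠ leadsTo G cl v e, s.2 ++ [e])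
  else s

open scoped Classical in
/-- At most `i` trials of the node `v` with `t` query edges each, from the state `s`. -/
def trials (cl : V → Option V) (v : V) (τ : ℝ) (t : ℕ) :
    ℕ → Finset (Sym2 V) × List (Sym2 V) → PMF (Finset (Sym2 V) × List (Sym2 V))
  | 0, s => PMF.pure s
  | i + 1, s =>
    if hX : s.1.Nonempty ∧ (s.2.length : ℝ) < τ then
      (draw s.1 hX.1 t).bind fun Q => trials cl v τ t i (Q.foldl (explore G cl v τ) s)
    else PMF.pure s

/-- First step of level `j`: all nodes `v` of `G_j` independently find their lists `F_v`. (The list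
stays empty if `v` is not a node of `G_j`.) -/
def firstStep (c : ℝ) (k h j : ℕ) (cl : V → Option V) : PMF (V → List (Sym2 V)) :=
  PMF.indep fun v =>
    (trials G cl v (target c (Fintype.card V) k j) (numQueries c (Fintype.card V) k h j) (2 * h)
      (edgesAt G cl v, [])).map Prod.snd

/-- Independent marks of centers at level `j`. (Only those of nodes of `G_j` matter.) -/
def centers (V : Type) [Fintype V] (k j : ℕ) : PMF (V → Bool) :=
  PMF.indep fun _ : V => PMF.coin (centerProb (Fintype.card V) k j)

/-- The cluster that the node `v` joins: its own if `v` is a center, otherwise that of the first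
center among the neighbours that `v` has found, if there is one. -/
def joins (cl : V → Option V) (F : V → List (Sym2 V)) (mark : V → Bool) (v : V) : Option V :=
  if mark v then some v
  else (F v).findSome? fun e => (leadsTo G cl v e).filter mark

/-- Second step: the cluster graph of the next level. -/
def nextClusters (cl : V → Option V) (F : V → List (Sym2 V)) (mark : V → Bool) (x : V) :
    Option V :=
  (cl x).bind (joins G cl F mark)

open scoped Classical in
/-- The edges added to the spanner at one level. -/
def edgesOf (F : V → List (Sym2 V)) : Finset (Sym2 V) :=
  Finset.univ.biUnion fun v => (F v).toFinset

open scoped Classical in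
/-- The levels `j, j + 1, …, j + r`, of which the last one does not form clusters. -/
def levels (c : ℝ) (k h : ℕ) : ℕ → ℕ → (V → Option V) → PMF (Finset (Sym2 V))
  | 0, j, cl => (firstStep G c k h j cl).map edgesOf
  | r + 1, j, cl =>
    (firstStep G c k h j cl).bind fun F => (centers V k j).bind fun mark =>
      (levels c k h r (j + 1) (nextClusters G cl F mark)).map fun S => edgesOf F ∪ S

/-- The law of the edge set that Sampler returns: levels `0, …, k`, from `G_0 = G`. -/
def output (c : ℝ) (k h : ℕ) : PMF (Finset (Sym2 V)) :=
  levels G c k h k 0 some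

end Sampler

end

/-!
All assertions are deduced from one event about the random seeds of the vertices: when the seeds
are good, the edge set of Sampler is a sparse spanner and the LOCAL algorithm computes exactly
this edge set.

**Deferred randomness.** The seed of a vertex contains, for each level, one number for every draw
and one mark. A draw from a set `X` of edges takes the edge whose ID has the rank `u % |X|` in
`X`, where `u` is uniform below `(n ^ 2)!`, a multiple of all possible `|X|`; this is exactly
uniform. Hence Sampler is the image of the independent seeds under a deterministic function
(`map_simulate_seedLaw`), and everything can be said about a fixed `Execution`.

**Good executions** (`holdsUpTo_good`). In a trial from the set `X` of unexplored edges, let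
`q = n ^ (-1 / h)`. As long as more than `q |X|` edges stay unexplored, every draw finds a new
neighbour with probability more than `q`. The expectation of `2 ^ (-|F|)` over such outcomes hence
drops by the factor `1 - q / 2` per draw, and the number of draws is so large that the trial
reaches the target or shrinks `X` to a `q`-fraction with high probability. After `2 h` such trials
no edge is left. A node that reaches its target has a marked neighbour in its list with high
probability, and the numbers of nodes of the cluster graphs obey a Chernoff bound. Whatever
depends on `Execution.Good` is deterministic.

**Stretch and size.** Clusters of level `j` have radius at most `(3 ^ j - 1) / 2` in the spanner.
For an edge of `G`, take the last level at which both endpoints are in clusters. If these differ,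
one of them is dropped there, or the level is the last one; so it has explored all its edges and
has found an edge to the other (`Good.within_of_adj`). The sizes of the cluster graphs decrease as
fast as the targets and the numbers of queries grow (`expectedNodes_mul_rpow`).

**Distributed implementation.** The vertices gossip all records that they have over all edges that
have ever been query edges. A record contains the name of a vertex (the set of its edge IDs, which
determines the vertex, as `G` is connected and `n ≥ 3`), its cluster and its seed. A vertex that
knows the records of its own cluster, of the adjacent vertices that are in no cluster, and of the
clusters found so far can simulate the center of its cluster (`Knows`, `viewQueries_eq`,
`viewFound_eq`, `viewJoin_eq`). Edges inside the cluster are those with two endpoints in it; other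
unexplored edges need no further knowledge before they are drawn. The vertices of a dropped
cluster are known to the adjacent ones because a dropped cluster has found an edge to each of its
neighbours. By induction on the stages the implementation equals the simulation in good executions
(`Good.correct`). In all executions a last exchange makes the outputs of the two endpoints of an
edge agree (`haltsBy`).
-/

noncomputable section

open scoped Classical

namespace PMF

variable {ι : Type} [Fintype ι] {α β : Type}

/-! ### Independent families of discrete random variables -/

/-- A finite product of series is the series of the products, if the series are finite. -/
lemma prod_tsum {α : ι → Type} (f : ∀ i, α i → ℝ≥0∞) (hf : ∀ i, ∑' a, f i a ≠ ∞) :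
    ∏ i, ∑' a, f i a = ∑' g : ∀ i, α i, ∏ i, f i (g i) := by
  apply le_antisymm
  · have ht : Filter.Tendsto (fun t : ∀ i, Finset (α i) => ∏ i, ∑ a ∈ t i, f i a)
        (Filter.pi fun _ => Filter.atTop) (nhds (∏ i, ∑' a, f i a)) := by
      refine ENNReal.tendsto_finsetProd_of_ne_top _ (fun i _ => ?_) (fun i _ => hf i)
      exact (ENNReal.summable.hasSum (f := f i)).comp (Filter.tendsto_eval_pi _ i)
    refine le_of_tendsto ht (Filter.Eventually.of_forall fun t => ?_)
    rw [Finset.prod_univ_sum]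
    exact ENNReal.sum_le_tsum _
  · rw [ENNReal.tsum_eq_iSup_sum]
    refine iSup_le fun s => ?_
    calc ∑ g ∈ s, ∏ i, f i (g i)
        ≤ ∑ g ∈ Fintype.piFinset (fun i => s.image (fun g => g i)), ∏ i, f i (g i) := by
          refine Finset.sum_le_sum_of_subset ?_
          intro g hg
          simp only [Fintype.mem_piFinset, Finset.mem_image]
          exact fun i => ⟨g, hg, rfl⟩
      _ = ∏ i, ∑ a ∈ s.image (fun g => g i), f i a := (Finset.prod_univ_sum _ _).symm
      _ ≤ _ := Finset.prod_le_prod' fun i _ => ENNReal.sum_le_tsum _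

lemma indep_apply {α : ι → Type} (p : ∀ i, PMF (α i)) (f : ∀ i, α i) :
    indep p f = ∏ i, p i (f i) := rfl

lemma indep_pure (a : ι → α) : indep (fun i => pure (a i)) = pure a := by
  ext f
  rw [indep_apply]
  simp only [pure_apply, Finset.prod_ite_zero, Finset.prod_const_one, Finset.mem_univ, true_imp_iff,
    funext_iff]

/-- Two-stage experiments that are performed independently for all indices can be performed stage
by stage. -/
lemma indep_bind (p : ι → PMF α) (f : ι → α → PMF β) :
    indep (fun i => (p i).bind (f i)) = (indep p).bind fun a => indep fun i => f i (a i) := by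
  ext g
  rw [indep_apply, bind_apply]
  simp only [bind_apply, indep_apply, ← Finset.prod_mul_distrib]
  refine prod_tsum (fun i a => p i a * f i a (g i)) fun i => ?_
  have h := ((p i).bind (f i)).apply_ne_top (g i)
  rwa [bind_apply] at h

lemma indep_map (p : ι → PMF α) (f : ι → α → β) :
    indep (fun i => (p i).map (f i)) = (indep p).map fun a i => f i (a i) := by
  have h := indep_bind p fun i a => pure (f i a)
  simp only [indep_pure] at h
  exact h

/-! ### Expectations and probabilities -/

/-- The expectation of a nonnegative function of a discrete random variable. -/
def expect (p : PMF α) (f : α → ℝ≥0∞) : ℝ≥0∞ := ∑' a, p a * f a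

lemma expect_pure (a : α) (f : α → ℝ≥0∞) : (pure a).expect f = f a := by
  rw [expect, tsum_eq_single a]
  · simp
  · intro b hb
    simp [pure_apply, hb]

lemma expect_bind (p : PMF α) (q : α → PMF β) (f : β → ℝ≥0∞) :
    (p.bind q).expect f = p.expect fun a => (q a).expect f := by
  simp only [expect, bind_apply, ← ENNReal.tsum_mul_right, ← ENNReal.tsum_mul_left]
  rw [ENNReal.tsum_comm]
  simp only [mul_assoc]

lemma expect_map (p : PMF α) (q : α → β) (f : β → ℝ≥0∞) :
    (p.map q).expect f = p.expect fun a => f (q a) := by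
  rw [map, expect_bind]
  simp [expect_pure]

lemma expect_mono (p : PMF α) {f g : α → ℝ≥0∞} (h : ∀ a, f a ≤ g a) : p.expect f ≤ p.expect g :=
  ENNReal.tsum_le_tsum fun a => mul_le_mul_right (h a) _

lemma expect_const (p : PMF α) (C : ℝ≥0∞) : (p.expect fun _ => C) = C := by
  rw [expect, ENNReal.tsum_mul_right, tsum_coe, one_mul]

lemma expect_add (p : PMF α) (f g : α → ℝ≥0∞) :
    (p.expect fun a => f a + g a) = p.expect f + p.expect g := by
  simp only [expect, mul_add, ENNReal.tsum_add]

lemma expect_indep_prod (p : ι → PMF α) (g : ι → α → ℝ≥0∞) (h : ∀ i, (p i).expect (g i) ≠ ∞) :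
    ((indep p).expect fun a => ∏ i, g i (a i)) = ∏ i, (p i).expect (g i) := by
  simp only [expect, indep_apply, ← Finset.prod_mul_distrib]
  exact (prod_tsum (fun i a => p i a * g i a) h).symm

lemma prob_eq_expect (p : PMF α) (A : Set α) :
    p.toOuterMeasure A = p.expect (A.indicator fun _ => 1) := by
  rw [toOuterMeasure_apply, expect]
  refine tsum_congr fun a => ?_
  by_cases h : a ∈ A <;> simp [h]

lemma prob_le_one (p : PMF α) (A : Set α) : p.toOuterMeasure A ≤ 1 := by
  rw [prob_eq_expect]
  refine (p.expect_mono fun a => ?_).trans (p.expect_const 1).le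
  by_cases h : a ∈ A <;> simp [h]

lemma prob_bind (p : PMF α) (q : α → PMF β) (A : Set β) :
    (p.bind q).toOuterMeasure A = p.expect fun a => (q a).toOuterMeasure A := by
  simp only [prob_eq_expect, expect_bind]

/-- The union bound for a two-stage experiment. -/
lemma prob_bind_le (p : PMF α) (q : α → PMF β) (A : Set β) (B : Set α) (η : ℝ≥0∞)
    (h : ∀ a ∉ B, (q a).toOuterMeasure A ≤ η) :
    (p.bind q).toOuterMeasure A ≤ p.toOuterMeasure B + η := by
  rw [prob_bind, prob_eq_expect p B]
  rw [← p.expect_const η, ← expect_add]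
  refine p.expect_mono fun a => ?_
  by_cases ha : a ∈ B
  · simpa [ha] using ((q a).prob_le_one A).trans le_self_add
  · simpa [ha] using h a ha

/-- Markov's inequality. -/
lemma mul_prob_le_expect (p : PMF α) (A : Set α) (f : α → ℝ≥0∞) (m : ℝ≥0∞)
    (h : ∀ a ∈ A, m ≤ f a) : m * p.toOuterMeasure A ≤ p.expect f := by
  rw [prob_eq_expect, expect, ← ENNReal.tsum_mul_left]
  refine ENNReal.tsum_le_tsum fun a => ?_
  by_cases ha : a ∈ A
  · simpa [ha, mul_comm] using mul_le_mul_right (h a ha) (p a)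
  · simp [ha]

lemma prob_exists_le (p : PMF α) {κ : Type} (s : Finset κ) (P : κ → α → Prop) (η : ℝ≥0∞)
    (h : ∀ i ∈ s, p.toOuterMeasure {a | P i a} ≤ η) :
    p.toOuterMeasure {a | ∃ i ∈ s, P i a} ≤ s.card * η := by
  have hU : {a | ∃ i ∈ s, P i a} = ⋃ i ∈ s, {a | P i a} := by ext a; simp
  rw [hU, ← nsmul_eq_mul]
  exact (MeasureTheory.measure_biUnion_finset_le s _).trans (Finset.sum_le_card_nsmul _ _ _ h)

lemma indep_map_eval (p : ι → PMF α) (i : ι) : (indep p).map (fun a => a i) = p i := by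
  ext b
  have h := expect_indep_prod p (fun j a => if j = i then (if a = b then 1 else 0) else 1)
    (fun j => by
      refine ne_top_of_le_ne_top ENNReal.one_ne_top ?_
      refine (expect_mono _ fun a => ?_).trans ((p j).expect_const 1).le
      split_ifs <;> simp)
  have hb : (p i).expect (fun a => if a = b then 1 else 0) = p i b := by
    rw [expect, tsum_eq_single b]
    · simp
    · intro a ha
      simp [ha]
  rw [Finset.prod_eq_single i] at h
  · simp only [if_true, hb] at h
    rw [← h, map_apply, expect]
    refine tsum_congr fun a => ?_
    rw [Finset.prod_ite_eq' Finset.univ i]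
    by_cases hab : a i = b
    · simp [hab]
    · simp [hab, Ne.symm hab]
  · intro j _ hj
    simp [hj, expect_const]
  · simp

/-- An event about a single coordinate has the probability that this coordinate gives to it. -/
lemma prob_indep_eval (p : ι → PMF α) (i : ι) (P : α → Prop) :
    (indep p).toOuterMeasure {a | P (a i)} = (p i).toOuterMeasure {a | P a} := by
  rw [← indep_map_eval p i, toOuterMeasure_map_apply]
  rfl

/-- Laws of functions that agree with high probability are close. -/
lemma closeTo_map (p : PMF α) (f g : α → β) (η : ℝ) (hη : 0 ≤ η)
    (h : p.HoldsUpTo η fun a => f a = g a) : (p.map f).CloseTo (p.map g) η := by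
  intro A
  simp only [toOuterMeasure_map_apply]
  have key : ∀ f g : α → β, p.toOuterMeasure {a | ¬ f a = g a} ≤ ENNReal.ofReal η →
      (p.toOuterMeasure (f ⁻¹' A)).toReal ≤ (p.toOuterMeasure (g ⁻¹' A)).toReal + η := by
    intro f g h
    have hsub : f ⁻¹' A ⊆ g ⁻¹' A ∪ {a | ¬ f a = g a} := by
      intro a ha
      by_cases hfg : f a = g a
      · left; simpa [← hfg] using ha
      · exact Or.inr hfg
    have h1 : p.toOuterMeasure (f ⁻¹' A) ≤ p.toOuterMeasure (g ⁻¹' A) + ENNReal.ofReal η :=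
      (MeasureTheory.measure_mono hsub).trans
        ((MeasureTheory.measure_union_le _ _).trans (add_le_add_right h _))
    have hne : p.toOuterMeasure (g ⁻¹' A) ≠ ∞ :=
      ne_top_of_le_ne_top ENNReal.one_ne_top (p.prob_le_one _)
    have h2 := ENNReal.toReal_mono (ENNReal.add_ne_top.2 ⟨hne, ENNReal.ofReal_ne_top⟩) h1
    rwa [ENNReal.toReal_add hne ENNReal.ofReal_ne_top, ENNReal.toReal_ofReal hη] at h2
  have h1 := key f g h
  have h2 := key g f (by simpa only [HoldsUpTo, eq_comm] using h)
  rw [abs_le]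
  constructor <;> linarith

lemma HoldsUpTo.mono {p : PMF α} {η : ℝ} {P Q : α → Prop} (h : p.HoldsUpTo η P)
    (hPQ : ∀ a, P a → Q a) : p.HoldsUpTo η Q :=
  (MeasureTheory.measure_mono (fun a (ha : ¬ Q a) hP => ha (hPQ a hP))).trans h

lemma HoldsUpTo.map {p : PMF α} {η : ℝ} {f : α → β} {P : β → Prop}
    (h : p.HoldsUpTo η fun a => P (f a)) : (p.map f).HoldsUpTo η P := by
  unfold HoldsUpTo
  rw [toOuterMeasure_map_apply]
  exact h

end PMF

namespace Sampler

/-! ### Streams of independent random variables -/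

variable {α β σ : Type}

/-- The stream that starts with `a` and continues with `f`. -/
def streamCons (a : α) (f : ℕ → α) : ℕ → α
  | 0 => a
  | i + 1 => f i

/-- The law of a stream whose first `r` entries are independent with the laws `p 0`, `p 1`, …; the
other entries are junk. -/
def streamLaw [Inhabited α] : (ℕ → PMF α) → ℕ → PMF (ℕ → α)
  | _, 0 => PMF.pure fun _ => default
  | p, r + 1 => (p 0).bind fun a => (streamLaw (fun i => p (i + 1)) r).map (streamCons a)

/-- The state that is reached from `s` by `i` steps with the first `i` entries of the stream. -/
def foldStream (step : σ → α → σ) (s : σ) (f : ℕ → α) : ℕ → σ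
  | 0 => s
  | i + 1 => step (foldStream step s f i) (f i)

lemma foldStream_cons (step : σ → α → σ) (s : σ) (a : α) (f : ℕ → α) (i : ℕ) :
    foldStream step s (streamCons a f) (i + 1) = foldStream step (step s a) f i := by
  induction i with
  | zero => rfl
  | succ i ih =>
    rw [foldStream, ih]
    rfl

lemma indep_streamLaw_succ {V : Type} [Fintype V] [Inhabited α] (p : ℕ → PMF α) (r : ℕ) :
    PMF.indep (fun _ : V => streamLaw p (r + 1)) = (PMF.indep fun _ : V => p 0).bind fun a =>
      (PMF.indep fun _ : V => streamLaw (fun i => p (i + 1)) r).map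
        fun f v => streamCons (a v) (f v) := by
  simp only [streamLaw, PMF.indep_bind, PMF.indep_map]

/-! ### Elementary facts about explorations -/

section Explore

variable {V : Type} [Fintype V] {G : SimpleGraph V}

lemma foldl_explore_subset (cl : V → Option V) (v : V) (τ : ℝ) (Q : List (Sym2 V))
    (s : Finset (Sym2 V) × List (Sym2 V)) : (Q.foldl (explore G cl v τ) s).1 ⊆ s.1 := by
  induction Q generalizing s with
  | nil => exact subset_rfl
  | cons e Q ih =>
    refine (ih _).trans ?_
    unfold explore
    split_ifs
    · exact Finset.filter_subset _ _
    · exact subset_rfl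

lemma foldl_explore_of_not (cl : V → Option V) (v : V) (τ : ℝ) (Q : List (Sym2 V))
    (s : Finset (Sym2 V) × List (Sym2 V)) (hs : ¬ (s.1.Nonempty ∧ (s.2.length : ℝ) < τ)) :
    Q.foldl (explore G cl v τ) s = s := by
  induction Q with
  | nil => rfl
  | cons e Q ih =>
    have h : explore G cl v τ s e = s := if_neg fun h => hs ⟨⟨e, h.1⟩, h.2⟩
    rw [List.foldl_cons, h, ih]

lemma mem_of_mem_foldl_explore {cl : V → Option V} {v : V} {τ : ℝ} {e : Sym2 V}
    (Q : List (Sym2 V)) (s : Finset (Sym2 V) × List (Sym2 V))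
    (he : e ∈ (Q.foldl (explore G cl v τ) s).2) :
    e ∈ s.2 ∨ e ∈ Q.toFinset ∩ s.1 := by
  induction Q generalizing s with
  | nil => exact Or.inl he
  | cons f Q ih =>
    have h := ih _ he
    unfold explore at h
    split_ifs at h with hf
    · simp only [List.mem_append, List.mem_singleton, Finset.mem_inter, Finset.mem_filter,
        List.mem_toFinset] at h
      simp only [List.toFinset_cons, Finset.mem_inter, Finset.mem_insert, List.mem_toFinset]
      rcases h with (h | rfl) | h
      · exact Or.inl h
      · exact Or.inr ⟨Or.inl rfl, hf.1⟩
      · exact Or.inr ⟨Or.inr h.1, h.2.1⟩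
    · simp only [Finset.mem_inter, List.mem_toFinset] at h
      simp only [List.toFinset_cons, Finset.mem_inter, Finset.mem_insert, List.mem_toFinset]
      rcases h with h | h
      · exact Or.inl h
      · exact Or.inr ⟨Or.inr h.1, h.2⟩

lemma mem_edgesAt_iff {cl : V → Option V} {v : V} {e : Sym2 V} :
    e ∈ edgesAt G cl v ↔
      ∃ u, u ≠ v ∧ ∃ x y, G.Adj x y ∧ e = s(x, y) ∧ cl x = some v ∧ cl y = some u := by
  rw [edgesAt, Finset.mem_filter, leadsTo]
  split_ifs with h <;> simp [h]

lemma edgesAt_subset (cl : V → Option V) (v : V) :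
    ((edgesAt G cl v : Finset (Sym2 V)) : Set (Sym2 V)) ⊆ G.edgeSet := by
  intro e he
  obtain ⟨u, -, x, y, hxy, rfl, -⟩ := mem_edgesAt_iff.1 he
  exact hxy

end Explore

/-! ### Uniform choice by rank -/

/-- The element of `X` whose rank is the residue of `u` modulo the size of `X`. -/
def pick (X : Finset ℕ) (u : ℕ) : ℕ :=
  if h : 0 < X.card then X.orderEmbOfFin rfl ⟨u % X.card, Nat.mod_lt _ h⟩ else 0

lemma pick_mem {X : Finset ℕ} (hX : X.Nonempty) (u : ℕ) : pick X u ∈ X := by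
  rw [pick, dif_pos hX.card_pos]
  exact Finset.orderEmbOfFin_mem _ _ _

lemma card_filter_pick {X : Finset ℕ} {N e : ℕ} (hN : X.card ∣ N) (he : e ∈ X) :
    ((Finset.range N).filter fun u => pick X u = e).card = N / X.card := by
  have hX : 0 < X.card := Finset.card_pos.2 ⟨e, he⟩
  obtain ⟨r, hr⟩ : ∃ r : Fin X.card, X.orderEmbOfFin rfl r = e := by
    have : e ∈ Set.range (X.orderEmbOfFin rfl) := by simpa using he
    exact this
  have h1 := Nat.count_modEq_card N hX (r : ℕ)
  rw [Nat.mod_eq_zero_of_dvd hN, if_neg (Nat.not_lt_zero _), add_zero,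
    Nat.count_eq_card_filter_range] at h1
  rw [← h1]
  congr 1
  ext u
  simp only [Finset.mem_filter, pick, dif_pos hX, ← hr, EmbeddingLike.apply_eq_iff_eq, Fin.ext_iff,
    Nat.ModEq, Nat.mod_eq_of_lt r.2]

variable {V : Type}

instance [Nonempty V] : Nonempty (Sym2 V) := ⟨s(Classical.arbitrary V, Classical.arbitrary V)⟩

variable [Nonempty V]

/-- The edge of `X` that is picked by the rank of its ID. -/
def pickEdge (ident : Sym2 V → ℕ) (X : Finset (Sym2 V)) (u : ℕ) : Sym2 V :=
  Function.invFunOn ident X (pick (X.image ident) u)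

lemma pickEdge_mem (ident : Sym2 V → ℕ) {X : Finset (Sym2 V)} (hX : X.Nonempty) (u : ℕ) :
    pickEdge ident X u ∈ X := by
  have h := pick_mem (hX.image ident) u
  rw [Finset.mem_image] at h
  exact Function.invFunOn_mem h

lemma ident_pickEdge (ident : Sym2 V → ℕ) {X : Finset (Sym2 V)} (hX : X.Nonempty) (u : ℕ) :
    ident (pickEdge ident X u) = pick (X.image ident) u := by
  have h := pick_mem (hX.image ident) u
  rw [Finset.mem_image] at h
  exact Function.invFunOn_eq h

/-- A uniformly random number below a multiple of the size of `X` picks a uniformly random edge. -/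
lemma map_pickEdge (ident : Sym2 V → ℕ) {X : Finset (Sym2 V)} (hX : X.Nonempty)
    (hinj : Set.InjOn ident X) {N : ℕ} (hN : X.card ∣ N) (h0 : (Finset.range N).Nonempty) :
    (PMF.uniformOfFinset (Finset.range N) h0).map (pickEdge ident X) =
      PMF.uniformOfFinset X hX := by
  ext e
  rw [PMF.map_apply, PMF.uniformOfFinset_apply]
  have h1 : ∀ u, (if e = pickEdge ident X u then PMF.uniformOfFinset (Finset.range N) h0 u else 0) =
      if u ∈ (Finset.range N).filter (fun u => e = pickEdge ident X u) then (N : ℝ≥0∞)⁻¹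
        else 0 := by
    intro u
    rw [PMF.uniformOfFinset_apply, Finset.card_range]
    by_cases h1 : u ∈ Finset.range N <;> by_cases h2 : e = pickEdge ident X u <;> simp_all
  refine Eq.trans (b := ∑' u, if u ∈ (Finset.range N).filter (fun u => e = pickEdge ident X u)
    then (N : ℝ≥0∞)⁻¹ else 0) (tsum_congr fun u => by convert h1 u) ?_
  rw [tsum_eq_sum (s := (Finset.range N).filter (fun u => e = pickEdge ident X u))
    (fun u hu => if_neg hu), Finset.sum_congr rfl (fun u hu => if_pos hu), Finset.sum_const,
    nsmul_eq_mul]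
  by_cases he : e ∈ X
  · rw [if_pos he]
    have hc : (X.image ident).card = X.card := Finset.card_image_of_injOn hinj
    have h2 : (Finset.range N).filter (fun u => e = pickEdge ident X u) =
        (Finset.range N).filter fun u => pick (X.image ident) u = ident e := by
      refine Finset.filter_congr fun u _ => ?_
      rw [← ident_pickEdge ident hX]
      exact ⟨fun h => by rw [h], fun h => (hinj (pickEdge_mem ident hX u) he h).symm⟩
    rw [h2, card_filter_pick (hc ▸ hN) (Finset.mem_image_of_mem _ he), hc]
    obtain ⟨m, rfl⟩ := hN
    have hX0 : X.card ≠ 0 := hX.card_pos.ne'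
    have hm0 : m ≠ 0 := by
      rintro rfl
      simp at h0
    rw [Nat.mul_div_cancel_left _ hX.card_pos, Nat.cast_mul, ENNReal.mul_inv (by simp) (by simp),
      mul_left_comm, ENNReal.mul_inv_cancel (by simpa using hm0) (by simp), mul_one]
  · rw [if_neg he, Finset.filter_false_of_mem, Finset.card_empty, Nat.cast_zero, zero_mul]
    rintro u - rfl
    exact he (pickEdge_mem ident hX u)

/-! ### Sampler as a function of independent random seeds -/

section Seeds

variable (c : ℝ) (n k h : ℕ)

/-- The randomness that a node uses at one level: one number for each draw of each trial, and its
mark. -/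
abbrev LevelSeed : Type := (ℕ → ℕ → ℕ) × Bool

/-- The randomness that a node uses at all levels. -/
abbrev Seed : Type := ℕ → LevelSeed

/-- The law of the number that decides one draw. The factorial makes it a multiple of every possible
number of unexplored edges. -/
def drawLaw : PMF ℕ :=
  PMF.uniformOfFinset (Finset.range (n ^ 2).factorial)
    (Finset.nonempty_range_iff.2 (Nat.factorial_ne_zero _))

/-- The law of the numbers that decide the trials of one node at level `j`. -/
def trialsLaw (j : ℕ) : PMF (ℕ → ℕ → ℕ) :=
  streamLaw (fun _ => streamLaw (fun _ => drawLaw n) (numQueries c n k h j)) (2 * h)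

/-- The law of the randomness that one node uses at level `j`. -/
def levelLaw (j : ℕ) : PMF LevelSeed :=
  (trialsLaw c n k h j).bind fun us => (PMF.coin (centerProb n k j)).map fun b => (us, b)

/-- The law of the seed of one node. -/
def seedLaw : PMF Seed := streamLaw (levelLaw c n k h) (k + 1)

lemma indep_levelLaw {V : Type} [Fintype V] (c : ℝ) (k h j : ℕ) :
    (PMF.indep fun _ : V => levelLaw c (Fintype.card V) k h j) =
      (PMF.indep fun _ : V => trialsLaw c (Fintype.card V) k h j).bind fun us =>
        (centers V k j).map fun m v => (us v, m v) := by
  simp only [levelLaw, PMF.indep_bind, PMF.indep_map, centers]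

end Seeds

variable [Fintype V] (G : SimpleGraph V) (ident : Sym2 V → ℕ)

/-- One trial of the node `v`, with the draws decided by `u`. If the target is reached or no edge is
unexplored, it has no effect. -/
def trialStep (cl : V → Option V) (v : V) (τ : ℝ) (t : ℕ) (s : Finset (Sym2 V) × List (Sym2 V))
    (u : ℕ → ℕ) : Finset (Sym2 V) × List (Sym2 V) :=
  ((List.range t).map fun q => pickEdge ident s.1 (u q)).foldl (explore G cl v τ) s

variable {G}

lemma draw_eq {X : Finset (Sym2 V)} (hX : X.Nonempty) (hinj : Set.InjOn ident X) (t : ℕ) :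
    draw X hX t = (streamLaw (fun _ => drawLaw (Fintype.card V)) t).map
      fun u => (List.range t).map fun q => pickEdge ident X (u q) := by
  have hle : X.card ≤ Fintype.card V ^ 2 := by
    refine (Finset.card_le_univ X).trans ?_
    rw [Sym2.card, Nat.choose_two_right, Nat.add_sub_cancel]
    have := Nat.le_self_pow two_ne_zero (Fintype.card V)
    refine Nat.div_le_of_le_mul ?_
    nlinarith
  have hdvd : X.card ∣ (Fintype.card V ^ 2).factorial := Nat.dvd_factorial hX.card_pos hle
  induction t with
  | zero => simp [draw, streamLaw, PMF.pure_map]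
  | succ t ih =>
    rw [draw, streamLaw, ih, ← map_pickEdge ident hX hinj hdvd
      (Finset.nonempty_range_iff.2 (Nat.factorial_ne_zero _)), PMF.map_bind, PMF.bind_map]
    refine congrArg _ (funext fun a => ?_)
    simp only [Function.comp_apply, PMF.map_comp]
    simp only [PMF.map, PMF.bind_bind]
    refine congrArg _ (funext fun u => ?_)
    simp [List.range_succ_eq_map, streamCons, Function.comp_def]

lemma trials_eq (cl : V → Option V) (v : V) (τ : ℝ) (t i : ℕ)
    (s : Finset (Sym2 V) × List (Sym2 V)) (hs : Set.InjOn ident s.1) :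
    trials G cl v τ t i s =
      (streamLaw (fun _ => streamLaw (fun _ => drawLaw (Fintype.card V)) t) i).map
        fun us => foldStream (trialStep G ident cl v τ t) s us i := by
  induction i generalizing s with
  | zero => simp [trials, streamLaw, foldStream, PMF.pure_map]
  | succ i ih =>
    rw [trials, streamLaw, PMF.map_bind]
    simp only [PMF.map_comp, Function.comp_def, foldStream_cons]
    split_ifs with hX
    · rw [draw_eq ident hX.1 hs, PMF.bind_map]
      refine congrArg _ (funext fun u => ?_)
      exact ih _ (hs.mono (foldl_explore_subset _ _ _ _ _))
    · have hstep : ∀ u, trialStep G ident cl v τ t s u = s := fun u =>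
        foldl_explore_of_not _ _ _ _ _ hX
      have hfold : ∀ us i, foldStream (trialStep G ident cl v τ t) s us i = s := by
        intro us i
        induction i with
        | zero => rfl
        | succ i ih => rw [foldStream, ih, hstep]
      simp only [hstep, hfold, PMF.bind_const]
      exact (PMF.map_const _ _).symm

variable (G)

section Simulation

variable (c : ℝ) (k h : ℕ)

/-- The unexplored edges and the list of the node `v` at level `j` after `i` trials that are decided
by `us`. -/
def stateAfter (j : ℕ) (cl : V → Option V) (v : V) (us : ℕ → ℕ → ℕ) (i : ℕ) :
    Finset (Sym2 V) × List (Sym2 V) :=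
  foldStream (trialStep G ident cl v (target c (Fintype.card V) k j)
    (numQueries c (Fintype.card V) k h j)) (edgesAt G cl v, []) us i

/-- The lists of all nodes at the end of level `j`. -/
def lists (j : ℕ) (cl : V → Option V) (a : V → LevelSeed) (v : V) : List (Sym2 V) :=
  (stateAfter G ident c k h j cl v (a v).1 (2 * h)).2

/-- The cluster graph of level `j + i`, from that of level `j`. -/
def clusters (j : ℕ) (cl : V → Option V) (ω : V → Seed) : ℕ → V → Option V
  | 0 => cl
  | i + 1 => nextClusters G (clusters j cl ω i)
      (lists G ident c k h (j + i) (clusters j cl ω i) fun v => ω v i) fun v => (ω v i).2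

/-- The edges that the levels `j`, …, `j + r` add to the spanner. -/
def simulate (j : ℕ) (cl : V → Option V) (r : ℕ) (ω : V → Seed) : Finset (Sym2 V) :=
  (Finset.range (r + 1)).biUnion fun i =>
    edgesOf (lists G ident c k h (j + i) (clusters G ident c k h j cl ω i) fun v => ω v i)

variable {G ident c k h}

lemma clusters_succ' (j : ℕ) (cl : V → Option V) (a : V → LevelSeed) (f : V → Seed) (i : ℕ) :
    clusters G ident c k h j cl (fun v => streamCons (a v) (f v)) (i + 1) =
      clusters G ident c k h (j + 1)
        (nextClusters G cl (lists G ident c k h j cl a) fun v => (a v).2) f i := by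
  induction i with
  | zero => rfl
  | succ i ih =>
    rw [clusters, ih, clusters, Nat.add_right_comm j 1 i]
    rfl

lemma simulate_succ (j : ℕ) (cl : V → Option V) (a : V → LevelSeed) (f : V → Seed) (r : ℕ) :
    simulate G ident c k h j cl (r + 1) (fun v => streamCons (a v) (f v)) =
      edgesOf (lists G ident c k h j cl a) ∪ simulate G ident c k h (j + 1)
        (nextClusters G cl (lists G ident c k h j cl a) fun v => (a v).2) r f := by
  rw [simulate, Finset.range_eq_Ico, ← Finset.insert_Ico_add_one_left_eq_Ico (Nat.succ_pos _),
    Finset.biUnion_insert]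
  congr 1
  rw [← Finset.image_add_right_Ico 0 (r + 1) 1]
  ext e
  simp only [Finset.mem_biUnion, Finset.mem_image, simulate, Finset.range_eq_Ico]
  constructor
  · rintro ⟨_, ⟨i, hi, rfl⟩, he⟩
    refine ⟨i, hi, ?_⟩
    rw [clusters_succ', ← add_assoc, Nat.add_right_comm] at he
    exact he
  · rintro ⟨i, hi, he⟩
    refine ⟨i + 1, ⟨i, hi, rfl⟩, ?_⟩
    rw [clusters_succ', ← add_assoc, Nat.add_right_comm]
    exact he

lemma firstStep_eq (hinj : Set.InjOn ident G.edgeSet) (j : ℕ) (cl : V → Option V) :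
    firstStep G c k h j cl = (PMF.indep fun _ : V => trialsLaw c (Fintype.card V) k h j).map
      fun us => lists G ident c k h j cl fun v => (us v, false) := by
  rw [firstStep]
  refine Eq.trans (congrArg PMF.indep (funext fun v => ?_)) (PMF.indep_map
    (fun _ : V => trialsLaw c (Fintype.card V) k h j)
    fun v us => (stateAfter G ident c k h j cl v us (2 * h)).2)
  rw [trials_eq ident _ _ _ _ _ _ (hinj.mono (edgesAt_subset _ _)), PMF.map_comp]
  rfl

/-- If the seeds of the nodes are independent, the simulation has the law of the levels of
Sampler. -/
lemma map_simulate (hinj : Set.InjOn ident G.edgeSet) (r j : ℕ) (cl : V → Option V) :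
    (PMF.indep fun _ : V => streamLaw (fun i => levelLaw c (Fintype.card V) k h (j + i))
      (r + 1)).map (simulate G ident c k h j cl r) = levels G c k h r j cl := by
  induction r generalizing j cl with
  | zero =>
    rw [indep_streamLaw_succ, levels, firstStep_eq hinj, add_zero, indep_levelLaw]
    simp only [streamLaw, PMF.indep_pure, PMF.pure_map, PMF.map_bind, PMF.bind_bind, PMF.bind_map,
      PMF.map_comp]
    simp only [PMF.map, Function.comp_def, PMF.pure_bind]
    refine congrArg _ (funext fun us => ?_)
    simp only [simulate, zero_add, Finset.range_one, Finset.singleton_biUnion, add_zero, clusters,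
      streamCons]
    exact PMF.bind_const (centers V k j)
      (PMF.pure (edgesOf (lists G ident c k h j cl fun v => (us v, false))))
  | succ r ih =>
    rw [indep_streamLaw_succ, levels, firstStep_eq hinj, add_zero, indep_levelLaw]
    simp only [PMF.map_bind, PMF.bind_bind, PMF.bind_map]
    refine congrArg _ (funext fun us => congrArg _ (funext fun m => ?_))
    have hshift : (fun i => levelLaw c (Fintype.card V) k h (j + (i + 1))) =
        fun i => levelLaw c (Fintype.card V) k h (j + 1 + i) := by
      funext i
      rw [← add_assoc, Nat.add_right_comm]
    simp only [Function.comp_apply]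
    rw [hshift, ← ih, PMF.map_comp, PMF.map_comp]
    refine congrArg (fun f => PMF.map f _) (funext fun f => ?_)
    simp only [Function.comp_apply]
    rw [simulate_succ]
    rfl

/-- The simulation has the law of the output of Sampler. -/
theorem map_simulate_seedLaw (hinj : Set.InjOn ident G.edgeSet) :
    (PMF.indep fun _ : V => seedLaw c (Fintype.card V) k h).map
      (simulate G ident c k h 0 some k) = output G c k h := by
  have h := map_simulate (c := c) (k := k) (h := h) hinj k 0 some
  simp only [zero_add] at h
  exact h

end Simulation

end Sampler

namespace Sampler

section Trials

variable {V : Type} [Fintype V] {G : SimpleGraph V} {cl : V → Option V} {v : V} {τ : ℝ}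

/-! ### The invariants of an exploration -/

/-- What holds whenever the node `v` has processed some query edges: the found edges lead to
distinct neighbours, and an edge is unexplored if and only if its neighbour has not been found. -/
structure Explored (G : SimpleGraph V) (cl : V → Option V) (v : V) (τ : ℝ)
    (s : Finset (Sym2 V) × List (Sym2 V)) : Prop where
  unexplored_subset : s.1 ⊆ edgesAt G cl v
  found_mem : ∀ e ∈ s.2, e ∈ edgesAt G cl v
  nodup : (s.2.map (leadsTo G cl v)).Nodup
  mem_iff : ∀ e ∈ edgesAt G cl v, e ∈ s.1 ↔ leadsTo G cl v e ∉ s.2.map (leadsTo G cl v)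
  length_le : 0 ≤ τ → (s.2.length : ℝ) ≤ τ + 1

lemma Explored.init : Explored G cl v τ (edgesAt G cl v, []) where
  unexplored_subset := subset_rfl
  found_mem := by simp
  nodup := by simp
  mem_iff := by simp
  length_le := by simp; intro; linarith

lemma Explored.explore {s : Finset (Sym2 V) × List (Sym2 V)} (hs : Explored G cl v τ s)
    (e : Sym2 V) : Explored G cl v τ (explore G cl v τ s e) := by
  unfold Sampler.explore
  split_ifs with h
  · have he := hs.unexplored_subset h.1
    refine ⟨(Finset.filter_subset _ _).trans hs.unexplored_subset, ?_, ?_, ?_, ?_⟩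
    · intro e' he'
      rcases List.mem_append.1 he' with he' | he'
      · exact hs.found_mem e' he'
      · rw [List.mem_singleton.1 he']
        exact he
    · rw [List.map_append, List.nodup_append]
      refine ⟨hs.nodup, by simp, ?_⟩
      intro a ha b hb hab
      simp only [List.map_cons, List.map_nil, List.mem_singleton] at hb
      exact (hs.mem_iff e he).1 h.1 (hb ▸ hab ▸ ha)
    · intro e' he'
      rw [Finset.mem_filter, hs.mem_iff e' he']
      simp only [List.map_append, List.map_cons, List.map_nil, List.mem_append, List.mem_singleton,
        not_or]
    · intro _
      simp only [List.length_append, List.length_singleton, Nat.cast_add, Nat.cast_one]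
      linarith [h.2]
  · exact hs

lemma Explored.foldl {s : Finset (Sym2 V) × List (Sym2 V)} (hs : Explored G cl v τ s)
    (Q : List (Sym2 V)) : Explored G cl v τ (Q.foldl (Sampler.explore G cl v τ) s) := by
  induction Q generalizing s with
  | nil => exact hs
  | cons e Q ih => exact ih (hs.explore e)

lemma Explored.foldStream [Nonempty V] {s : Finset (Sym2 V) × List (Sym2 V)}
    (hs : Explored G cl v τ s) (ident : Sym2 V → ℕ) (t : ℕ) (us : ℕ → ℕ → ℕ) (i : ℕ) :
    Explored G cl v τ (foldStream (trialStep G ident cl v τ t) s us i) := by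
  induction i with
  | zero => exact hs
  | succ i ih => exact ih.foldl _

/-! ### One trial either reaches the target or shrinks the set of unexplored edges -/

lemma length_le_foldl_explore (Q : List (Sym2 V)) (s : Finset (Sym2 V) × List (Sym2 V)) :
    s.2.length ≤ (Q.foldl (explore G cl v τ) s).2.length := by
  induction Q generalizing s with
  | nil => exact le_rfl
  | cons e Q ih =>
    refine le_trans ?_ (ih _)
    unfold explore
    split_ifs <;> simp

/-- The weight `2 ^ (-|F|)` of a state in which more than `m` edges are unexplored and the target is
not reached. Its expectation decreases by a constant factor with every draw. -/
def weight (τ m : ℝ) (s : Finset (Sym2 V) × List (Sym2 V)) : ℝ≥0∞ :=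
  if m < s.1.card ∧ (s.2.length : ℝ) < τ then 2⁻¹ ^ s.2.length else 0

lemma expect_weight_le {X : Finset (Sym2 V)} (hX : X.Nonempty) {m : ℝ} {ρ : ℝ≥0∞}
    (hρ : ∀ a b : ℕ, a + b = X.card → m < a →
      ((b : ℝ≥0∞) + a * 2⁻¹) * (X.card : ℝ≥0∞)⁻¹ ≤ ρ) (t : ℕ)
    (s : Finset (Sym2 V) × List (Sym2 V)) (hs : s.1 ⊆ X) :
    ((draw X hX t).expect fun Q => weight τ m (Q.foldl (explore G cl v τ) s)) ≤
      ρ ^ t * 2⁻¹ ^ s.2.length := by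
  induction t generalizing s with
  | zero =>
    rw [draw, PMF.expect_pure, List.foldl_nil, pow_zero, one_mul, weight]
    split_ifs
    · exact le_rfl
    · exact zero_le
  | succ t ih =>
    by_cases hm : m < s.1.card ∧ (s.2.length : ℝ) < τ
    swap
    · refine (PMF.expect_mono _ (g := fun _ => 0) fun Q => ?_).trans ?_
      · rw [weight, if_neg]
        rintro ⟨h1, h2⟩
        refine hm ⟨h1.trans_le ?_, lt_of_le_of_lt ?_ h2⟩
        · exact Nat.cast_le.2 (Finset.card_le_card (foldl_explore_subset _ _ _ _ _))
        · exact Nat.cast_le.2 (length_le_foldl_explore _ _)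
      · rw [PMF.expect_const]
        exact zero_le
    · rw [draw, PMF.expect_bind]
      have hstep : ∀ e, (((draw X hX t).bind fun l => PMF.pure (e :: l)).expect fun Q =>
          weight τ m (Q.foldl (explore G cl v τ) s)) ≤
            ρ ^ t * (2⁻¹ ^ s.2.length * if e ∈ s.1 then 2⁻¹ else 1) := by
        intro e
        rw [PMF.expect_bind]
        simp only [PMF.expect_pure, List.foldl_cons]
        by_cases he : e ∈ s.1
        · rw [explore, if_pos ⟨he, hm.2⟩, if_pos he]
          refine (ih _ ((Finset.filter_subset _ _).trans hs)).trans (le_of_eq ?_)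
          simp [pow_succ]
        · rw [explore, if_neg (fun h => he h.1), if_neg he, mul_one]
          exact ih _ hs
      refine (PMF.expect_mono _ hstep).trans ?_
      rw [PMF.expect, tsum_eq_sum (s := X)
        (fun e he => by rw [PMF.uniformOfFinset_apply_of_notMem _ he, zero_mul]),
        Finset.sum_congr rfl (fun e he => by rw [PMF.uniformOfFinset_apply_of_mem _ he])]
      have hsum : ∑ e ∈ X, (if e ∈ s.1 then (2⁻¹ : ℝ≥0∞) else 1) =
          ((X \ s.1).card : ℝ≥0∞) + s.1.card * 2⁻¹ := by
        rw [← Finset.sum_sdiff hs,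
          Finset.sum_congr rfl (fun e he => if_neg (Finset.mem_sdiff.1 he).2),
          Finset.sum_congr rfl (fun e he => if_pos he)]
        simp
      calc _ = ρ ^ t * 2⁻¹ ^ s.2.length * ((((X \ s.1).card : ℝ≥0∞) + s.1.card * 2⁻¹) *
            (X.card : ℝ≥0∞)⁻¹) := by
            rw [← hsum, Finset.sum_mul, Finset.mul_sum]
            refine Finset.sum_congr rfl fun e _ => ?_
            ring
        _ ≤ ρ ^ t * 2⁻¹ ^ s.2.length * ρ := by
            refine mul_le_mul_right (hρ _ _ ?_ hm.1) _
            rw [add_comm, Finset.card_sdiff_add_card_eq_card hs]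
        _ = ρ ^ (t + 1) * 2⁻¹ ^ s.2.length := by ring

/-- If the set of unexplored edges does not shrink to a `q`-fraction, then every draw finds a new
neighbour with probability at least `q`. -/
lemma prob_draw_le {X : Finset (Sym2 V)} (hX : X.Nonempty) {q : ℝ} (hq1 : q ≤ 1)
    (t : ℕ) (F : List (Sym2 V)) :
    (draw X hX t).toOuterMeasure {Q | q * X.card < (Q.foldl (explore G cl v τ) (X, F)).1.card ∧
      ((Q.foldl (explore G cl v τ) (X, F)).2.length : ℝ) < τ} ≤
        ENNReal.ofReal (2 ^ ⌈τ⌉₊ * (1 - q / 2) ^ t) := by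
  have hρ : ∀ a b : ℕ, a + b = X.card → q * X.card < a →
      ((b : ℝ≥0∞) + a * 2⁻¹) * (X.card : ℝ≥0∞)⁻¹ ≤ ENNReal.ofReal (1 - q / 2) := by
    intro a b hab hlt
    have hX0 : (0 : ℝ) < X.card := by exact_mod_cast hX.card_pos
    have h1 : ((b : ℝ≥0∞) + a * 2⁻¹) * (X.card : ℝ≥0∞)⁻¹ =
        ENNReal.ofReal ((b + a * 2⁻¹) * (X.card : ℝ)⁻¹) := by
      rw [ENNReal.ofReal_mul (by positivity), ENNReal.ofReal_add (by positivity) (by positivity),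
        ENNReal.ofReal_mul (by positivity), ENNReal.ofReal_inv_of_pos hX0,
        ENNReal.ofReal_inv_of_pos two_pos]
      simp
    rw [h1]
    refine ENNReal.ofReal_le_ofReal ?_
    rw [← div_eq_mul_inv, div_le_iff₀ hX0]
    have h2 : (a : ℝ) + b = X.card := by exact_mod_cast hab
    nlinarith
  have h1 := expect_weight_le (τ := τ) (cl := cl) (v := v) (G := G) hX hρ t (X, F) subset_rfl
  have h2 := PMF.mul_prob_le_expect (draw X hX t)
    {Q | q * X.card < (Q.foldl (explore G cl v τ) (X, F)).1.card ∧
      ((Q.foldl (explore G cl v τ) (X, F)).2.length : ℝ) < τ}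
    (fun Q => weight τ (q * X.card) (Q.foldl (explore G cl v τ) (X, F))) (2⁻¹ ^ ⌈τ⌉₊)
    (fun Q hQ => by
      obtain ⟨h1, h2⟩ := hQ
      rw [weight, if_pos ⟨h1, h2⟩]
      refine pow_le_pow_right_of_le_one' (ENNReal.inv_le_one.2 one_le_two) ?_
      exact (Nat.cast_le (α := ℝ)).1 (h2.le.trans (Nat.le_ceil τ)))
  have h3 := h2.trans (h1.trans (mul_le_of_le_one_right' (pow_le_one' (ENNReal.inv_le_one.2
    one_le_two) _)))
  have h4 : (2 : ℝ≥0∞) ^ ⌈τ⌉₊ * 2⁻¹ ^ ⌈τ⌉₊ = 1 := by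
    rw [← mul_pow, ENNReal.mul_inv_cancel two_ne_zero (by simp), one_pow]
  rw [ENNReal.ofReal_mul (by positivity), ENNReal.ofReal_pow (by linarith),
    ENNReal.ofReal_pow (by linarith), ENNReal.ofReal_ofNat]
  calc _ = (2 : ℝ≥0∞) ^ ⌈τ⌉₊ * (2⁻¹ ^ ⌈τ⌉₊ * _) := by rw [← mul_assoc, h4, one_mul]
    _ ≤ _ := mul_le_mul_right h3 _

lemma trials_of_not (t i : ℕ) (s : Finset (Sym2 V) × List (Sym2 V))
    (hs : ¬ (s.1.Nonempty ∧ (s.2.length : ℝ) < τ)) : trials G cl v τ t i s = PMF.pure s := by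
  cases i with
  | zero => rfl
  | succ i => rw [trials, dif_neg hs]

/-- If no trial fails, the set of unexplored edges shrinks geometrically until the target is
reached. -/
lemma prob_trials_le {q : ℝ} (hq0 : 0 ≤ q) (hq1 : q ≤ 1) (t i : ℕ)
    (s : Finset (Sym2 V) × List (Sym2 V)) :
    (trials G cl v τ t i s).toOuterMeasure
      {s' | q ^ i * s.1.card < s'.1.card ∧ (s'.2.length : ℝ) < τ} ≤
        i * ENNReal.ofReal (2 ^ ⌈τ⌉₊ * (1 - q / 2) ^ t) := by
  induction i generalizing s with
  | zero => simp [trials, PMF.toOuterMeasure_pure_apply]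
  | succ i ih =>
    by_cases hs : s.1.Nonempty ∧ (s.2.length : ℝ) < τ
    · rw [trials, dif_pos hs, Nat.cast_succ, add_mul, one_mul, add_comm (_ * _)]
      refine (PMF.prob_bind_le _ _ _ _ _ fun Q hQ => ?_).trans
        (add_le_add_left (prob_draw_le (cl := cl) (v := v) (G := G) (τ := τ) hs.1 hq1 t s.2) _)
      set s₁ := Q.foldl (explore G cl v τ) s with hs₁
      by_cases hτ : (s₁.2.length : ℝ) < τ
      · have hle : (s₁.1.card : ℝ) ≤ q * s.1.card := by
          by_contra hlt
          exact hQ ⟨not_le.1 hlt, hτ⟩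
        refine (MeasureTheory.measure_mono ?_).trans (ih s₁)
        rintro s' ⟨h1, h2⟩
        refine ⟨lt_of_le_of_lt ?_ h1, h2⟩
        rw [pow_succ, mul_assoc]
        exact mul_le_mul_of_nonneg_left hle (pow_nonneg hq0 i)
      · rw [trials_of_not _ _ _ fun h => hτ h.2, PMF.toOuterMeasure_pure_apply,
          if_neg fun h => hτ h.2]
        exact zero_le
    · rw [trials_of_not _ _ _ hs, PMF.toOuterMeasure_pure_apply, if_neg]
      · exact zero_le
      · rintro ⟨h1, h2⟩
        refine hs ⟨?_, h2⟩
        rw [← Finset.card_pos, ← Nat.cast_pos (α := ℝ)]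
        exact lt_of_le_of_lt (by positivity) h1

/-! ### The marks of the centers -/

/-- The nodes of `U` are all unmarked with probability at most `exp (-p |U|)`. -/
lemma prob_centers_le (k j : ℕ) (U : Finset V) :
    (centers V k j).toOuterMeasure {m | ∀ u ∈ U, m u = false} ≤
      ENNReal.ofReal (Real.exp (-(min (centerProb (Fintype.card V) k j) 1 : ℝ≥0) * U.card)) := by
  set p : ℝ≥0 := min (centerProb (Fintype.card V) k j) 1 with hp
  have h1 : ∀ u : V, (PMF.coin (centerProb (Fintype.card V) k j)).expect
      (fun b => if u ∈ U ∧ b = true then 0 else 1) = if u ∈ U then 1 - (p : ℝ≥0∞) else 1 := by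
    intro u
    by_cases hu : u ∈ U
    · simp [hu, PMF.expect, tsum_fintype, PMF.coin, hp]
    · simp [hu, PMF.expect_const]
  have h2 := PMF.expect_indep_prod (fun _ : V => PMF.coin (centerProb (Fintype.card V) k j))
    (fun u b => if u ∈ U ∧ b = true then 0 else 1) (fun u => by
      rw [h1]
      split_ifs
      · exact ne_top_of_le_ne_top ENNReal.one_ne_top tsub_le_self
      · exact ENNReal.one_ne_top)
  simp only [h1] at h2
  rw [Finset.prod_ite_mem, Finset.univ_inter, Finset.prod_const] at h2
  have h3 := PMF.mul_prob_le_expect (centers V k j) {m | ∀ u ∈ U, m u = false}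
    (fun m => ∏ u, if u ∈ U ∧ m u = true then 0 else 1) 1 (fun m hm => by
      refine (Finset.prod_eq_one fun u _ => if_neg ?_).ge
      rintro ⟨hu, h⟩
      rw [hm u hu] at h
      exact Bool.false_ne_true h)
  rw [one_mul] at h3
  refine h3.trans (h2.le.trans ?_)
  rw [neg_mul, mul_comm, ← mul_neg, Real.exp_nat_mul, ENNReal.ofReal_pow (Real.exp_pos _).le]
  refine pow_le_pow_left' ?_ _
  have h4 : (1 : ℝ≥0∞) - p = ENNReal.ofReal (1 - p) := by
    rw [ENNReal.ofReal_sub _ p.coe_nonneg, ENNReal.ofReal_one, ENNReal.ofReal_coe_nnreal]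
  rw [h4]
  exact ENNReal.ofReal_le_ofReal (Real.one_sub_le_exp_neg _)

lemma mark_eq_false_of_joins_eq_none {F : V → List (Sym2 V)} {mark : V → Bool}
    (h : joins G cl F mark v = none) {e : Sym2 V} (he : e ∈ F v) {u : V}
    (hu : leadsTo G cl v e = some u) : mark u = false := by
  unfold joins at h
  split_ifs at h
  rw [List.findSome?_eq_none_iff] at h
  have h1 := h e he
  rw [hu] at h1
  simpa [Option.filter] using h1

end Trials

/-! ### Numerical estimates -/

section Numbers

variable {c : ℝ} {n k h j : ℕ}

lemma two_le_logb (hn : 4 ≤ n) : 2 ≤ Real.logb 2 n := by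
  rw [Real.le_logb_iff_rpow_le one_lt_two (by positivity)]
  norm_num
  exact_mod_cast hn

lemma exp_neg_logb_le (hn : 4 ≤ n) (hc : 0 ≤ c) :
    Real.exp (-(c * Real.logb 2 n)) ≤ (n : ℝ) ^ (-c) := by
  have hn0 : (0 : ℝ) < n := by positivity
  have hlog : Real.log n ≤ Real.logb 2 n := by
    rw [Real.logb]
    refine le_div_self (Real.log_nonneg ?_) (Real.log_pos one_lt_two) ?_
    · exact_mod_cast (by omega : 1 ≤ n)
    · exact Real.log_two_lt_d9.le.trans (by norm_num)
  rw [Real.rpow_def_of_pos hn0]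
  refine Real.exp_le_exp.2 ?_
  nlinarith

lemma delta_pos : 0 < delta k := by
  have h : (1 : ℝ) < 2 ^ (k + 1) := one_lt_pow₀ one_lt_two (Nat.succ_ne_zero k)
  exact one_div_pos.2 (by linarith)

lemma mul_logb_le_target (hn : 4 ≤ n) (hc : 1 ≤ c) : c * Real.logb 2 n ≤ target c n k j := by
  have h1 : (1 : ℝ) ≤ (n : ℝ) ^ ((2 : ℝ) ^ j * delta k) :=
    Real.one_le_rpow (by exact_mod_cast (by omega : 1 ≤ n)) (by
      have := delta_pos (k := k)
      positivity)
  have h2 := two_le_logb hn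
  rw [target, mul_right_comm]
  exact le_mul_of_one_le_right (by positivity) h1

/-- The failure probability of one trial that succeeds if it reaches the target or shrinks the set
of unexplored edges to a `q`-fraction, for `q = n ^ (-1 / h)`. -/
lemma trial_failure_le (hn : 4 ≤ n) (hc : 2 ≤ c) :
    2 ^ ⌈target c n k j⌉₊ * (1 - (n : ℝ) ^ (-(1 / (h : ℝ))) / 2) ^ numQueries c n k h j ≤
      (n : ℝ) ^ (-c) := by
  have hL := two_le_logb hn
  have hn1 : (1 : ℝ) ≤ n := by exact_mod_cast (by omega : 1 ≤ n)
  have hn0 : (0 : ℝ) < n := by linarith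
  set L := Real.logb 2 n with hLdef
  set τ := target c n k j with hτ
  set t := numQueries c n k h j with ht
  set q : ℝ := (n : ℝ) ^ (-(1 / (h : ℝ))) with hq
  have hτ1 : c * L ≤ τ := mul_logb_le_target hn (by linarith)
  have hq1 : q ≤ 1 := Real.rpow_le_one_of_one_le_of_nonpos hn1 (by
    rw [neg_nonpos]; positivity)
  have hq0 : 0 < q := Real.rpow_pos_of_pos hn0 _
  -- the expected number of new neighbours in one trial exceeds the target by a logarithmic factor
  have hqt : c * L ^ 2 * τ ≤ q * t := by
    have h1 : c ^ 2 * (n : ℝ) ^ ((2 : ℝ) ^ j * delta k + 1 / (h : ℝ)) * L ^ 3 ≤ t := Nat.le_ceil _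
    have h2 : q * (n : ℝ) ^ ((2 : ℝ) ^ j * delta k + 1 / (h : ℝ)) =
        (n : ℝ) ^ ((2 : ℝ) ^ j * delta k) := by
      rw [hq, ← Real.rpow_add hn0]
      congr 1
      ring
    calc c * L ^ 2 * τ = c ^ 2 * (q * (n : ℝ) ^ ((2 : ℝ) ^ j * delta k + 1 / (h : ℝ))) * L ^ 3 := by
          rw [h2, hτ, target]; ring
      _ = q * (c ^ 2 * (n : ℝ) ^ ((2 : ℝ) ^ j * delta k + 1 / (h : ℝ)) * L ^ 3) := by ring
      _ ≤ q * t := mul_le_mul_of_nonneg_left h1 hq0.le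
  have h3 : (2 : ℝ) ^ ⌈τ⌉₊ ≤ Real.exp (2 * τ) := by
    have h4 : (2 : ℝ) ≤ Real.exp 1 := by
      have := Real.add_one_le_exp (1 : ℝ)
      linarith
    have h5 : (⌈τ⌉₊ : ℝ) ≤ 2 * τ := by
      have := Nat.ceil_lt_add_one (show 0 ≤ τ by nlinarith)
      nlinarith
    calc (2 : ℝ) ^ ⌈τ⌉₊ ≤ Real.exp 1 ^ ⌈τ⌉₊ := pow_le_pow_left₀ two_pos.le h4 _
      _ = Real.exp (⌈τ⌉₊ : ℝ) := by rw [← Real.exp_nat_mul, mul_one]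
      _ ≤ _ := Real.exp_le_exp.2 h5
  have h6 : (1 - q / 2) ^ t ≤ Real.exp (-(q * t / 2)) := by
    have h7 : 1 - q / 2 ≤ Real.exp (-(q / 2)) := Real.one_sub_le_exp_neg _
    calc (1 - q / 2) ^ t ≤ Real.exp (-(q / 2)) ^ t := pow_le_pow_left₀ (by linarith) h7 _
      _ = _ := by rw [← Real.exp_nat_mul]; congr 1; ring
  refine le_trans ?_ (exp_neg_logb_le hn (by linarith))
  calc _ ≤ Real.exp (2 * τ) * Real.exp (-(q * t / 2)) :=
        mul_le_mul h3 h6 (pow_nonneg (by linarith) _) (Real.exp_pos _).le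
    _ = Real.exp (2 * τ - q * t / 2) := by rw [← Real.exp_add]; congr 1
    _ ≤ _ := by
      refine Real.exp_le_exp.2 ?_
      have hτ0 : 0 ≤ τ := by nlinarith
      have h8 : c * τ * 4 ≤ c * τ * L ^ 2 :=
        mul_le_mul_of_nonneg_left (by nlinarith) (by positivity)
      have h9 : 2 * τ ≤ c * τ := mul_le_mul_of_nonneg_right hc hτ0
      rw [← hLdef]
      linarith

lemma centerProb_mul_target (hn : 4 ≤ n) :
    ((min (centerProb n k j) 1 : ℝ≥0) : ℝ) * target c n k j = c * Real.logb 2 n := by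
  have hn0 : (0 : ℝ) < n := by positivity
  have h1 : centerProb n k j ≤ 1 :=
    NNReal.rpow_le_one_of_one_le_of_nonpos (by exact_mod_cast (by omega : 1 ≤ n)) (by
      have := delta_pos (k := k)
      rw [neg_nonpos]
      positivity)
  rw [min_eq_left h1, centerProb, NNReal.coe_rpow, NNReal.coe_natCast, target, mul_assoc,
    mul_left_comm, ← mul_assoc ((n : ℝ) ^ _), ← Real.rpow_add hn0]
  simp

end Numbers

section Levels

variable {V : Type} [Fintype V] [Nonempty V] {G : SimpleGraph V} {ident : Sym2 V → ℕ}
  {c : ℝ} {k h : ℕ}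

/-! ### The failure probability of one level -/

lemma explored_stateAfter (j : ℕ) (cl : V → Option V) (v : V)
    (us : ℕ → ℕ → ℕ) (i : ℕ) : Explored G cl v (target c (Fintype.card V) k j)
      (stateAfter G ident c k h j cl v us i) :=
  Explored.init.foldStream _ _ _ _

/-- At level `j`, some node neither finds all its neighbours nor reaches the target, or some node
that reaches the target has no center to join. -/
def LevelFails (G : SimpleGraph V) (ident : Sym2 V → ℕ) (c : ℝ) (k h j : ℕ) (cl : V → Option V)
    (a : V → LevelSeed) : Prop :=
  (∃ v, (stateAfter G ident c k h j cl v (a v).1 (2 * h)).1.Nonempty ∧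
    ((lists G ident c k h j cl a v).length : ℝ) < target c (Fintype.card V) k j) ∨
  ∃ v, target c (Fintype.card V) k j ≤ (lists G ident c k h j cl a v).length ∧
    joins G cl (lists G ident c k h j cl a) (fun u => (a u).2) v = none

/-- A node is unlikely to stop its exploration halfway: `2 h` successful trials, each of which
shrinks the set of fewer than `n ^ 2` unexplored edges to an `n ^ (-1 / h)`-fraction, leave no
edge. -/
lemma prob_trialsLaw_le (hinj : Set.InjOn ident G.edgeSet) (hn : 4 ≤ Fintype.card V) (hc : 2 ≤ c)
    (hh : 1 ≤ h) (j : ℕ) (cl : V → Option V) (v : V) :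
    (trialsLaw c (Fintype.card V) k h j).toOuterMeasure
      {us | (stateAfter G ident c k h j cl v us (2 * h)).1.Nonempty ∧
        ((stateAfter G ident c k h j cl v us (2 * h)).2.length : ℝ) <
          target c (Fintype.card V) k j} ≤
      2 * h * ENNReal.ofReal ((Fintype.card V : ℝ) ^ (-c)) := by
  set n := Fintype.card V with hndef
  have hn1 : (1 : ℝ) ≤ n := by exact_mod_cast (by omega : 1 ≤ n)
  have hn0 : (0 : ℝ) < n := by linarith
  have hh0 : (h : ℝ) ≠ 0 := by positivity
  have h1 := trials_eq (G := G) ident cl v (target c n k j) (numQueries c n k h j) (2 * h)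
    (edgesAt G cl v, []) (hinj.mono (edgesAt_subset _ _))
  have h2 := prob_trials_le (G := G) (cl := cl) (v := v) (τ := target c n k j)
    (q := (n : ℝ) ^ (-(1 / (h : ℝ)))) (Real.rpow_nonneg hn0.le _)
    (Real.rpow_le_one_of_one_le_of_nonpos hn1 (by rw [neg_nonpos]; positivity))
    (numQueries c n k h j) (2 * h) (edgesAt G cl v, [])
  rw [h1, PMF.toOuterMeasure_map_apply] at h2
  refine (MeasureTheory.measure_mono ?_).trans (h2.trans ?_)
  · rintro us ⟨hne, hlt⟩
    refine ⟨?_, hlt⟩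
    have h3 : ((n : ℝ) ^ (-(1 / (h : ℝ)))) ^ (2 * h) = ((n : ℝ) ^ 2)⁻¹ := by
      rw [← Real.rpow_natCast, ← Real.rpow_mul hn0.le, ← Real.rpow_natCast _ 2,
        ← Real.rpow_neg hn0.le]
      congr 1
      push_cast
      field_simp
    have h4 : ((edgesAt G cl v).card : ℝ) < (n : ℝ) ^ 2 := by
      have h5 := Finset.card_le_univ (edgesAt G cl v)
      rw [Sym2.card, Nat.choose_two_right, Nat.add_sub_cancel] at h5
      have h6 : (n + 1) * n / 2 < n ^ 2 := by
        rw [Nat.div_lt_iff_lt_mul two_pos]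
        nlinarith
      exact_mod_cast h5.trans_lt h6
    calc _ = ((n : ℝ) ^ 2)⁻¹ * (edgesAt G cl v).card := by rw [h3]
      _ < 1 := by rw [inv_mul_lt_one₀ (by positivity)]; exact h4
      _ ≤ _ := by exact_mod_cast hne.card_pos
  · push_cast
    exact mul_le_mul_right (ENNReal.ofReal_le_ofReal (trial_failure_le hn hc)) _

/-- A node that reaches its target is unlikely to have no center to join, since its found edges lead
to distinct neighbours, which are marked independently. -/
lemma prob_joins_le (hn : 4 ≤ Fintype.card V) (hc : 2 ≤ c) (j : ℕ) (cl : V → Option V)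
    (us : V → ℕ → ℕ → ℕ) (v : V) :
    (centers V k j).toOuterMeasure {m | target c (Fintype.card V) k j ≤
        (lists G ident c k h j cl (fun u => (us u, m u)) v).length ∧
      joins G cl (lists G ident c k h j cl fun u => (us u, m u)) m v = none} ≤
      ENNReal.ofReal ((Fintype.card V : ℝ) ^ (-c)) := by
  set F := (stateAfter G ident c k h j cl v (us v) (2 * h)).2 with hF
  have hE := explored_stateAfter (G := G) (ident := ident) (c := c) (k := k) (h := h) j cl v (us v)
    (2 * h)
  by_cases hτ : target c (Fintype.card V) k j ≤ F.length
  swap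
  · refine le_trans (le_of_eq ?_) zero_le
    convert MeasureTheory.measure_empty (μ := (centers V k j).toOuterMeasure)
    ext m
    simp only [Set.mem_empty_iff_false, iff_false]
    exact fun h => hτ h.1
  set U : Finset V := Finset.univ.filter fun u => some u ∈ F.map (leadsTo G cl v) with hU
  have hcard : U.card = F.length := by
    have h1 : U.image some = (F.map (leadsTo G cl v)).toFinset := by
      ext o
      simp only [hU, Finset.mem_image, Finset.mem_filter, Finset.mem_univ, true_and,
        List.mem_toFinset]
      constructor
      · rintro ⟨u, hu, rfl⟩
        exact hu
      · intro ho
        obtain ⟨e, he, rfl⟩ := List.mem_map.1 ho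
        have h2 := hE.found_mem e he
        rw [edgesAt, Finset.mem_filter, Option.isSome_iff_exists] at h2
        obtain ⟨-, u, hu⟩ := h2
        exact ⟨u, hu ▸ ho, hu.symm⟩
    rw [← Finset.card_image_of_injective U (Option.some_injective V), h1,
      List.toFinset_card_of_nodup hE.nodup, List.length_map]
  refine le_trans (MeasureTheory.measure_mono ?_) ((prob_centers_le k j U).trans ?_)
  · rintro m ⟨-, hm⟩ u hu
    rw [hU, Finset.mem_filter] at hu
    obtain ⟨e, he, hu⟩ := List.mem_map.1 hu.2
    exact mark_eq_false_of_joins_eq_none hm he hu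
  · refine ENNReal.ofReal_le_ofReal (le_trans ?_ (exp_neg_logb_le hn (by linarith)))
    refine Real.exp_le_exp.2 ?_
    rw [← centerProb_mul_target (k := k) (j := j) hn, neg_mul, neg_le_neg_iff, hcard]
    exact mul_le_mul_of_nonneg_left hτ (NNReal.coe_nonneg _)

lemma prob_levelFails_le (hinj : Set.InjOn ident G.edgeSet) (hn : 4 ≤ Fintype.card V) (hc : 2 ≤ c)
    (hh : 1 ≤ h) (j : ℕ) (cl : V → Option V) :
    (PMF.indep fun _ : V => levelLaw c (Fintype.card V) k h j).toOuterMeasure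
      {a | LevelFails G ident c k h j cl a} ≤
      Fintype.card V * (2 * h + 1) * ENNReal.ofReal ((Fintype.card V : ℝ) ^ (-c)) := by
  rw [indep_levelLaw, mul_add, add_mul, mul_one, mul_assoc]
  have h1 := PMF.prob_exists_le (PMF.indep fun _ : V => trialsLaw c (Fintype.card V) k h j)
    Finset.univ (fun v us => (stateAfter G ident c k h j cl v (us v) (2 * h)).1.Nonempty ∧
        ((stateAfter G ident c k h j cl v (us v) (2 * h)).2.length : ℝ) <
          target c (Fintype.card V) k j) _ (fun v _ => by
      rw [PMF.prob_indep_eval (fun _ : V => trialsLaw c (Fintype.card V) k h j) v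
        fun us => (stateAfter G ident c k h j cl v us (2 * h)).1.Nonempty ∧
          ((stateAfter G ident c k h j cl v us (2 * h)).2.length : ℝ) <
            target c (Fintype.card V) k j]
      exact prob_trialsLaw_le hinj hn hc hh j cl v)
  refine (PMF.prob_bind_le _ _ _ _ _ fun us hus => ?_).trans (add_le_add_left h1 _)
  rw [PMF.toOuterMeasure_map_apply]
  refine le_trans (MeasureTheory.measure_mono ?_)
    (PMF.prob_exists_le (centers V k j) Finset.univ _ _
      fun v _ => prob_joins_le (G := G) (ident := ident) (h := h) hn hc j cl us v)
  rintro m (⟨v, hv⟩ | ⟨v, hv⟩)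
  · exact absurd ⟨v, Finset.mem_univ v, hv⟩ hus
  · exact ⟨v, Finset.mem_univ v, hv⟩

lemma prob_exists_levelFails_le (hinj : Set.InjOn ident G.edgeSet) (hn : 4 ≤ Fintype.card V)
    (hc : 2 ≤ c) (hh : 1 ≤ h) (r j : ℕ) (cl : V → Option V) :
    (PMF.indep fun _ : V => streamLaw (fun i => levelLaw c (Fintype.card V) k h (j + i))
      r).toOuterMeasure {ω | ∃ i < r, LevelFails G ident c k h (j + i)
        (clusters G ident c k h j cl ω i) fun v => ω v i} ≤
      r * (Fintype.card V * (2 * h + 1) * ENNReal.ofReal ((Fintype.card V : ℝ) ^ (-c))) := by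
  induction r generalizing j cl with
  | zero => simp
  | succ r ih =>
    rw [indep_streamLaw_succ, add_zero, Nat.cast_succ, add_mul (r : ℝ≥0∞), one_mul,
      add_comm (_ * _)]
    refine (PMF.prob_bind_le _ _ _ _ _ fun a ha => ?_).trans
      (add_le_add_left (prob_levelFails_le hinj hn hc hh j cl) _)
    have hshift : (fun i => levelLaw c (Fintype.card V) k h (j + (i + 1))) =
        fun i => levelLaw c (Fintype.card V) k h (j + 1 + i) := by
      funext i
      rw [← add_assoc, Nat.add_right_comm]
    rw [PMF.toOuterMeasure_map_apply, hshift]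
    refine le_trans (MeasureTheory.measure_mono ?_) (ih (j + 1)
      (nextClusters G cl (lists G ident c k h j cl a) fun v => (a v).2))
    rintro f ⟨i, hi, hf⟩
    rcases i with _ | i
    · exact absurd hf ha
    · refine ⟨i, by omega, ?_⟩
      rw [clusters_succ', ← add_assoc, Nat.add_right_comm] at hf
      exact hf

end Levels

/-! ### The number of nodes of the cluster graphs -/

section Counts

variable {c : ℝ} {n k h : ℕ}

/-- The expected number `n ^ (1 - (2 ^ j - 1) δ)` of nodes that are marked at all levels below
`j`. -/
def expectedNodes (n k j : ℕ) : ℝ := (n : ℝ) ^ (1 - ((2 : ℝ) ^ j - 1) * delta k)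

lemma expect_mark_le (j : ℕ) :
    ((levelLaw c n k h j).expect fun a => if a.2 = true then 1 else 0) ≤ centerProb n k j := by
  rw [levelLaw, PMF.expect_bind]
  simp only [PMF.expect_map]
  refine (PMF.expect_mono _ fun us => ?_).trans (PMF.expect_const (trialsLaw c n k h j) _).le
  rw [PMF.expect, tsum_fintype]
  simp [PMF.coin]

lemma expect_marks_le (j r i : ℕ) (hj : j ≤ r) :
    ((streamLaw (fun l => levelLaw c n k h (i + l)) r).expect
      fun f => if ∀ l < j, (f l).2 = true then 1 else 0) ≤
        ∏ l ∈ Finset.range j, (centerProb n k (i + l) : ℝ≥0∞) := by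
  induction j generalizing r i with
  | zero =>
    rw [Finset.prod_range_zero]
    refine (PMF.expect_mono _ fun f => ?_).trans (PMF.expect_const _ 1).le
    split_ifs <;> simp
  | succ j ih =>
    obtain ⟨r, rfl⟩ : ∃ r', r = r' + 1 := ⟨r - 1, by omega⟩
    have hshift : (fun l => levelLaw c n k h (i + (l + 1))) =
        fun l => levelLaw c n k h (i + 1 + l) := by
      funext l
      rw [← add_assoc, Nat.add_right_comm]
    rw [streamLaw, PMF.expect_bind, Finset.prod_range_succ', add_zero]
    simp only [PMF.expect_map, hshift]
    set P := ∏ l ∈ Finset.range j, (centerProb n k (i + (l + 1)) : ℝ≥0∞) with hP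
    have hP' : P = ∏ l ∈ Finset.range j, (centerProb n k (i + 1 + l) : ℝ≥0∞) := by
      refine Finset.prod_congr rfl fun l _ => ?_
      rw [← add_assoc, Nat.add_right_comm]
    have h1 : ∀ a : LevelSeed, ((streamLaw (fun l => levelLaw c n k h (i + 1 + l)) r).expect
        fun f => if ∀ l < j + 1, (streamCons a f l).2 = true then 1 else 0) ≤
          P * if a.2 = true then 1 else 0 := by
      intro a
      by_cases ha : a.2 = true
      · rw [if_pos ha, mul_one, hP']
        refine (PMF.expect_mono _ fun f => ?_).trans (ih r (i + 1) (by omega))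
        have h2 : (∀ l < j + 1, (streamCons a f l).2 = true) ↔ ∀ l < j, (f l).2 = true := by
          constructor
          · intro h l hl
            exact h (l + 1) (by omega)
          · rintro h (_ | l) hl
            · exact ha
            · exact h l (by omega)
        simp only [h2, le_refl]
      · rw [if_neg ha, mul_zero]
        refine (PMF.expect_mono _ fun f => ?_).trans (PMF.expect_const _ 0).le
        rw [if_neg]
        exact fun h => ha (h 0 (by omega))
    refine (PMF.expect_mono _ h1).trans ?_
    rw [PMF.expect]
    simp only [mul_left_comm _ P]
    rw [ENNReal.tsum_mul_left]
    exact mul_le_mul_right (expect_mark_le i) _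

lemma prod_centerProb (hn : 4 ≤ n) (j : ℕ) :
    ∏ l ∈ Finset.range j, centerProb n k l = (n : ℝ≥0) ^ (-(((2 : ℝ) ^ j - 1) * delta k)) := by
  have hn0 : (n : ℝ≥0) ≠ 0 := by positivity
  induction j with
  | zero => simp
  | succ j ih =>
    rw [Finset.prod_range_succ, ih, centerProb, ← NNReal.rpow_add hn0]
    congr 1
    ring

lemma one_le_expectedNodes (hn : 4 ≤ n) {j : ℕ} (hj : j ≤ k) : 1 ≤ expectedNodes n k j := by
  refine Real.one_le_rpow (by exact_mod_cast (by omega : 1 ≤ n)) ?_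
  have h1 : (1 : ℝ) < 2 ^ (k + 1) := one_lt_pow₀ one_lt_two (Nat.succ_ne_zero k)
  have h2 : (2 : ℝ) ^ j ≤ 2 ^ (k + 1) := pow_le_pow_right₀ one_le_two (by omega)
  rw [delta, mul_one_div, sub_nonneg, div_le_one (by linarith)]
  linarith

/-- A Chernoff bound for the number `X` of nodes that are marked at all levels below `j`, from the
expectation of `2 ^ X`. -/
lemma prob_card_marked_le {V : Type} [Fintype V] (hn : 4 ≤ Fintype.card V) (hc : 2 ≤ c) {j : ℕ}
    (hj : j ≤ k) :
    (PMF.indep fun _ : V => seedLaw c (Fintype.card V) k h).toOuterMeasure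
      {ω | c * Real.logb 2 (Fintype.card V) * expectedNodes (Fintype.card V) k j ≤
        (Finset.univ.filter fun v => ∀ i < j, (ω v i).2 = true).card} ≤
      ENNReal.ofReal ((Fintype.card V : ℝ) ^ (1 - c)) := by
  set n := Fintype.card V with hndef
  have hn1 : (1 : ℝ) ≤ n := by exact_mod_cast (by omega : 1 ≤ n)
  have hn0 : (0 : ℝ) < n := by linarith
  set μ := expectedNodes n k j with hμ
  set L := Real.logb 2 n with hL
  set q : ℝ≥0 := (n : ℝ≥0) ^ (-(((2 : ℝ) ^ j - 1) * delta k)) with hq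
  have hμ1 : 1 ≤ μ := one_le_expectedNodes hn hj
  have hqμ : (n : ℝ) * q = μ := by
    rw [hq, NNReal.coe_rpow, NNReal.coe_natCast, hμ, expectedNodes, sub_eq_add_neg 1,
      Real.rpow_add hn0, Real.rpow_one]
  have hE : ∀ _ : V, (seedLaw c n k h).expect
      (fun f => if ∀ i < j, (f i).2 = true then 2 else 1) ≤ 1 + (q : ℝ≥0∞) := by
    intro _
    have h1 := expect_marks_le (c := c) (n := n) (k := k) (h := h) j (k + 1) 0 (by omega)
    simp only [zero_add] at h1
    have h2 : ∏ l ∈ Finset.range j, (centerProb n k l : ℝ≥0∞) = q := by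
      rw [hq, ← prod_centerProb hn, ENNReal.ofNNReal_finsetProd]
    rw [h2] at h1
    have h3 : (fun f : Seed => if ∀ i < j, (f i).2 = true then (2 : ℝ≥0∞) else 1) =
        fun f => 1 + if ∀ i < j, (f i).2 = true then 1 else 0 := by
      funext f
      split_ifs
      · exact one_add_one_eq_two.symm
      · rw [add_zero]
    rw [h3, PMF.expect_add, PMF.expect_const]
    exact add_le_add_right h1 _
  have h1 := PMF.expect_indep_prod (fun _ : V => seedLaw c n k h)
    (fun _ f => if ∀ i < j, (f i).2 = true then 2 else 1)
    (fun v => ne_top_of_le_ne_top (by simp) (hE v))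
  have h2 := PMF.mul_prob_le_expect (PMF.indep fun _ : V => seedLaw c n k h)
    {ω | c * L * μ ≤ (Finset.univ.filter fun v => ∀ i < j, (ω v i).2 = true).card}
    (fun ω => ∏ v, if ∀ i < j, (ω v i).2 = true then 2 else 1) (2 ^ ⌈c * L * μ⌉₊) (fun ω hω => by
      rw [Finset.prod_ite, Finset.prod_const, Finset.prod_const_one, mul_one]
      exact pow_le_pow_right₀ one_le_two (Nat.ceil_le.2 hω))
  have h3 : ∏ v : V, (seedLaw c n k h).expect
      (fun f => if ∀ i < j, (f i).2 = true then 2 else 1) ≤ ENNReal.ofReal (Real.exp μ) := by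
    calc _ ≤ ∏ _v : V, (1 + (q : ℝ≥0∞)) := Finset.prod_le_prod' fun v _ => hE v
      _ = ENNReal.ofReal ((1 + q) ^ n) := by
        rw [Finset.prod_const, Finset.card_univ, ENNReal.ofReal_pow (by positivity),
          ENNReal.ofReal_add zero_le_one q.coe_nonneg, ENNReal.ofReal_one,
          ENNReal.ofReal_coe_nnreal]
      _ ≤ _ := by
        refine ENNReal.ofReal_le_ofReal ?_
        rw [← hqμ, Real.exp_nat_mul]
        refine pow_le_pow_left₀ (by positivity) ?_ _
        rw [add_comm]
        exact Real.add_one_le_exp _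
  set P := (PMF.indep fun _ : V => seedLaw c n k h).toOuterMeasure
    {ω | c * L * μ ≤ (Finset.univ.filter fun v => ∀ i < j, (ω v i).2 = true).card} with hP
  have h4 : (2 : ℝ≥0∞) ^ ⌈c * L * μ⌉₊ * P ≤ ENNReal.ofReal (Real.exp μ) :=
    h2.trans (h1.le.trans h3)
  have hPtop : P ≠ ∞ := ne_top_of_le_ne_top ENNReal.one_ne_top (PMF.prob_le_one _ _)
  rw [ENNReal.le_ofReal_iff_toReal_le (ENNReal.mul_ne_top (by simp) hPtop) (Real.exp_pos _).le,
    ENNReal.toReal_mul, ENNReal.toReal_pow, ENNReal.toReal_ofNat] at h4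
  rw [ENNReal.le_ofReal_iff_toReal_le hPtop (by positivity)]
  have hL2 := two_le_logb hn
  have h5 : (n : ℝ) ^ (c * μ) ≤ 2 ^ ⌈c * L * μ⌉₊ := by
    calc (n : ℝ) ^ (c * μ) = ((2 : ℝ) ^ L) ^ (c * μ) := by
          rw [hL, Real.rpow_logb two_pos (by norm_num) hn0]
      _ = (2 : ℝ) ^ (c * L * μ) := by
          rw [← Real.rpow_mul two_pos.le]
          congr 1
          ring
      _ ≤ (2 : ℝ) ^ (⌈c * L * μ⌉₊ : ℝ) :=
        Real.rpow_le_rpow_of_exponent_le one_le_two (Nat.le_ceil _)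
      _ = _ := Real.rpow_natCast _ _
  have h6 : Real.exp μ ≤ (n : ℝ) ^ μ := by
    rw [Real.rpow_def_of_pos hn0]
    refine Real.exp_le_exp.2 (le_mul_of_one_le_left (by linarith) ?_)
    rw [Real.le_log_iff_exp_le hn0]
    have h7 : (4 : ℝ) ≤ n := by exact_mod_cast hn
    exact Real.exp_one_lt_d9.le.trans (by linarith)
  have h8 : (n : ℝ) ^ (c * μ) * P.toReal ≤ (n : ℝ) ^ μ :=
    (mul_le_mul_of_nonneg_right h5 ENNReal.toReal_nonneg).trans (h4.trans h6)
  have h9 : P.toReal ≤ (n : ℝ) ^ (μ - c * μ) := by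
    rw [Real.rpow_sub hn0, le_div_iff₀ (by positivity), mul_comm]
    exact h8
  refine h9.trans (Real.rpow_le_rpow_of_exponent_le hn1 ?_)
  nlinarith

end Counts

/-! ### Executions of Sampler -/

/-- An execution of Sampler: the input, the parameters and the random seeds of all nodes. -/
structure Execution (V : Type) where
  /-- The input graph. -/
  graph : SimpleGraph V
  /-- The edge IDs. -/
  ident : Sym2 V → ℕ
  /-- The constant in the targets and in the numbers of queries. -/
  c : ℝ
  /-- The number of the last level. -/
  k : ℕ
  /-- Half the number of trials in each level. -/
  h : ℕ
  /-- The random seeds. -/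
  seed : V → Seed

namespace Execution

variable {V : Type} [Fintype V] [Nonempty V] (E : Execution V)

/-- The number of neighbours that a node tries to find at level `j`. -/
def goal (j : ℕ) : ℝ := target E.c (Fintype.card V) E.k j

/-- The cluster graph of level `j`. -/
def cluster : ℕ → V → Option V
  | 0 => some
  | j + 1 => nextClusters E.graph (cluster j)
      (lists E.graph E.ident E.c E.k E.h j (cluster j) fun v => E.seed v j) fun v => (E.seed v j).2

/-- The unexplored edges and the list of `v` at level `j` after `i` trials. -/
def state (j : ℕ) (v : V) (i : ℕ) : Finset (Sym2 V) × List (Sym2 V) :=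
  stateAfter E.graph E.ident E.c E.k E.h j (E.cluster j) v (E.seed v j).1 i

/-- The list of `v` at the end of level `j`. -/
def found (j : ℕ) (v : V) : List (Sym2 V) := (E.state j v (2 * E.h)).2

/-- The node of the cluster graph to which an edge leads from `v` at level `j`. -/
def leads (j : ℕ) (v : V) (e : Sym2 V) : Option V := leadsTo E.graph (E.cluster j) v e

/-- Whether `v` is marked at level `j`. -/
def mark (j : ℕ) (v : V) : Bool := (E.seed v j).2

/-- The cluster that `v` joins at level `j`. -/
def join (j : ℕ) (v : V) : Option V := joins E.graph (E.cluster j) (E.found j) (E.mark j) v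

/-- The vertices that are marked at all levels below `j`. -/
def marked (j : ℕ) : Finset V := Finset.univ.filter fun v => ∀ i < j, E.mark i v = true

/-- The edges that the levels up to `k` put into the spanner. -/
def spanner : Finset (Sym2 V) := (Finset.range (E.k + 1)).biUnion fun j => edgesOf (E.found j)

lemma cluster_succ (j : ℕ) (x : V) : E.cluster (j + 1) x = (E.cluster j x).bind (E.join j) := rfl

/-- The typical executions: all nodes find all their neighbours or reach the target, the nodes that
reach the target join a cluster, and the number of nodes is close to its expectation. -/
structure Good : Prop where
  explored : ∀ j ≤ E.k, ∀ v, (E.state j v (2 * E.h)).1 = ∅ ∨ E.goal j ≤ (E.found j v).length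
  joined : ∀ j ≤ E.k, ∀ v, E.goal j ≤ (E.found j v).length → E.join j v ≠ none
  few : ∀ j ≤ E.k, ((E.marked j).card : ℝ) <
    E.c * Real.logb 2 (Fintype.card V) * expectedNodes (Fintype.card V) E.k j

end Execution

section

variable {V : Type} [Fintype V] [Nonempty V] (G : SimpleGraph V) (ident : Sym2 V → ℕ) (c : ℝ)
  (k h : ℕ)

lemma clusters_eq_cluster (ω : V → Seed) (j : ℕ) : clusters G ident c k h 0 some ω j =
    (Execution.mk G ident c k h ω).cluster j := by
  induction j with
  | zero => rfl
  | succ j ih => rw [clusters, ih, zero_add]; rfl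

lemma simulate_eq_spanner (ω : V → Seed) : simulate G ident c k h 0 some k ω =
    (Execution.mk G ident c k h ω).spanner := by
  refine Finset.biUnion_congr rfl fun j _ => ?_
  rw [clusters_eq_cluster, zero_add]
  rfl

variable {G ident c k h}

/-- Executions are good with high probability. -/
theorem holdsUpTo_good {d : ℝ} (hinj : Set.InjOn ident G.edgeSet) (hn : 4 ≤ Fintype.card V)
    (hc : 2 ≤ c) (hcd : d + 4 ≤ c) (hk : k + 1 ≤ Fintype.card V) (hh1 : 1 ≤ h)
    (hh : h ≤ Fintype.card V) :
    (PMF.indep fun _ : V => seedLaw c (Fintype.card V) k h).HoldsUpTo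
      ((Fintype.card V : ℝ) ^ (-d)) fun ω => (Execution.mk G ident c k h ω).Good := by
  set n := Fintype.card V with hndef
  have hn1 : (1 : ℝ) ≤ n := by exact_mod_cast (by omega : 1 ≤ n)
  have hn0 : (0 : ℝ) < n := by linarith
  set P := PMF.indep fun _ : V => seedLaw c n k h with hP
  have h1 := prob_exists_levelFails_le (c := c) (k := k) hinj hn hc hh1 (k + 1) 0 some
  simp only [zero_add] at h1
  have h2 := PMF.prob_exists_le P (Finset.range (k + 1)) (fun j ω =>
    c * Real.logb 2 n * expectedNodes n k j ≤
      (Finset.univ.filter fun v => ∀ i < j, (ω v i).2 = true).card) _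
      (fun j hj => prob_card_marked_le (h := h) hn hc (by
        rw [Finset.mem_range] at hj
        omega))
  rw [Finset.card_range] at h2
  unfold PMF.HoldsUpTo
  refine (MeasureTheory.measure_mono ?_).trans ((MeasureTheory.measure_union_le _ _).trans
    ((add_le_add h1 h2).trans ?_))
  · intro ω hω
    by_contra hnot
    simp only [Set.mem_union, not_or] at hnot
    obtain ⟨hA, hB⟩ := hnot
    have hA' : ∀ j ≤ k, ¬ LevelFails G ident c k h j
        ((Execution.mk G ident c k h ω).cluster j) fun v => ω v j := by
      intro j hj hf
      refine hA ⟨j, by omega, ?_⟩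
      rw [clusters_eq_cluster]
      exact hf
    refine hω ⟨fun j hj v => ?_, fun j hj v hv hnone => ?_, fun j hj => ?_⟩
    · by_contra hv
      rw [not_or, not_le] at hv
      exact hA' j hj (Or.inl ⟨v, Finset.nonempty_iff_ne_empty.2 hv.1, hv.2⟩)
    · exact hA' j hj (Or.inr ⟨v, hv, hnone⟩)
    · by_contra hj'
      exact hB ⟨j, Finset.mem_range.2 (Nat.lt_succ_of_le hj), not_lt.1 hj'⟩
  · have e1 : (2 * (h : ℝ≥0∞) + 1) = ENNReal.ofReal (2 * h + 1) := by
      rw [ENNReal.ofReal_add (by positivity) zero_le_one, ENNReal.ofReal_mul two_pos.le]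
      simp
    have e2 : ∀ m : ℕ, (m : ℝ≥0∞) = ENNReal.ofReal m := fun m => by simp
    rw [e1, e2, e2 n, ← ENNReal.ofReal_mul hn0.le, ← ENNReal.ofReal_mul (by positivity),
      ← ENNReal.ofReal_mul (by positivity), ← ENNReal.ofReal_mul (by positivity),
      ← ENNReal.ofReal_add (by positivity) (by positivity)]
    refine ENNReal.ofReal_le_ofReal ?_
    have hk' : ((k + 1 : ℕ) : ℝ) ≤ n := by exact_mod_cast hk
    have hh' : (h : ℝ) ≤ n := by exact_mod_cast hh
    have hn4 : (4 : ℝ) ≤ n := by exact_mod_cast hn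
    have hp : 0 < (n : ℝ) ^ (-c) := Real.rpow_pos_of_pos hn0 _
    have e3 : (n : ℝ) ^ (1 - c) = n * (n : ℝ) ^ (-c) := by
      rw [sub_eq_add_neg, Real.rpow_add hn0, Real.rpow_one]
    have e4 : (n : ℝ) ^ (4 - c) = (n : ℝ) ^ 4 * (n : ℝ) ^ (-c) := by
      rw [sub_eq_add_neg, Real.rpow_add hn0]
      norm_cast
    calc _ ≤ (n : ℝ) * (n * (2 * n + 1) * (n : ℝ) ^ (-c)) + n * (n * (n : ℝ) ^ (-c)) := by
          rw [e3]
          gcongr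
      _ = (2 * n ^ 3 + 2 * n ^ 2) * (n : ℝ) ^ (-c) := by ring
      _ ≤ (n : ℝ) ^ 4 * (n : ℝ) ^ (-c) := by
          refine mul_le_mul_of_nonneg_right ?_ hp.le
          nlinarith [sq_nonneg (n : ℝ), mul_nonneg (sq_nonneg (n : ℝ)) hn0.le]
      _ = (n : ℝ) ^ (4 - c) := e4.symm
      _ ≤ _ := Real.rpow_le_rpow_of_exponent_le hn1 (by linarith)

end

/-! ### Short walks -/

section Within

variable {V : Type} {H H' : SimpleGraph V} {x y z : V} {l m : ℕ}

/-- There is a walk of length at most `l` from `x` to `y`. -/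
def Within (H : SimpleGraph V) (l : ℕ) (x y : V) : Prop := ∃ p : H.Walk x y, p.length ≤ l

lemma Within.refl (x : V) : Within H 0 x x := ⟨.nil, le_rfl⟩

lemma Within.symm (h : Within H l x y) : Within H l y x := by
  obtain ⟨p, hp⟩ := h
  exact ⟨p.reverse, by simpa using hp⟩

lemma Within.trans (h : Within H l x y) (h' : Within H m y z) : Within H (l + m) x z := by
  obtain ⟨p, hp⟩ := h
  obtain ⟨q, hq⟩ := h'
  exact ⟨p.append q, by rw [SimpleGraph.Walk.length_append]; omega⟩

lemma Within.of_adj (h : H.Adj x y) : Within H 1 x y := ⟨h.toWalk, by simp⟩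

lemma Within.mono (h : Within H l x y) (hH : H ≤ H') (hl : l ≤ m) : Within H' m x y := by
  obtain ⟨p, hp⟩ := h
  exact ⟨p.mapLe hH, by simpa using hp.trans hl⟩

end Within

/-- The bound `(3 ^ j - 1) / 2` on the radius of the clusters of level `j`. -/
def radius : ℕ → ℕ
  | 0 => 0
  | j + 1 => 3 * radius j + 1

lemma two_mul_radius (j : ℕ) : 2 * radius j + 1 = 3 ^ j := by
  induction j with
  | zero => rfl
  | succ j ih => rw [radius, pow_succ]; omega

/-! ### Clusters -/

namespace Execution

variable {V : Type} [Fintype V] [Nonempty V] {E : Execution V} {j : ℕ} {v u w x y : V} {e : Sym2 V}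

/-- The graph of the edges that the levels below `j` put into the spanner. -/
def below (E : Execution V) (j : ℕ) : SimpleGraph V :=
  SimpleGraph.fromEdgeSet {e | ∃ i < j, ∃ v, e ∈ E.found i v}

lemma below_mono {i j : ℕ} (hij : i ≤ j) : E.below i ≤ E.below j :=
  SimpleGraph.fromEdgeSet_mono fun _ ⟨l, hl, h⟩ => ⟨l, hl.trans_le hij, h⟩

lemma explored_state (E : Execution V) (j : ℕ) (v : V) (i : ℕ) :
    Explored E.graph (E.cluster j) v (E.goal j) (E.state j v i) := explored_stateAfter _ _ _ _ _

lemma exists_of_leads (h : E.leads j v e = some u) :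
    u ≠ v ∧ ∃ x y, E.graph.Adj x y ∧ e = s(x, y) ∧ E.cluster j x = some v ∧
      E.cluster j y = some u := by
  unfold leads leadsTo at h
  split_ifs at h with h'
  rw [Option.some.injEq] at h
  exact h ▸ h'.choose_spec

lemma leads_eq (hxy : E.graph.Adj x y) (hx : E.cluster j x = some v) (hy : E.cluster j y = some u)
    (huv : u ≠ v) : E.leads j v s(x, y) = some u := by
  have h : ∃ u, u ≠ v ∧ ∃ x' y', E.graph.Adj x' y' ∧ s(x, y) = s(x', y') ∧
      E.cluster j x' = some v ∧ E.cluster j y' = some u := ⟨u, huv, x, y, hxy, rfl, hx, hy⟩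
  unfold leads leadsTo
  rw [dif_pos h]
  obtain ⟨-, x', y', -, hs, hx', hy'⟩ := h.choose_spec
  rcases Sym2.eq_iff.1 hs with ⟨rfl, rfl⟩ | ⟨rfl, rfl⟩
  · rw [← hy', hy]
  · rw [hx', Option.some.injEq] at hy
    exact absurd hy.symm huv

lemma mem_edgesAt_of (hxy : E.graph.Adj x y) (hx : E.cluster j x = some v)
    (hy : E.cluster j y = some u) (huv : u ≠ v) : s(x, y) ∈ edgesAt E.graph (E.cluster j) v :=
  mem_edgesAt_iff.2 ⟨u, huv, x, y, hxy, rfl, hx, hy⟩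

lemma exists_of_mem_found (he : e ∈ E.found j v) :
    ∃ u, u ≠ v ∧ E.leads j v e = some u ∧ ∃ x y, E.graph.Adj x y ∧ e = s(x, y) ∧
      E.cluster j x = some v ∧ E.cluster j y = some u := by
  obtain ⟨u, huv, x, y, hxy, rfl, hx, hy⟩ :=
    mem_edgesAt_iff.1 ((E.explored_state j v _).found_mem e he)
  exact ⟨u, huv, leads_eq hxy hx hy huv, x, y, hxy, rfl, hx, hy⟩

lemma join_eq_some (h : E.join j v = some w) : E.mark j w = true ∧
    (w = v ∨ ∃ e ∈ E.found j v, E.leads j v e = some w) := by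
  unfold join joins at h
  split_ifs at h with hm
  · rw [Option.some.injEq] at h
    exact ⟨h ▸ hm, Or.inl h.symm⟩
  · obtain ⟨e, he, h⟩ := List.exists_of_findSome?_eq_some h
    rw [Option.filter_eq_some_iff] at h
    exact ⟨h.2, Or.inr ⟨e, he, h.1⟩⟩

lemma exists_of_cluster_succ (h : E.cluster (j + 1) x = some w) :
    ∃ v, E.cluster j x = some v ∧ E.join j v = some w := by
  rw [cluster_succ, Option.bind_eq_some_iff] at h
  exact h

lemma cluster_succ_eq (hx : E.cluster j x = some v) : E.cluster (j + 1) x = E.join j v := by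
  rw [cluster_succ, hx, Option.bind_some]

lemma join_of_mark (h : E.mark j v = true) : E.join j v = some v := if_pos h

/-- The center of a cluster belongs to it. -/
lemma cluster_center (h : E.cluster j x = some v) : E.cluster j v = some v := by
  induction j generalizing x v with
  | zero => rfl
  | succ j ih =>
    obtain ⟨v', hv', hj⟩ := exists_of_cluster_succ h
    obtain ⟨hm, hc⟩ := join_eq_some hj
    have hv : E.cluster j v = some v := by
      rcases hc with rfl | ⟨e, -, he⟩
      · exact ih hv'
      · obtain ⟨-, x', y, -, -, -, hy⟩ := exists_of_leads he
        exact ih hy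
    rw [cluster_succ_eq hv, join_of_mark hm]

/-- The nodes of the cluster graph of level `j` were centers at all levels below `j`. -/
lemma mem_marked (h : E.cluster j x = some v) : v ∈ E.marked j := by
  rw [marked, Finset.mem_filter]
  refine ⟨Finset.mem_univ v, ?_⟩
  induction j generalizing x v with
  | zero => simp
  | succ j ih =>
    intro i hi
    obtain ⟨v', hv', hj⟩ := exists_of_cluster_succ h
    obtain ⟨hm, hc⟩ := join_eq_some hj
    rcases Nat.lt_succ_iff_lt_or_eq.1 hi with hi | rfl
    · rcases hc with rfl | ⟨e, -, he⟩
      · exact ih hv' i hi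
      · obtain ⟨-, x', y, -, -, -, hy⟩ := exists_of_leads he
        exact ih hy i hi
    · exact hm

/-- The vertices of a cluster of level `j` are close to its center. -/
lemma within_center (h : E.cluster j x = some v) : Within (E.below j) (radius j) x v := by
  induction j generalizing x v with
  | zero =>
    cases h
    exact Within.refl _
  | succ j ih =>
    obtain ⟨v', hv', hj⟩ := exists_of_cluster_succ h
    have hmono : E.below j ≤ E.below (j + 1) := below_mono (Nat.le_succ j)
    have h1 := (ih hv').mono hmono le_rfl
    rcases (join_eq_some hj).2 with rfl | ⟨e, hmem, he⟩
    · exact h1.mono le_rfl (by rw [radius]; omega)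
    · obtain ⟨-, x', y', hadj, rfl, hx', hy'⟩ := exists_of_leads he
      have h2 := ((ih hx').mono hmono le_rfl).symm
      have h3 : Within (E.below (j + 1)) 1 x' y' := Within.of_adj
        (SimpleGraph.fromEdgeSet_adj _ |>.2 ⟨⟨j, Nat.lt_succ_self j, v', hmem⟩, hadj.ne⟩)
      have h4 := (ih hy').mono hmono le_rfl
      exact (((h1.trans h2).trans h3).trans h4).mono le_rfl (by rw [radius]; omega)

lemma within_of_cluster_eq (hx : E.cluster j x = some v) (hy : E.cluster j y = some v) :
    Within (E.below j) (2 * radius j) x y :=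
  ((within_center hx).trans (within_center hy).symm).mono le_rfl (by omega)

/-- A node without unexplored edges has found an edge to each of its neighbours. -/
lemma exists_found (hv : (E.state j v (2 * E.h)).1 = ∅) (hxy : E.graph.Adj x y)
    (hx : E.cluster j x = some v) (hy : E.cluster j y = some u) (huv : u ≠ v) :
    ∃ e ∈ E.found j v, E.leads j v e = some u := by
  have h1 := mem_edgesAt_of hxy hx hy huv
  have h2 := (E.explored_state j v (2 * E.h)).mem_iff _ h1
  rw [hv] at h2
  simp only [Finset.notMem_empty, false_iff, not_not, List.mem_map] at h2
  obtain ⟨e, he, h3⟩ := h2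
  exact ⟨e, he, h3.trans (leads_eq hxy hx hy huv)⟩

lemma within_of_exists_found (h : ∃ e ∈ E.found j v, E.leads j v e = some u)
    (hx : E.cluster j x = some v) (hy : E.cluster j y = some u) :
    Within (E.below (j + 1)) (4 * radius j + 1) x y := by
  obtain ⟨e, hmem, he⟩ := h
  obtain ⟨-, x', y', hadj, rfl, hx', hy'⟩ := exists_of_leads he
  have hmono : E.below j ≤ E.below (j + 1) := below_mono (Nat.le_succ j)
  have h1 := (within_of_cluster_eq hx hx').mono hmono le_rfl
  have h2 : Within (E.below (j + 1)) 1 x' y' := Within.of_adj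
    (SimpleGraph.fromEdgeSet_adj _ |>.2 ⟨⟨j, Nat.lt_succ_self j, v, hmem⟩, hadj.ne⟩)
  have h3 := (within_of_cluster_eq hy' hy).mono hmono le_rfl
  exact ((h1.trans h2).trans h3).mono le_rfl (by omega)

/-- In a good execution, a node that joins no cluster has explored all its edges. -/
lemma Good.explored_of_join_eq_none (hE : E.Good) (hj : j ≤ E.k) (h : E.join j v = none) :
    (E.state j v (2 * E.h)).1 = ∅ :=
  (hE.explored j hj v).resolve_right fun h' => hE.joined j hj v h' h

lemma length_found_le (E : Execution V) (j : ℕ) (v : V) :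
    (E.found j v).length ≤ (E.marked j).card := by
  have h1 : ((E.found j v).map (leadsTo E.graph (E.cluster j) v)).Nodup :=
    (E.explored_state j v (2 * E.h)).nodup
  rw [← List.length_map (leadsTo E.graph (E.cluster j) v), ← List.toFinset_card_of_nodup h1,
    ← Finset.card_image_of_injective (E.marked j) (Option.some_injective V)]
  refine Finset.card_le_card fun o ho => ?_
  obtain ⟨e, he, rfl⟩ := List.mem_map.1 (List.mem_toFinset.1 ho)
  obtain ⟨u, -, hu, x, y, -, -, -, hy⟩ := exists_of_mem_found he
  exact Finset.mem_image.2 ⟨u, mem_marked hy, hu.symm⟩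

lemma found_eq_nil (hv : v ∉ E.marked j) : E.found j v = [] := by
  refine List.eq_nil_iff_forall_not_mem.2 fun e he => hv ?_
  obtain ⟨u, -, hu, x, y, -, -, hx, -⟩ := exists_of_mem_found he
  exact mem_marked hx

/-- In a good execution, the nodes of the last level explore all their edges, since they have fewer
neighbours than they try to find. -/
lemma Good.explored_last (hE : E.Good) (v : V) : (E.state E.k v (2 * E.h)).1 = ∅ := by
  refine (hE.explored E.k le_rfl v).resolve_right fun h => ?_
  have h1 := hE.few E.k le_rfl
  have h2 : ((E.found E.k v).length : ℝ) ≤ (E.marked E.k).card := by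
    exact_mod_cast E.length_found_le E.k v
  have h3 : E.goal E.k = E.c * Real.logb 2 (Fintype.card V) *
      expectedNodes (Fintype.card V) E.k E.k := by
    rw [goal, target, expectedNodes, mul_right_comm]
    congr 2
    have h4 : (1 : ℝ) < 2 ^ (E.k + 1) := one_lt_pow₀ one_lt_two (Nat.succ_ne_zero _)
    rw [delta, pow_succ] at *
    field_simp [show (2 : ℝ) ^ E.k * 2 - 1 ≠ 0 by linarith]
    ring
  linarith

/-- In a good execution, the endpoints of an edge of the input graph are close in the spanner. The
reason is the last level at which both endpoints are in clusters: there, one of these two clusters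
explores all its edges. -/
lemma Good.within_of_adj (hE : E.Good) (hxy : E.graph.Adj x y) :
    Within (E.below (E.k + 1)) (2 * 3 ^ E.k) x y := by
  have hrad : ∀ j ≤ E.k, 4 * radius j + 1 ≤ 2 * 3 ^ E.k := by
    intro j hj
    have h1 := two_mul_radius j
    have h2 : 3 ^ j ≤ 3 ^ E.k := Nat.pow_le_pow_right (by norm_num) hj
    omega
  have key : ∀ i j, j + i = E.k → ∀ v u, E.cluster j x = some v → E.cluster j y = some u →
      Within (E.below (E.k + 1)) (2 * 3 ^ E.k) x y := by
    intro i
    induction i with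
    | zero =>
      rintro j rfl v u hx hy
      by_cases huv : u = v
      · subst huv
        exact (within_of_cluster_eq hx hy).mono (below_mono (by omega))
          (by have := hrad _ le_rfl; omega)
      · exact (within_of_exists_found (exists_found (hE.explored_last v) hxy hx hy huv) hx hy).mono
          le_rfl (hrad _ le_rfl)
    | succ i ih =>
      intro j hj v u hx hy
      have hjk : j ≤ E.k := by omega
      by_cases huv : u = v
      · subst huv
        exact (within_of_cluster_eq hx hy).mono (below_mono (by omega))
          (by have := hrad j hjk; omega)
      rcases hv : E.join j v with _ | v'
      · exact (within_of_exists_found (exists_found (hE.explored_of_join_eq_none hjk hv) hxy hx hy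
          huv) hx hy).mono (below_mono (by omega)) (hrad j hjk)
      rcases hu : E.join j u with _ | u'
      · exact (within_of_exists_found (exists_found (hE.explored_of_join_eq_none hjk hu) hxy.symm hy
          hx (Ne.symm huv)) hy hx).symm.mono (below_mono (by omega)) (hrad j hjk)
      · exact ih (j + 1) (by omega) v' u' (by rw [cluster_succ_eq hx, hv])
          (by rw [cluster_succ_eq hy, hu])
  exact key E.k 0 (zero_add _) x y rfl rfl

lemma mem_spanner : e ∈ E.spanner ↔ ∃ j < E.k + 1, ∃ v, e ∈ E.found j v := by
  simp [spanner, edgesOf]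

lemma Good.isSpanner (hE : E.Good) {α : ℕ} (hα : 2 * 3 ^ E.k ≤ α) :
    IsSpanner E.graph α E.spanner := by
  constructor
  · intro e he
    obtain ⟨j, -, v, he⟩ := mem_spanner.1 he
    obtain ⟨u, -, -, x, y, hxy, rfl, -⟩ := exists_of_mem_found he
    exact hxy
  · have hH : SimpleGraph.fromEdgeSet (E.spanner : Set (Sym2 V)) = E.below (E.k + 1) := by
      rw [below]
      congr 1
      ext e
      exact mem_spanner
    rw [hH]
    have hwalk : ∀ {u v : V} (p : E.graph.Walk u v),
        Within (E.below (E.k + 1)) (α * p.length) u v := by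
      intro u v p
      induction p with
      | nil => exact Within.refl _
      | cons hadj p ih =>
        refine ((hE.within_of_adj hadj).trans ih).mono le_rfl ?_
        rw [SimpleGraph.Walk.length_cons, mul_add, mul_one]
        omega
    intro u v
    by_cases htop : E.graph.edist u v = ⊤
    · rw [htop, ENat.mul_top]
      · exact le_top
      · have : 0 < 3 ^ E.k := by positivity
        exact_mod_cast (by omega : α ≠ 0)
    · obtain ⟨p, hp⟩ := SimpleGraph.exists_walk_of_edist_ne_top htop
      obtain ⟨q, hq⟩ := hwalk p
      rw [← hp]
      exact (SimpleGraph.edist_le q).trans (by exact_mod_cast hq)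

/-! ### Queries -/

/-- The query edges of `v` in the trial number `i` of level `j`. -/
def queries (E : Execution V) (j : ℕ) (v : V) (i : ℕ) : Finset (Sym2 V) :=
  ((List.range (numQueries E.c (Fintype.card V) E.k E.h j)).map fun q =>
    pickEdge E.ident (E.state j v i).1 ((E.seed v j).1 i q)).toFinset ∩ (E.state j v i).1

lemma card_queries_le (E : Execution V) (j : ℕ) (v : V) (i : ℕ) :
    (E.queries j v i).card ≤ numQueries E.c (Fintype.card V) E.k E.h j := by
  refine (Finset.card_le_card Finset.inter_subset_left).trans ((List.toFinset_card_le _).trans ?_)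
  simp

lemma queries_subset (E : Execution V) (j : ℕ) (v : V) (i : ℕ) :
    E.queries j v i ⊆ edgesAt E.graph (E.cluster j) v :=
  Finset.inter_subset_right.trans (E.explored_state j v i).unexplored_subset

lemma exists_of_mem_queries {i : ℕ} (he : e ∈ E.queries j v i) :
    ∃ u, u ≠ v ∧ ∃ x y, E.graph.Adj x y ∧ e = s(x, y) ∧ E.cluster j x = some v ∧
      E.cluster j y = some u := mem_edgesAt_iff.1 (E.queries_subset j v i he)

lemma state_succ (E : Execution V) (j : ℕ) (v : V) (i : ℕ) : E.state j v (i + 1) =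
    trialStep E.graph E.ident (E.cluster j) v (E.goal j)
      (numQueries E.c (Fintype.card V) E.k E.h j) (E.state j v i) ((E.seed v j).1 i) := rfl

lemma exists_queries_of_mem_state {i : ℕ} (he : e ∈ (E.state j v i).2) :
    ∃ i' < i, e ∈ E.queries j v i' := by
  induction i with
  | zero => simp [state, stateAfter, foldStream] at he
  | succ i ih =>
    rw [state_succ] at he
    rcases mem_of_mem_foldl_explore _ _ he with he | he
    · obtain ⟨i', hi', h⟩ := ih he
      exact ⟨i', by omega, h⟩
    · exact ⟨i, by omega, he⟩

/-- The query edges of all nodes at all levels. -/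
def allQueries (E : Execution V) : Finset (Sym2 V) :=
  (Finset.range (E.k + 1)).biUnion fun j => (E.marked j).biUnion fun v =>
    (Finset.range (2 * E.h)).biUnion fun i => E.queries j v i

lemma mem_allQueries {i : ℕ} (hj : j ≤ E.k) (hi : i < 2 * E.h) (he : e ∈ E.queries j v i) :
    e ∈ E.allQueries := by
  obtain ⟨u, -, x, y, -, -, hx, -⟩ := exists_of_mem_queries he
  simp only [allQueries, Finset.mem_biUnion, Finset.mem_range]
  exact ⟨j, by omega, v, mem_marked hx, i, hi, he⟩

lemma card_allQueries_le (E : Execution V) : E.allQueries.card ≤ ∑ j ∈ Finset.range (E.k + 1),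
    (E.marked j).card * (2 * E.h * numQueries E.c (Fintype.card V) E.k E.h j) := by
  refine Finset.card_biUnion_le.trans (Finset.sum_le_sum fun j _ => ?_)
  refine Finset.card_biUnion_le.trans ((Finset.sum_le_card_nsmul _ _ _ fun v _ => ?_))
  refine Finset.card_biUnion_le.trans ((Finset.sum_le_card_nsmul _ _ _
    fun i _ => E.card_queries_le j v i).trans ?_)
  simp

lemma card_spanner_le (E : Execution V) (hg : ∀ j, 0 ≤ E.goal j) :
    (E.spanner.card : ℝ) ≤
      ∑ j ∈ Finset.range (E.k + 1), ((E.marked j).card : ℝ) * (E.goal j + 1) := by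
  have h1 : E.spanner.card ≤ ∑ j ∈ Finset.range (E.k + 1), ∑ v ∈ E.marked j,
      (E.found j v).length := by
    refine Finset.card_biUnion_le.trans (Finset.sum_le_sum fun j _ => ?_)
    refine Finset.card_biUnion_le.trans ?_
    rw [← Finset.sum_subset (Finset.subset_univ (E.marked j))
      fun v _ hv => by rw [found_eq_nil hv]; rfl]
    exact Finset.sum_le_sum fun v _ => List.toFinset_card_le _
  refine (Nat.cast_le (α := ℝ).2 h1).trans ?_
  push_cast
  refine Finset.sum_le_sum fun j _ => ?_
  rw [← nsmul_eq_mul]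
  exact Finset.sum_le_card_nsmul _ _ _ fun v _ =>
    (E.explored_state j v (2 * E.h)).length_le (hg j)

end Execution

/-! ### The distributed implementation -/

/-- What a vertex announces about itself at the beginning of a level: its name, the name of its
cluster, if it is in one, and its seed. The name of a vertex is the set of the IDs of its incident
edges, and the name of a cluster is that of its center. -/
structure Record where
  /-- The level. -/
  level : ℕ
  /-- The name of the vertex. -/
  name : Finset ℕ
  /-- The name of the cluster of the vertex. -/
  cluster : Option (Finset ℕ)
  /-- The seed of the vertex. -/
  seed : Seed

section View

variable (K : Finset Record) (j : ℕ) (a : Finset ℕ)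

/-- The edges at the cluster `a` of level `j`, from the records in `K`: those that are incident to
exactly one vertex of the cluster and to no vertex that is known to be in no cluster. -/
def viewEdges : Finset ℕ :=
  (K.biUnion Record.name).filter fun e =>
    (∃ r ∈ K, r.level = j ∧ r.cluster = some a ∧ e ∈ r.name) ∧
    (∀ r ∈ K, ∀ r' ∈ K, r.level = j → r'.level = j → r.cluster = some a → r'.cluster = some a →
      e ∈ r.name → e ∈ r'.name → r.name = r'.name) ∧
    ∀ r ∈ K, r.level ≤ j → r.cluster = none → e ∉ r.name

/-- The cluster to which the edge `e` leads from the cluster `a`, from the records in `K`. -/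
def viewLeads (e : ℕ) : Option (Finset ℕ) :=
  if h : ∃ b, b ≠ a ∧ ∃ r ∈ K, r.level = j ∧ r.cluster = some b ∧ e ∈ r.name
  then some h.choose else none

/-- The seed of the vertex `a`, from the records in `K`. -/
def viewSeed : Seed := if h : ∃ r ∈ K, r.name = a then h.choose.seed else default

/-- The step `explore` of Sampler in terms of edge IDs. -/
def exploreBy (leads : ℕ → Option (Finset ℕ)) (τ : ℝ) (s : Finset ℕ × List ℕ) (e : ℕ) :
    Finset ℕ × List ℕ :=
  if e ∈ s.1 ∧ (s.2.length : ℝ) < τ then (s.1.filter fun e' => leads e' ≠ leads e, s.2 ++ [e])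
  else s

variable (c : ℝ) (n k h : ℕ)

/-- The IDs that are drawn in a trial of level `j` from the set `X` of unexplored edges. -/
def viewDraws (X : Finset ℕ) (u : ℕ → ℕ) : List ℕ :=
  (List.range (numQueries c n k h j)).map fun q => pick X (u q)

/-- The unexplored edges and the list of the cluster `a` after `i` trials of level `j`, from the
records in `K`. -/
def viewState (i : ℕ) : Finset ℕ × List ℕ :=
  foldStream (fun s u => (viewDraws j c n k h s.1 u).foldl
    (exploreBy (viewLeads K j a) (target c n k j)) s)
    (viewEdges K j a, []) (viewSeed K a j).1 i

/-- The query edges of the cluster `a` in the trial number `i` of level `j`, from the records in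
`K`. -/
def viewQueries (i : ℕ) : Finset ℕ :=
  (viewDraws j c n k h (viewState K j a c n k h i).1 ((viewSeed K a j).1 i)).toFinset ∩
    (viewState K j a c n k h i).1

/-- The list of the cluster `a` at the end of level `j`, from the records in `K`. -/
def viewFound : List ℕ := (viewState K j a c n k h (2 * h)).2

/-- The cluster that the cluster `a` joins at level `j`, from the records in `K`. -/
def viewJoin : Option (Finset ℕ) :=
  if (viewSeed K a j).2 then some a
  else (viewFound K j a c n k h).findSome? fun e =>
    (viewLeads K j a e).filter fun b => (viewSeed K b j).2

end View

/-- The state of a node: the number of rounds so far, its name, its seed, the name of its current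
cluster, the records that it knows, the IDs of the incident edges over which messages are sent, and
the IDs of the incident edges that it has selected for the spanner. -/
structure NodeState where
  /-- The number of rounds so far. -/
  time : ℕ
  /-- The name of the node. -/
  name : Finset ℕ
  /-- The seed of the node. -/
  seed : Seed
  /-- The name of the current cluster of the node. -/
  cluster : Option (Finset ℕ)
  /-- The known records. -/
  known : Finset Record
  /-- The IDs of the active incident edges. -/
  active : Finset ℕ
  /-- The IDs of the selected incident edges. -/
  selected : Finset ℕ

section Algorithm

variable (c : ℝ) (n k h : ℕ)

/-- The round in which stage `p` is performed. There are `2 h + 1` stages in each level, one for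
each trial and one for the formation of the clusters. The slowest news between two stages of level
`j` are that a neighbouring cluster is dropped: they travel over at most `4 r + 1` edges to some
vertex of a cluster of level `j + 1`, and over at most `2 (3 r + 1)` edges to the others, where `2
r + 1 = 3 ^ j`. This makes `5 * 3 ^ j - 2` edges. -/
def stageTime : ℕ → ℕ
  | 0 => 0
  | p + 1 => stageTime p + 5 * 3 ^ (p / (2 * h + 1))

/-- The number of rounds. By the geometric sum `stageTime_level`, all stages are over by then, and
at least one more round of messages follows. -/
def rounds : ℕ := 24 * 3 ^ k * h

/-- Stage `p`: if it is a trial of level `j`, activate the incident query edges of the own cluster.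
If it is the last stage of level `j`, select the incident edges in the list of the own cluster, join
a new cluster, and announce this. -/
def performStage (p : ℕ) (s : NodeState) : NodeState :=
  if p % (2 * h + 1) < 2 * h then
    { s with
      active := s.active ∪ (s.cluster.elim ∅ fun a =>
        viewQueries s.known (p / (2 * h + 1)) a c n k h (p % (2 * h + 1))) ∩ s.name }
  else
    { s with
      cluster := s.cluster.bind fun a => viewJoin s.known (p / (2 * h + 1)) a c n k h
      known := insert
        ⟨p / (2 * h + 1) + 1, s.name,
          s.cluster.bind fun a => viewJoin s.known (p / (2 * h + 1)) a c n k h, s.seed⟩ s.known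
      active := s.active ∪ (s.cluster.elim ∅ fun a =>
        (viewFound s.known (p / (2 * h + 1)) a c n k h).toFinset) ∩ s.name
      selected := s.selected ∪ (s.cluster.elim ∅ fun a =>
        (viewFound s.known (p / (2 * h + 1)) a c n k h).toFinset) ∩ s.name }

/-- The update of the state of a node from its inbox `m`. -/
def absorb (s : NodeState) (m : ℕ → Option (Finset Record × Bool)) : NodeState :=
  { s with
    time := s.time + 1
    known := s.known ∪ s.name.biUnion fun i => (m i).elim ∅ Prod.fst
    active := s.active ∪ s.name.filter fun i => (m i).isSome
    selected := s.selected ∪ s.name.filter fun i => ∃ K, m i = some (K, true) }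

/-- Perform the stage that takes place in round `t`, if there is one. -/
def stageAt (t : ℕ) (s : NodeState) : NodeState :=
  if ht : ∃ p < (k + 1) * (2 * h + 1), stageTime h p = t then performStage c n k h ht.choose s
  else s

/-- The distributed implementation of Sampler. The nodes gossip all that they know over all edges
that have ever been used for a query. As they know the seeds, all vertices of a cluster can simulate
the center of this cluster without further communication. -/
def algorithm : LocalAlgorithm where
  Seed := Seed
  seedLaw := seedLaw c n k h
  State := NodeState
  Msg := Finset Record × Bool
  start I ω := ⟨0, I, ω, some I, {⟨0, I, some I, ω⟩}, ∅, ∅⟩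
  send s i := if i ∈ s.active then some (s.known, decide (i ∈ s.selected)) else none
  receive s m := stageAt c n k h s.time (absorb s m)
  output s := if s.time = rounds k h then some s.selected else none

end Algorithm

lemma stageTime_strictMono (h : ℕ) : StrictMono (stageTime h) :=
  strictMono_nat_of_lt_succ fun p => by
    rw [stageTime]
    have : 0 < 3 ^ (p / (2 * h + 1)) := by positivity
    omega

lemma stageTime_level (h j : ℕ) :
    2 * stageTime h (j * (2 * h + 1)) + 5 * (2 * h + 1) = 5 * (2 * h + 1) * 3 ^ j := by
  have hstep : ∀ j i, i ≤ 2 * h + 1 → stageTime h (j * (2 * h + 1) + i) =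
      stageTime h (j * (2 * h + 1)) + i * (5 * 3 ^ j) := by
    intro j i hi
    induction i with
    | zero => simp
    | succ i ih =>
      have hdiv : (j * (2 * h + 1) + i) / (2 * h + 1) = j := by
        rw [mul_comm, Nat.mul_add_div (by omega), Nat.div_eq_of_lt (by omega), add_zero]
      rw [← add_assoc, stageTime, hdiv, ih (by omega)]
      ring
  induction j with
  | zero => simp [stageTime]
  | succ j ih =>
    rw [add_mul, one_mul, hstep j _ le_rfl, pow_succ]
    linarith

lemma stageTime_add_two_le {h p k : ℕ} (hh : 1 ≤ h) (hp : p ≤ (k + 1) * (2 * h + 1)) :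
    stageTime h p + 2 ≤ rounds k h := by
  have h1 := stageTime_level h (k + 1)
  have h2 := (stageTime_strictMono h).monotone hp
  have h3 : 0 < 3 ^ k := by positivity
  have h4 : 3 ^ k ≤ 3 ^ k * h := Nat.le_mul_of_pos_right _ hh
  rw [pow_succ] at h1
  rw [rounds, mul_assoc]
  nlinarith

section Stage

variable {c : ℝ} {n k h : ℕ} {s : NodeState} {t p : ℕ}

lemma stageAt_stageTime (hp : p < (k + 1) * (2 * h + 1)) :
    stageAt c n k h (stageTime h p) s = performStage c n k h p s := by
  have h1 : ∃ p' < (k + 1) * (2 * h + 1), stageTime h p' = stageTime h p := ⟨p, hp, rfl⟩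
  rw [stageAt, dif_pos h1, (stageTime_strictMono h).injective h1.choose_spec.2]

lemma stageAt_of_not (ht : ∀ p < (k + 1) * (2 * h + 1), stageTime h p ≠ t) :
    stageAt c n k h t s = s := dif_neg fun ⟨p, hp, h⟩ => ht p hp h

/-- To prove a property of the state after a stage, consider the case of no stage and that of stage
`p`. -/
lemma stageAt_cases {P : NodeState → Prop} (h0 : P s)
    (hp : ∀ p < (k + 1) * (2 * h + 1), stageTime h p = t → P (performStage c n k h p s)) :
    P (stageAt c n k h t s) := by
  unfold stageAt
  split_ifs with h1
  · exact hp _ h1.choose_spec.1 h1.choose_spec.2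
  · exact h0

lemma stageAt_fixed : (stageAt c n k h t s).time = s.time ∧ (stageAt c n k h t s).name = s.name ∧
    (stageAt c n k h t s).seed = s.seed := by
  refine stageAt_cases (P := fun s' => s'.time = s.time ∧ s'.name = s.name ∧ s'.seed = s.seed)
    ⟨rfl, rfl, rfl⟩ fun p _ _ => ?_
  unfold performStage
  split_ifs <;> exact ⟨rfl, rfl, rfl⟩

lemma subset_stageAt : s.known ⊆ (stageAt c n k h t s).known ∧
    s.active ⊆ (stageAt c n k h t s).active ∧ s.selected ⊆ (stageAt c n k h t s).selected := by
  refine stageAt_cases (P := fun s' => s.known ⊆ s'.known ∧ s.active ⊆ s'.active ∧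
    s.selected ⊆ s'.selected) ⟨subset_rfl, subset_rfl, subset_rfl⟩ fun p _ _ => ?_
  unfold performStage
  split_ifs
  · exact ⟨subset_rfl, Finset.subset_union_left, subset_rfl⟩
  · exact ⟨Finset.subset_insert _ _, Finset.subset_union_left, Finset.subset_union_left⟩

end Stage

namespace Execution

variable {V : Type} [Fintype V]

/-- The name of a vertex. -/
def name (E : Execution V) (x : V) : Finset ℕ := LocalAlgorithm.idsAt E.ident E.graph.edgeSet x

/-- The state of the vertex `x` after `t` rounds of the distributed implementation. -/
def node (E : Execution V) (t : ℕ) (x : V) : NodeState :=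
  (algorithm E.c (Fintype.card V) E.k E.h).run E.graph E.ident E.seed t x

/-- The messages that reach the vertex `x` in round `t`. -/
def inbox (E : Execution V) (t : ℕ) (x : V) : ℕ → Option (Finset Record × Bool) :=
  (algorithm E.c (Fintype.card V) E.k E.h).inbox E.graph E.ident (E.node t) x

/-- The state of the vertex `x` in round `t` before a stage is performed. -/
def pre (E : Execution V) (t : ℕ) (x : V) : NodeState := absorb (E.node t x) (E.inbox t x)

variable {E : Execution V} {t : ℕ} {x y : V} {i : ℕ}

lemma mem_name : i ∈ E.name x ↔ ∃ y, E.graph.Adj x y ∧ E.ident s(x, y) = i := by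
  simp only [name, LocalAlgorithm.idsAt, Finset.mem_image, Finset.mem_filter, Finset.mem_univ,
    true_and]
  constructor
  · rintro ⟨e, ⟨he, hx⟩, rfl⟩
    obtain ⟨y, rfl⟩ := hx
    exact ⟨y, he, rfl⟩
  · rintro ⟨y, hxy, rfl⟩
    exact ⟨s(x, y), ⟨hxy, Sym2.mem_mk_left x y⟩, rfl⟩

lemma ident_mem_name (hxy : E.graph.Adj x y) : E.ident s(x, y) ∈ E.name x :=
  mem_name.2 ⟨y, hxy, rfl⟩

lemma eq_of_ident_eq {V : Type} {E : Execution V} {x y z : V}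
    (hinj : Set.InjOn E.ident E.graph.edgeSet) (hxy : E.graph.Adj x y)
    (hxz : E.graph.Adj x z) (h : E.ident s(x, y) = E.ident s(x, z)) : y = z := by
  have h1 : s(x, y) = s(x, z) := hinj hxy hxz h
  rcases Sym2.eq_iff.1 h1 with h | h
  · exact h.2
  · exact h.2.trans h.1

lemma node_zero (x : V) : E.node 0 x = ⟨0, E.name x, E.seed x, some (E.name x),
    {⟨0, E.name x, some (E.name x), E.seed x⟩}, ∅, ∅⟩ := rfl

lemma node_succ_of_time (h : (E.node t x).time ≠ rounds E.k E.h) : E.node (t + 1) x =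
    stageAt E.c (Fintype.card V) E.k E.h (E.node t x).time (E.pre t x) := by
  have hrun : E.node (t + 1) = (algorithm E.c (Fintype.card V) E.k E.h).round E.graph E.ident
      (E.node t) := Function.iterate_succ_apply' _ _ _
  rw [hrun]
  refine if_neg fun h' => ?_
  change Option.isSome (if (E.node t x).time = rounds E.k E.h then some (E.node t x).selected
    else none) = true at h'
  rw [if_neg h] at h'
  exact absurd h' (by simp)

lemma node_fixed (ht : t ≤ rounds E.k E.h) :
    (E.node t x).time = t ∧ (E.node t x).name = E.name x ∧ (E.node t x).seed = E.seed x := by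
  induction t with
  | zero => exact ⟨rfl, rfl, rfl⟩
  | succ t ih =>
    obtain ⟨h1, h2, h3⟩ := ih (by omega)
    rw [node_succ_of_time (by omega)]
    obtain ⟨h4, h5, h6⟩ := stageAt_fixed (c := E.c) (n := Fintype.card V) (k := E.k) (h := E.h)
      (s := E.pre t x) (t := (E.node t x).time)
    refine ⟨h4.trans ?_, h5.trans h2, h6.trans h3⟩
    rw [pre, absorb, h1]

lemma node_succ (ht : t < rounds E.k E.h) :
    E.node (t + 1) x = stageAt E.c (Fintype.card V) E.k E.h t (E.pre t x) := by
  have h1 := (E.node_fixed (x := x) ht.le).1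
  rw [node_succ_of_time (by omega), h1]

lemma pre_fixed (ht : t ≤ rounds E.k E.h) :
    (E.pre t x).name = E.name x ∧ (E.pre t x).seed = E.seed x := (E.node_fixed ht).2

lemma inbox_eq (hinj : Set.InjOn E.ident E.graph.edgeSet) (ht : t < rounds E.k E.h)
    (hxy : E.graph.Adj x y) : E.inbox t x (E.ident s(x, y)) =
      if E.ident s(x, y) ∈ (E.node t y).active then
        some ((E.node t y).known, decide (E.ident s(x, y) ∈ (E.node t y).selected)) else none := by
  have h : ∃ u, E.graph.Adj x u ∧ E.ident s(x, u) = E.ident s(x, y) := ⟨y, hxy, rfl⟩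
  have h1 : h.choose = y := eq_of_ident_eq hinj h.choose_spec.1 hxy h.choose_spec.2
  unfold inbox LocalAlgorithm.inbox
  rw [dif_pos h, h1]
  refine if_neg fun h' => ?_
  change Option.isSome (if (E.node t y).time = rounds E.k E.h then some (E.node t y).selected
    else none) = true at h'
  rw [if_neg (by rw [(E.node_fixed ht.le).1]; omega)] at h'
  exact absurd h' (by simp)

lemma mem_known_pre (hinj : Set.InjOn E.ident E.graph.edgeSet) (ht : t < rounds E.k E.h)
    {r : Record} : r ∈ (E.pre t x).known ↔ r ∈ (E.node t x).known ∨
      ∃ y, E.graph.Adj x y ∧ E.ident s(x, y) ∈ (E.node t y).active ∧ r ∈ (E.node t y).known := by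
  simp only [pre, absorb, Finset.mem_union, Finset.mem_biUnion, (E.node_fixed ht.le).2.1]
  refine or_congr_right ⟨?_, ?_⟩
  · rintro ⟨i, hi, hr⟩
    obtain ⟨y, hxy, rfl⟩ := mem_name.1 hi
    rw [inbox_eq hinj ht hxy] at hr
    split_ifs at hr with ha
    · exact ⟨y, hxy, ha, hr⟩
    · simp at hr
  · rintro ⟨y, hxy, ha, hr⟩
    refine ⟨_, ident_mem_name hxy, ?_⟩
    rw [inbox_eq hinj ht hxy, if_pos ha]
    exact hr

lemma mem_active_pre (hinj : Set.InjOn E.ident E.graph.edgeSet) (ht : t < rounds E.k E.h) :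
    i ∈ (E.pre t x).active ↔ i ∈ (E.node t x).active ∨
      ∃ y, E.graph.Adj x y ∧ E.ident s(x, y) = i ∧ i ∈ (E.node t y).active := by
  simp only [pre, absorb, Finset.mem_union, Finset.mem_filter, (E.node_fixed ht.le).2.1]
  refine or_congr_right ⟨?_, ?_⟩
  · rintro ⟨hi, hr⟩
    obtain ⟨y, hxy, rfl⟩ := mem_name.1 hi
    rw [inbox_eq hinj ht hxy] at hr
    split_ifs at hr with ha
    · exact ⟨y, hxy, rfl, ha⟩
    · simp at hr
  · rintro ⟨y, hxy, rfl, ha⟩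
    refine ⟨ident_mem_name hxy, ?_⟩
    rw [inbox_eq hinj ht hxy, if_pos ha]
    rfl

lemma mem_selected_pre (hinj : Set.InjOn E.ident E.graph.edgeSet) (ht : t < rounds E.k E.h) :
    i ∈ (E.pre t x).selected ↔ i ∈ (E.node t x).selected ∨ ∃ y, E.graph.Adj x y ∧
      E.ident s(x, y) = i ∧ i ∈ (E.node t y).active ∧ i ∈ (E.node t y).selected := by
  simp only [pre, absorb, Finset.mem_union, Finset.mem_filter, (E.node_fixed ht.le).2.1]
  refine or_congr_right ⟨?_, ?_⟩
  · rintro ⟨hi, K, hK⟩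
    obtain ⟨y, hxy, rfl⟩ := mem_name.1 hi
    rw [inbox_eq hinj ht hxy] at hK
    split_ifs at hK with ha
    · rw [Option.some.injEq, Prod.mk.injEq, decide_eq_true_eq] at hK
      exact ⟨y, hxy, rfl, ha, hK.2⟩
  · rintro ⟨y, hxy, rfl, ha, hs⟩
    refine ⟨ident_mem_name hxy, (E.node t y).known, ?_⟩
    rw [inbox_eq hinj ht hxy, if_pos ha, decide_eq_true hs]

/-! ### Termination and consistency -/

lemma pre_subset_node_succ (ht : t < rounds E.k E.h) :
    (E.pre t x).known ⊆ (E.node (t + 1) x).known ∧ (E.pre t x).active ⊆ (E.node (t + 1) x).active ∧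
      (E.pre t x).selected ⊆ (E.node (t + 1) x).selected := by
  rw [node_succ ht]
  exact subset_stageAt

lemma node_subset_pre : (E.node t x).known ⊆ (E.pre t x).known ∧
    (E.node t x).active ⊆ (E.pre t x).active ∧ (E.node t x).selected ⊆ (E.pre t x).selected :=
  ⟨Finset.subset_union_left, Finset.subset_union_left, Finset.subset_union_left⟩

lemma node_mono {t' : ℕ} (htt' : t ≤ t') (ht' : t' ≤ rounds E.k E.h) :
    (E.node t x).known ⊆ (E.node t' x).known ∧ (E.node t x).active ⊆ (E.node t' x).active ∧
      (E.node t x).selected ⊆ (E.node t' x).selected := by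
  induction t', htt' using Nat.le_induction with
  | base => exact ⟨subset_rfl, subset_rfl, subset_rfl⟩
  | succ t' _ ih =>
    obtain ⟨h1, h2, h3⟩ := ih (by omega)
    obtain ⟨h4, h5, h6⟩ := E.node_subset_pre (t := t') (x := x)
    obtain ⟨h7, h8, h9⟩ := E.pre_subset_node_succ (t := t') (x := x) (by omega)
    exact ⟨h1.trans (h4.trans h7), h2.trans (h5.trans h8), h3.trans (h6.trans h9)⟩

lemma selected_subset (hinj : Set.InjOn E.ident E.graph.edgeSet) (ht : t ≤ rounds E.k E.h) :
    (E.node t x).selected ⊆ E.name x ∧ (E.node t x).selected ⊆ (E.node t x).active := by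
  induction t generalizing x with
  | zero => simp [node_zero]
  | succ t ih =>
    have ht' : t < rounds E.k E.h := by omega
    rw [node_succ ht']
    have hpre : (E.pre t x).selected ⊆ E.name x ∧ (E.pre t x).selected ⊆ (E.pre t x).active := by
      constructor
      · intro i hi
        rcases (mem_selected_pre hinj ht').1 hi with h | ⟨y, hxy, rfl, -⟩
        · exact (ih ht'.le).1 h
        · exact ident_mem_name hxy
      · intro i hi
        rw [mem_active_pre hinj ht']
        rcases (mem_selected_pre hinj ht').1 hi with h | ⟨y, hxy, rfl, h, -⟩
        · exact Or.inl ((ih ht'.le).2 h)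
        · exact Or.inr ⟨y, hxy, rfl, h⟩
    refine stageAt_cases (P := fun s => s.selected ⊆ E.name x ∧ s.selected ⊆ s.active) hpre
      fun p _ _ => ?_
    unfold performStage
    split_ifs
    · exact ⟨hpre.1, hpre.2.trans Finset.subset_union_left⟩
    · refine ⟨Finset.union_subset hpre.1 ?_, Finset.union_subset_union_left hpre.2⟩
      rw [(E.pre_fixed ht'.le).1]
      exact Finset.inter_subset_right

/-- After the last round the two endpoints of an edge agree on whether it is selected. -/
lemma mem_selected_comm (hinj : Set.InjOn E.ident E.graph.edgeSet) (hh : 1 ≤ E.h)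
    (hxy : E.graph.Adj x y) (hx : E.ident s(x, y) ∈ (E.node (rounds E.k E.h) x).selected) :
    E.ident s(x, y) ∈ (E.node (rounds E.k E.h) y).selected := by
  have hR : 0 < rounds E.k E.h := by rw [rounds]; positivity
  obtain ⟨t, ht⟩ : ∃ t, rounds E.k E.h = t + 1 := ⟨_, (Nat.succ_pred_eq_of_pos hR).symm⟩
  have ht' : t < rounds E.k E.h := by omega
  have hnode : ∀ z, E.node (t + 1) z = E.pre t z := fun z => by
    rw [node_succ ht', stageAt_of_not]
    intro p hp
    have := stageTime_add_two_le (k := E.k) hh hp.le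
    omega
  rw [ht, hnode, mem_selected_pre hinj ht'] at hx ⊢
  rcases hx with hx | ⟨z, hxz, he, -, hz⟩
  · refine Or.inr ⟨x, hxy.symm, by rw [Sym2.eq_swap], (selected_subset hinj ht'.le).2 hx, hx⟩
  · rw [eq_of_ident_eq hinj hxz hxy he] at hz
    exact Or.inl hz

lemma output_node_rounds (x : V) : (algorithm E.c (Fintype.card V) E.k E.h).output
    ((algorithm E.c (Fintype.card V) E.k E.h).run E.graph E.ident E.seed (rounds E.k E.h) x) =
      some (E.node (rounds E.k E.h) x).selected := if_pos (E.node_fixed le_rfl).1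

lemma mem_result {e : Sym2 V} : e ∈ (algorithm E.c (Fintype.card V) E.k E.h).result E.graph E.ident
    (rounds E.k E.h) E.seed ↔
      e ∈ E.graph.edgeSet ∧ ∃ x ∈ e, E.ident e ∈ (E.node (rounds E.k E.h) x).selected := by
  unfold LocalAlgorithm.result
  rw [Finset.mem_filter]
  simp only [output_node_rounds, Finset.mem_univ, true_and, Option.some.injEq, exists_eq_left']

/-- Whatever the seeds are, all vertices halt in time, with consistent outputs. -/
theorem haltsBy (hinj : Set.InjOn E.ident E.graph.edgeSet) (hh : 1 ≤ E.h) :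
    (algorithm E.c (Fintype.card V) E.k E.h).HaltsBy E.graph E.ident (rounds E.k E.h) E.seed := by
  intro x
  rw [output_node_rounds, Option.some.injEq]
  ext i
  simp only [LocalAlgorithm.idsAt, Finset.mem_image, Finset.mem_filter, Finset.mem_univ, true_and,
    Finset.mem_coe, mem_result]
  constructor
  · intro hi
    obtain ⟨y, hxy, rfl⟩ := mem_name.1 ((selected_subset hinj le_rfl).1 hi)
    exact ⟨s(x, y), ⟨⟨hxy, x, Sym2.mem_mk_left x y, hi⟩, Sym2.mem_mk_left x y⟩, rfl⟩
  · rintro ⟨e, ⟨⟨he, z, hz, hsel⟩, hx⟩, rfl⟩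
    obtain ⟨y, rfl⟩ := hx
    rcases Sym2.mem_iff.1 hz with rfl | rfl
    · exact hsel
    · rw [Sym2.eq_swap] at hsel ⊢
      exact mem_selected_comm hinj hh (SimpleGraph.Adj.symm he) hsel

end Execution

/-! ### Sufficient local knowledge -/

lemma findSome?_eq_map {α β γ : Type} {l : List α} {f : α → Option β} {g : α → Option γ}
    {φ : β → γ} (h : ∀ a ∈ l, g a = (f a).map φ) : l.findSome? g = (l.findSome? f).map φ := by
  induction l with
  | nil => rfl
  | cons a l ih =>
    rw [List.findSome?_cons, List.findSome?_cons, h a List.mem_cons_self]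
    cases f a with
    | none => exact ih fun b hb => h b (List.mem_cons_of_mem _ hb)
    | some b => rfl

lemma foldl_exploreBy_empty (leads : ℕ → Option (Finset ℕ)) (τ : ℝ) (Q F : List ℕ) :
    Q.foldl (exploreBy leads τ) (∅, F) = (∅, F) := by
  induction Q with
  | nil => rfl
  | cons e Q ih =>
    rw [List.foldl_cons, exploreBy, if_neg fun h => Finset.notMem_empty e h.1, ih]

namespace Execution

variable {V : Type} [Fintype V] [Nonempty V] {E : Execution V} {K : Finset Record} {j i : ℕ}
  {u v x y : V} {e : Sym2 V}

/-- What the vertex `x` announces about itself at the beginning of level `j`. -/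
def announcement (E : Execution V) (j : ℕ) (x : V) : Record :=
  ⟨j, E.name x, (E.cluster j x).map E.name, E.seed x⟩

/-- The records in `K` are true, and they suffice for the simulation of the first `i` trials of the
node `v` at level `j`. -/
structure Knows (E : Execution V) (K : Finset Record) (j : ℕ) (v : V) (i : ℕ) : Prop where
  sound : ∀ r ∈ K, ∃ j y, r = E.announcement j y
  own : ∀ y, E.cluster j y = some v → E.announcement j y ∈ K
  dropped : ∀ x y, E.cluster j x = some v → E.graph.Adj x y → E.cluster j y = none →
    ∃ j' ≤ j, E.cluster j' y = none ∧ E.announcement j' y ∈ K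
  neighbour : ∀ i' < i, ∀ e ∈ E.queries j v i', ∀ u, E.leads j v e = some u →
    ∀ y, E.cluster j y = some u → E.announcement j y ∈ K

lemma cluster_eq_none_of_le {j' : ℕ} (hj : j' ≤ j) (h : E.cluster j' y = none) :
    E.cluster j y = none := by
  induction j, hj using Nat.le_induction with
  | base => exact h
  | succ j _ ih => rw [cluster_succ, ih, Option.bind_none]

lemma ident_mem_name_iff {V : Type} [Fintype V] {E : Execution V} {x y z : V}
    (hinj : Set.InjOn E.ident E.graph.edgeSet) (hxy : E.graph.Adj x y) :
    E.ident s(x, y) ∈ E.name z ↔ z = x ∨ z = y := by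
  rw [mem_name, ← Sym2.mem_iff]
  constructor
  · rintro ⟨w, hzw, h⟩
    have h1 : s(z, w) = s(x, y) := hinj hzw hxy h
    rw [← h1]
    exact Sym2.mem_mk_left z w
  · rintro ⟨w, h⟩
    refine ⟨w, ?_, by rw [h]⟩
    rw [← SimpleGraph.mem_edgeSet, ← h]
    exact hxy

lemma viewEdges_eq (hinj : Set.InjOn E.ident E.graph.edgeSet) (hname : Function.Injective E.name)
    (hK : E.Knows K j v i) :
    viewEdges K j (E.name v) = (edgesAt E.graph (E.cluster j) v).image E.ident := by
  ext a
  rw [viewEdges, Finset.mem_filter, Finset.mem_image, Finset.mem_biUnion]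
  constructor
  · rintro ⟨-, ⟨r, hr, hrj, hrv, har⟩, hmem, hnone⟩
    obtain ⟨j', x, rfl⟩ := hK.sound r hr
    obtain rfl : j' = j := hrj
    obtain ⟨v', hx, hv'⟩ := Option.map_eq_some_iff.1 hrv
    rw [hname hv'] at hx
    obtain ⟨y, hxy, rfl⟩ := mem_name.1 har
    have hay : E.ident s(x, y) ∈ E.name y := (ident_mem_name_iff hinj hxy).2 (Or.inr rfl)
    refine ⟨s(x, y), ?_, rfl⟩
    rcases hy : E.cluster j' y with _ | u
    · obtain ⟨j₁, hj₁, hy₁, hmem₁⟩ := hK.dropped x y hx hxy hy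
      exact absurd hay (hnone _ hmem₁ hj₁ (by rw [announcement, hy₁]; rfl))
    · refine mem_edgesAt_of hxy hx hy ?_
      rintro rfl
      have h1 := hmem _ (hK.own x hx) _ (hK.own y hy) rfl rfl (by rw [announcement, hx]; rfl)
        (by rw [announcement, hy]; rfl) har hay
      exact hxy.ne (hname h1)
  · rintro ⟨e, he, rfl⟩
    obtain ⟨u, huv, x, y, hxy, rfl, hx, hy⟩ := mem_edgesAt_iff.1 he
    have hax : E.ident s(x, y) ∈ E.name x := ident_mem_name hxy
    have hown := hK.own x hx
    refine ⟨⟨_, hown, hax⟩, ⟨_, hown, rfl, by rw [announcement, hx]; rfl, hax⟩, ?_, ?_⟩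
    · intro r hr r' hr' hrj hrj' hrv hrv' har har'
      have key : ∀ r ∈ K, r.level = j → r.cluster = some (E.name v) → E.ident s(x, y) ∈ r.name →
          r.name = E.name x := by
        intro r hr hrj hrv har
        obtain ⟨j', z, rfl⟩ := hK.sound r hr
        obtain rfl : j' = j := hrj
        obtain ⟨v', hz, hv'⟩ := Option.map_eq_some_iff.1 hrv
        rcases (ident_mem_name_iff hinj hxy).1 har with rfl | rfl
        · rfl
        · rw [hz, Option.some.injEq] at hy
          exact absurd (hy ▸ hname hv') huv
      rw [key r hr hrj hrv har, key r' hr' hrj' hrv' har']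
    · intro r hr hrj hrn har
      obtain ⟨j', z, rfl⟩ := hK.sound r hr
      have hz := cluster_eq_none_of_le hrj (Option.map_eq_none_iff.1 hrn)
      rcases (ident_mem_name_iff hinj hxy).1 har with rfl | rfl
      · rw [hz] at hx
        exact absurd hx (by simp)
      · rw [hz] at hy
        exact absurd hy (by simp)

lemma viewLeads_sound (hinj : Set.InjOn E.ident E.graph.edgeSet)
    (hK : E.Knows K j v i) (he : e ∈ edgesAt E.graph (E.cluster j) v)
    {b : Finset ℕ} (hb : viewLeads K j (E.name v) (E.ident e) = some b) :
    ∃ u, E.leads j v e = some u ∧ b = E.name u := by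
  unfold viewLeads at hb
  split_ifs at hb with h
  rw [Option.some.injEq] at hb
  obtain ⟨hbv, r, hr, hrj, hrb, her⟩ := h.choose_spec
  rw [hb] at hbv hrb
  obtain ⟨j', z, rfl⟩ := hK.sound r hr
  obtain rfl : j' = j := hrj
  obtain ⟨w, hz, hw⟩ := Option.map_eq_some_iff.1 hrb
  obtain ⟨u, huv, x, y, hxy, rfl, hx, hy⟩ := mem_edgesAt_iff.1 he
  rcases (ident_mem_name_iff hinj hxy).1 her with rfl | rfl
  · rw [hz, Option.some.injEq] at hx
    exact absurd (by rw [← hw, hx]) hbv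
  · rw [hz, Option.some.injEq] at hy
    exact ⟨u, leads_eq hxy hx (by rw [hz, hy]) huv, by rw [← hw, hy]⟩

lemma viewLeads_eq (hinj : Set.InjOn E.ident E.graph.edgeSet) (hname : Function.Injective E.name)
    (hK : E.Knows K j v i) (he : E.leads j v e = some u)
    (hu : ∀ y, E.cluster j y = some u → E.announcement j y ∈ K) :
    viewLeads K j (E.name v) (E.ident e) = some (E.name u) := by
  obtain ⟨huv, x, y, hxy, rfl, hx, hy⟩ := exists_of_leads he
  have h : ∃ b, b ≠ E.name v ∧ ∃ r ∈ K, r.level = j ∧ r.cluster = some b ∧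
      E.ident s(x, y) ∈ r.name := ⟨E.name u, fun h => huv (hname h), _, hu y hy, rfl,
    by rw [announcement, hy]; rfl, (ident_mem_name_iff hinj hxy).2 (Or.inr rfl)⟩
  have h1 : viewLeads K j (E.name v) (E.ident s(x, y)) = some h.choose := dif_pos h
  obtain ⟨u', hu', hb⟩ := viewLeads_sound hinj hK (mem_edgesAt_of hxy hx hy huv) h1
  rw [he, Option.some.injEq] at hu'
  rw [h1, hb, hu']

lemma viewSeed_eq (hname : Function.Injective E.name)
    (hK : E.Knows K j v i) {j' : ℕ} (hx : E.announcement j' x ∈ K) :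
    viewSeed K (E.name x) = E.seed x := by
  have h : ∃ r ∈ K, r.name = E.name x := ⟨_, hx, rfl⟩
  rw [viewSeed, dif_pos h]
  obtain ⟨hmem, hr⟩ := h.choose_spec
  obtain ⟨j₁, y, hy⟩ := hK.sound _ hmem
  rw [hy] at hr ⊢
  rw [← hname (hr : E.name y = E.name x)]
  rfl

lemma foldl_exploreBy_eq (hinj : Set.InjOn E.ident E.graph.edgeSet)
    (hname : Function.Injective E.name) (hK : E.Knows K j v i) (τ : ℝ) (Q : List (Sym2 V))
    (s : Finset (Sym2 V) × List (Sym2 V)) (hs : s.1 ⊆ edgesAt E.graph (E.cluster j) v)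
    (hQ : ∀ e ∈ Q, e ∈ edgesAt E.graph (E.cluster j) v ∧ ∀ u, E.leads j v e = some u →
      ∀ y, E.cluster j y = some u → E.announcement j y ∈ K) :
    (Q.map E.ident).foldl (exploreBy (viewLeads K j (E.name v)) τ)
      (s.1.image E.ident, s.2.map E.ident) =
      ((Q.foldl (explore E.graph (E.cluster j) v τ) s).1.image E.ident,
        (Q.foldl (explore E.graph (E.cluster j) v τ) s).2.map E.ident) := by
  induction Q generalizing s with
  | nil => rfl
  | cons e Q ih =>
    have hstep : exploreBy (viewLeads K j (E.name v)) τ (s.1.image E.ident, s.2.map E.ident)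
        (E.ident e) = ((explore E.graph (E.cluster j) v τ s e).1.image E.ident,
          (explore E.graph (E.cluster j) v τ s e).2.map E.ident) := by
      obtain ⟨he, hu⟩ := hQ e List.mem_cons_self
      have hmem : E.ident e ∈ s.1.image E.ident ↔ e ∈ s.1 := by
        refine ⟨fun h => ?_, Finset.mem_image_of_mem _⟩
        obtain ⟨e', he', h'⟩ := Finset.mem_image.1 h
        rwa [← hinj (edgesAt_subset _ _ (hs he')) (edgesAt_subset _ _ he) h']
      simp only [exploreBy, explore, hmem, List.length_map]
      split_ifs with hc
      · refine Prod.ext ?_ (by simp)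
        simp only
        rw [Finset.filter_image]
        congr 1
        refine Finset.filter_congr fun e' he' => not_congr ?_
        obtain ⟨u, huv, x, y, hxy, rfl, hx, hy⟩ := mem_edgesAt_iff.1 he
        have hl := leads_eq hxy hx hy huv
        have hl' : leadsTo E.graph (E.cluster j) v s(x, y) = some u := hl
        rw [viewLeads_eq hinj hname hK hl (hu u hl), hl']
        constructor
        · intro h
          obtain ⟨u', hu', hb⟩ := viewLeads_sound hinj hK (hs he') h
          rw [hname hb]
          exact hu'
        · intro h
          exact viewLeads_eq hinj hname hK h (hu u hl)
      · rfl
    rw [List.map_cons, List.foldl_cons, List.foldl_cons, hstep]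
    refine ih _ ?_ fun e' he' => hQ e' (List.mem_cons_of_mem _ he')
    exact (foldl_explore_subset (cl := E.cluster j) v τ [e] s).trans hs

lemma viewDraws_eq {X : Finset (Sym2 V)} (hX : X.Nonempty) (u : ℕ → ℕ) :
    viewDraws j E.c (Fintype.card V) E.k E.h (X.image E.ident) u =
      ((List.range (numQueries E.c (Fintype.card V) E.k E.h j)).map fun q =>
        pickEdge E.ident X (u q)).map E.ident := by
  rw [viewDraws, List.map_map]
  exact List.map_congr_left fun q _ => (ident_pickEdge E.ident hX (u q)).symm

/-- Sufficient knowledge determines the course of the trials. -/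
lemma viewState_eq (hinj : Set.InjOn E.ident E.graph.edgeSet) (hname : Function.Injective E.name)
    (hK : E.Knows K j v i) (hv : E.cluster j v = some v) {i' : ℕ} (hi : i' ≤ i) :
    viewState K j (E.name v) E.c (Fintype.card V) E.k E.h i' =
      ((E.state j v i').1.image E.ident, (E.state j v i').2.map E.ident) := by
  induction i' with
  | zero =>
    rw [viewState, foldStream, viewEdges_eq hinj hname hK]
    rfl
  | succ i' ih =>
    have ih' := ih (by omega)
    rw [state_succ]
    unfold viewState at ih' ⊢
    rw [foldStream, ih', viewSeed_eq hname hK (hK.own v hv)]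
    have hsub := (E.explored_state j v i').unexplored_subset
    by_cases hX : (E.state j v i').1.Nonempty
    · simp only [viewDraws_eq hX]
      refine foldl_exploreBy_eq hinj hname hK _ _ _ hsub fun e he => ?_
      have he' : e ∈ (E.state j v i').1 := by
        obtain ⟨q, -, rfl⟩ := List.mem_map.1 he
        exact pickEdge_mem _ hX _
      exact ⟨hsub he', fun u hu => hK.neighbour i' (by omega) e
        (Finset.mem_inter.2 ⟨List.mem_toFinset.2 he, he'⟩) u hu⟩
    · rw [trialStep, foldl_explore_of_not _ _ _ _ _ fun h => hX h.1]
      rw [Finset.not_nonempty_iff_eq_empty.1 hX, Finset.image_empty, foldl_exploreBy_empty]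

lemma viewQueries_eq (hinj : Set.InjOn E.ident E.graph.edgeSet) (hname : Function.Injective E.name)
    (hK : E.Knows K j v i) (hv : E.cluster j v = some v) :
    viewQueries K j (E.name v) E.c (Fintype.card V) E.k E.h i =
      (E.queries j v i).image E.ident := by
  rw [viewQueries, viewState_eq hinj hname hK hv le_rfl, viewSeed_eq hname hK (hK.own v hv),
    queries]
  by_cases hX : (E.state j v i).1.Nonempty
  · simp only [viewDraws_eq hX]
    ext a
    simp only [Finset.mem_inter, List.mem_toFinset, List.mem_map (f := E.ident), Finset.mem_image]
    constructor
    · rintro ⟨⟨e, he, rfl⟩, -⟩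
      obtain ⟨q, -, rfl⟩ := List.mem_map.1 he
      exact ⟨_, ⟨he, pickEdge_mem _ hX _⟩, rfl⟩
    · rintro ⟨e, ⟨he, he'⟩, rfl⟩
      exact ⟨⟨e, he, rfl⟩, e, he', rfl⟩
  · rw [Finset.not_nonempty_iff_eq_empty.1 hX]
    simp

lemma viewFound_eq (hinj : Set.InjOn E.ident E.graph.edgeSet) (hname : Function.Injective E.name)
    (hK : E.Knows K j v (2 * E.h)) (hv : E.cluster j v = some v) :
    viewFound K j (E.name v) E.c (Fintype.card V) E.k E.h = (E.found j v).map E.ident := by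
  rw [viewFound, viewState_eq hinj hname hK hv le_rfl]
  rfl

lemma viewJoin_eq (hinj : Set.InjOn E.ident E.graph.edgeSet) (hname : Function.Injective E.name)
    (hK : E.Knows K j v (2 * E.h)) (hv : E.cluster j v = some v) :
    viewJoin K j (E.name v) E.c (Fintype.card V) E.k E.h = (E.join j v).map E.name := by
  unfold viewJoin join joins
  rw [viewFound_eq hinj hname hK hv, viewSeed_eq hname hK (hK.own v hv)]
  by_cases hm : E.mark j v = true
  · rw [if_pos hm, if_pos (show (E.seed v j).2 = true from hm)]
    rfl
  · rw [if_neg hm, if_neg (show ¬ (E.seed v j).2 = true from hm), List.findSome?_map]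
    refine findSome?_eq_map fun e he => ?_
    obtain ⟨u, huv, hu, x, y, hxy, rfl, hx, hy⟩ := exists_of_mem_found he
    obtain ⟨i', hi', hq⟩ := exists_queries_of_mem_state he
    have hu' : leadsTo E.graph (E.cluster j) v s(x, y) = some u := hu
    have hknown := hK.neighbour i' hi' _ hq u hu
    rw [Function.comp_apply, viewLeads_eq hinj hname hK hu hknown, hu', Option.filter_some,
      Option.filter_some, viewSeed_eq hname hK (hknown u (cluster_center hy))]
    change (if E.mark j u = true then _ else _) = Option.map _ (if E.mark j u = true then _ else _)
    split_ifs <;> rfl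

end Execution

/-! ### Gossip -/

lemma level_div {h i : ℕ} (j : ℕ) (hi : i < 2 * h + 1) :
    (j * (2 * h + 1) + i) / (2 * h + 1) = j := by
  rw [mul_comm, Nat.mul_add_div (by omega), Nat.div_eq_of_lt hi, add_zero]

lemma level_mod {h i : ℕ} (j : ℕ) (hi : i < 2 * h + 1) :
    (j * (2 * h + 1) + i) % (2 * h + 1) = i := by
  rw [mul_comm, Nat.mul_add_mod, Nat.mod_eq_of_lt hi]

lemma exists_level_eq (h p : ℕ) : ∃ j i, i < 2 * h + 1 ∧ p = j * (2 * h + 1) + i :=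
  ⟨p / (2 * h + 1), p % (2 * h + 1), Nat.mod_lt _ (by omega), by rw [mul_comm, Nat.div_add_mod]⟩

lemma stageTime_succ {h i : ℕ} (j : ℕ) (hi : i < 2 * h + 1) :
    stageTime h (j * (2 * h + 1) + i + 1) = stageTime h (j * (2 * h + 1) + i) + 5 * 3 ^ j := by
  rw [stageTime, level_div j hi]

lemma lt_of_stageTime_lt {h p q : ℕ} (hlt : stageTime h q < stageTime h p) : q < p :=
  (stageTime_strictMono h).lt_iff_lt.1 hlt

lemma level_lt_of_stage_lt {h k j i : ℕ} (hlt : j * (2 * h + 1) + i < (k + 1) * (2 * h + 1)) :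
    j < k + 1 := by
  by_contra hj
  have h1 : (k + 1) * (2 * h + 1) ≤ j * (2 * h + 1) := Nat.mul_le_mul_right _ (by omega)
  omega

namespace Execution

variable {V : Type} [Fintype V] {E : Execution V} {p t : ℕ} {x y : V}

/-- In a connected graph on at least three vertices, different vertices have different names. -/
lemma name_injective (hinj : Set.InjOn E.ident E.graph.edgeSet) (hconn : E.graph.Connected)
    (hn : 3 ≤ Fintype.card V) : Function.Injective E.name := by
  intro x y hxy
  by_contra hne
  have key : ∀ {a b : V}, E.name a = E.name b → a ≠ b → ∀ z, E.graph.Adj a z → z = b := by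
    intro a b hab hne z haz
    have h1 : E.ident s(a, z) ∈ E.name b := hab ▸ ident_mem_name haz
    rcases (ident_mem_name_iff hinj haz).1 h1 with h | h
    · exact absurd h.symm hne
    · exact h.symm
  have hclosed : ∀ {a b : V} (w : E.graph.Walk a b), a = x ∨ a = y → b = x ∨ b = y := by
    intro a b w
    induction w with
    | nil => exact id
    | cons hadj w ih =>
      rintro (rfl | rfl)
      · exact ih (Or.inr (key hxy hne _ hadj))
      · exact ih (Or.inl (key hxy.symm (Ne.symm hne) _ hadj))
  have huniv : (Finset.univ : Finset V) ⊆ {x, y} := by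
    intro z _
    obtain ⟨w⟩ := hconn.preconnected x z
    simpa using hclosed w (Or.inl rfl)
  have := (Finset.card_le_card huniv).trans Finset.card_le_two
  rw [Finset.card_univ] at this
  omega

lemma known_transfer (hinj : Set.InjOn E.ident E.graph.edgeSet) (ht : t < rounds E.k E.h)
    (hxy : E.graph.Adj x y) (ha : E.ident s(x, y) ∈ (E.node t x).active) :
    (E.node t x).known ⊆ (E.node (t + 1) y).known := by
  refine Finset.Subset.trans (fun r hr => ?_) (pre_subset_node_succ ht).1
  rw [mem_known_pre hinj ht]
  exact Or.inr ⟨x, hxy.symm, by rwa [Sym2.eq_swap], hr⟩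

/-- Records spread along active edges by one hop in every round. -/
lemma known_spread (hinj : Set.InjOn E.ident E.graph.edgeSet) {H : SimpleGraph V} {t₀ l : ℕ}
    (hH : ∀ x y, H.Adj x y → E.graph.Adj x y ∧ E.ident s(x, y) ∈ (E.node t₀ x).active)
    (hxy : Within H l x y) (ht : t₀ ≤ t) (htR : t + l ≤ rounds E.k E.h) :
    (E.node t x).known ⊆ (E.node (t + l) y).known := by
  obtain ⟨w, hw⟩ := hxy
  have key : ∀ {x y : V} (w : H.Walk x y) (t : ℕ), t₀ ≤ t → t + w.length ≤ rounds E.k E.h →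
      (E.node t x).known ⊆ (E.node (t + w.length) y).known := by
    intro x y w
    induction w with
    | nil => exact fun _ _ _ => subset_rfl
    | cons hadj w ih =>
      intro t ht htR
      rw [SimpleGraph.Walk.length_cons] at htR ⊢
      obtain ⟨h1, h2⟩ := hH _ _ hadj
      have h3 := known_transfer hinj (by omega) h1 ((node_mono ht (by omega)).2.1 h2)
      have h4 := ih (t + 1) (by omega) (by omega)
      rw [show t + (w.length + 1) = t + 1 + w.length by omega]
      exact h3.trans h4
  exact (key w t ht (by omega)).trans (node_mono (by omega) htR).1

variable [Nonempty V]

/-- The effect that stage `p` should have at the vertex `x`: that of the simulated execution. -/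
def idealStage (E : Execution V) (p : ℕ) (x : V) (s : NodeState) : NodeState :=
  if p % (2 * E.h + 1) < 2 * E.h then
    { s with
      active := s.active ∪ ((E.cluster (p / (2 * E.h + 1)) x).elim ∅ fun v =>
        (E.queries (p / (2 * E.h + 1)) v (p % (2 * E.h + 1))).image E.ident) ∩ E.name x }
  else
    { s with
      cluster := (E.cluster (p / (2 * E.h + 1) + 1) x).map E.name
      known := insert (E.announcement (p / (2 * E.h + 1) + 1) x) s.known
      active := s.active ∪ ((E.cluster (p / (2 * E.h + 1)) x).elim ∅ fun v =>
        ((E.found (p / (2 * E.h + 1)) v).map E.ident).toFinset) ∩ E.name x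
      selected := s.selected ∪ ((E.cluster (p / (2 * E.h + 1)) x).elim ∅ fun v =>
        ((E.found (p / (2 * E.h + 1)) v).map E.ident).toFinset) ∩ E.name x }

/-- All stages before stage `p` have the effect that they should have. -/
def CorrectBefore (E : Execution V) (p : ℕ) : Prop :=
  ∀ q < p, ∀ x, performStage E.c (Fintype.card V) E.k E.h q (E.pre (stageTime E.h q) x) =
    E.idealStage q x (E.pre (stageTime E.h q) x)

/-- The number of stages. -/
def stages (E : Execution V) : ℕ := (E.k + 1) * (2 * E.h + 1)

lemma node_stage (hh : 1 ≤ E.h) (hp : p ≤ E.stages) (hC : E.CorrectBefore p) {q : ℕ} (hq : q < p) :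
    E.node (stageTime E.h q + 1) x = E.idealStage q x (E.pre (stageTime E.h q) x) := by
  have h1 := stageTime_add_two_le (k := E.k) hh ((hq.trans_le hp).le)
  rw [node_succ (by omega), stageAt_stageTime (hq.trans_le hp), hC q hq x]

/-- To prove a property of the states of all vertices before stage `p`, consider the exchange of
messages and the ideal stages. -/
lemma node_induction (hh : 1 ≤ E.h) (hp : p ≤ E.stages) (hC : E.CorrectBefore p)
    {P : V → NodeState → Prop} (h0 : ∀ x, P x (E.node 0 x))
    (hpre : ∀ t < rounds E.k E.h, (∀ x, P x (E.node t x)) → ∀ x, P x (E.pre t x))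
    (hstage : ∀ q < p, ∀ x, P x (E.pre (stageTime E.h q) x) →
      P x (E.idealStage q x (E.pre (stageTime E.h q) x)))
    (htR : t ≤ rounds E.k E.h) (ht : ∀ q < E.stages, stageTime E.h q < t → q < p) (x : V) :
    P x (E.node t x) := by
  induction t generalizing x with
  | zero => exact h0 x
  | succ t ih =>
    have h1 := hpre t (by omega) (fun x => ih (by omega) (fun q hq hqt => ht q hq (by omega)) x)
    by_cases hex : ∃ q < E.stages, stageTime E.h q = t
    · obtain ⟨q, hq, rfl⟩ := hex
      have hqp := ht q hq (by omega)
      rw [node_stage hh hp hC hqp]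
      exact hstage q hqp x (h1 x)
    · push Not at hex
      rw [node_succ (by omega), stageAt_of_not hex]
      exact h1 x

lemma announcement_sound (hinj : Set.InjOn E.ident E.graph.edgeSet) (hh : 1 ≤ E.h)
    (hp : p ≤ E.stages) (hC : E.CorrectBefore p) {r : Record}
    (hr : r ∈ (E.node (stageTime E.h p) x).known) : ∃ j y, r = E.announcement j y := by
  have hR := stageTime_add_two_le (k := E.k) hh hp
  refine node_induction (P := fun x s => ∀ r ∈ s.known, ∃ j y, r = E.announcement j y) hh hp hC
    ?_ ?_ ?_ (by omega) (fun q _ hq => lt_of_stageTime_lt hq) x r hr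
  · intro x r hr
    rw [node_zero, Finset.mem_singleton] at hr
    exact ⟨0, x, hr⟩
  · intro t ht ih x r hr
    rcases (mem_known_pre hinj ht).1 hr with h | ⟨y, -, -, h⟩
    · exact ih x r h
    · exact ih y r h
  · intro q _ x ih r hr
    unfold idealStage at hr
    split_ifs at hr
    · exact ih r hr
    · rcases Finset.mem_insert.1 hr with rfl | hr
      · exact ⟨_, x, rfl⟩
      · exact ih r hr

lemma cluster_node (hh : 1 ≤ E.h) (hp : p ≤ E.stages) (hC : E.CorrectBefore p) {q : ℕ} (hq : q ≤ p)
    (x : V) : (E.node (stageTime E.h q) x).cluster =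
      (E.cluster (q / (2 * E.h + 1)) x).map E.name := by
  induction q with
  | zero => rw [Nat.zero_div]; rfl
  | succ q ih =>
    have hR := stageTime_add_two_le (k := E.k) hh (hq.trans hp)
    obtain ⟨j, i, hi, rfl⟩ := exists_level_eq E.h q
    have hT := stageTime_succ j hi
    have hpos : 0 < 3 ^ j := by positivity
    have hconst : ∀ t, stageTime E.h (j * (2 * E.h + 1) + i) + 1 ≤ t →
        t ≤ stageTime E.h (j * (2 * E.h + 1) + i + 1) → (E.node t x).cluster =
          (E.node (stageTime E.h (j * (2 * E.h + 1) + i) + 1) x).cluster := by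
      intro t ht
      induction t, ht using Nat.le_induction with
      | base => exact fun _ => rfl
      | succ t ht iht =>
        intro ht'
        rw [← iht (by omega), node_succ (by omega), stageAt_of_not]
        · rfl
        · rintro q' - rfl
          have h1 := (stageTime_strictMono E.h).lt_iff_lt.1 (show stageTime E.h _ < _ from ht)
          have h2 := (stageTime_strictMono E.h).lt_iff_lt.1 (show _ < stageTime E.h _ from ht')
          omega
    rw [hconst _ (by omega) le_rfl, node_stage hh hp hC (by omega), idealStage, level_div j hi,
      level_mod j hi]
    split_ifs with hi'
    · have h1 := ih (by omega)
      rw [level_div j hi] at h1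
      rw [add_assoc, level_div j (by omega)]
      exact h1
    · have h2 : j * (2 * E.h + 1) + i + 1 = (j + 1) * (2 * E.h + 1) + 0 := by
        rw [show i = 2 * E.h by omega]
        ring
      rw [h2, level_div _ (by omega)]

/-- Two rounds after a trial its query edges are active at both endpoints. -/
lemma queries_active (hinj : Set.InjOn E.ident E.graph.edgeSet) (hh : 1 ≤ E.h) (hp : p ≤ E.stages)
    (hC : E.CorrectBefore p) {j i : ℕ} (hi : i < 2 * E.h) (hq : j * (2 * E.h + 1) + i < p) {v : V}
    {e : Sym2 V} (he : e ∈ E.queries j v i) (hx : x ∈ e) :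
    E.ident e ∈ (E.node (stageTime E.h (j * (2 * E.h + 1) + i) + 2) x).active := by
  have hR := stageTime_add_two_le (k := E.k) hh ((hq.trans_le hp).le)
  obtain ⟨u, -, y, z, hyz, rfl, hy, hz⟩ := exists_of_mem_queries he
  have h1 : E.ident s(y, z) ∈ (E.node (stageTime E.h (j * (2 * E.h + 1) + i) + 1) y).active := by
    rw [node_stage hh hp hC hq, idealStage, level_mod j (by omega), level_div j (by omega),
      if_pos hi, hy]
    exact Finset.mem_union_right _ (Finset.mem_inter.2
      ⟨Finset.mem_image_of_mem _ he, ident_mem_name hyz⟩)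
  rcases Sym2.mem_iff.1 hx with rfl | rfl
  · exact (node_mono (by omega) hR).2.1 h1
  · refine (pre_subset_node_succ (by omega)).2.1 ?_
    rw [mem_active_pre hinj (by omega)]
    exact Or.inr ⟨y, hyz.symm, by rw [Sym2.eq_swap], h1⟩

/-- The spanner edges of the levels below `j` are active from the last stage below level `j` on. -/
lemma below_active (hinj : Set.InjOn E.ident E.graph.edgeSet) (hh : 1 ≤ E.h) (hp : p ≤ E.stages)
    (hC : E.CorrectBefore p) {j q : ℕ} (hj : j * (2 * E.h + 1) ≤ q + 1) (hq : q ≤ p) (x y : V)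
    (hxy : (E.below j).Adj x y) :
    E.graph.Adj x y ∧ E.ident s(x, y) ∈ (E.node (stageTime E.h q) x).active := by
  rw [below, SimpleGraph.fromEdgeSet_adj] at hxy
  obtain ⟨⟨j', hj', v, he⟩, -⟩ := hxy
  have hR := stageTime_add_two_le (k := E.k) hh (hq.trans hp)
  obtain ⟨u, -, -, x', y', hadj, hs, -⟩ := exists_of_mem_found he
  obtain ⟨i, hi, hmem⟩ := exists_queries_of_mem_state he
  have h1 : (j' + 1) * (2 * E.h + 1) ≤ j * (2 * E.h + 1) := Nat.mul_le_mul_right _ hj'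
  have h2 : j' * (2 * E.h + 1) + i + 1 ≤ q := by
    rw [add_mul] at h1
    omega
  have h3 := (stageTime_strictMono E.h).monotone h2
  rw [stageTime_succ j' (by omega)] at h3
  have hpos : 0 < 3 ^ j' := by positivity
  refine ⟨?_, (node_mono (by omega) (by omega)).2.1
    (queries_active hinj hh hp hC hi (by omega) hmem (Sym2.mem_mk_left x y))⟩
  rw [← SimpleGraph.mem_edgeSet, hs]
  exact hadj

/-! ### The implementation follows the simulation -/

/-- At the beginning of a level, the vertices of a cluster know each other. -/
lemma knows_own (hinj : Set.InjOn E.ident E.graph.edgeSet) (hh : 1 ≤ E.h) (hp : p ≤ E.stages)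
    (hC : E.CorrectBefore p) {j : ℕ} (hj : j * (2 * E.h + 1) ≤ p) {v : V}
    (hx : E.cluster j x = some v) (hy : E.cluster j y = some v) :
    E.announcement j y ∈ (E.node (stageTime E.h (j * (2 * E.h + 1))) x).known := by
  have hR := stageTime_add_two_le (k := E.k) hh (hj.trans hp)
  rcases j with _ | j
  · cases hx
    cases hy
    rw [zero_mul, stageTime, node_zero]
    exact Finset.mem_singleton.2 rfl
  · -- the announcement is made in the last stage of the previous level
    have hlast : (j + 1) * (2 * E.h + 1) = j * (2 * E.h + 1) + 2 * E.h + 1 := by ring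
    rw [hlast] at hj hR ⊢
    have hT := stageTime_succ j (show 2 * E.h < 2 * E.h + 1 by omega)
    have hrad := two_mul_radius (j + 1)
    rw [pow_succ] at hrad
    set q := j * (2 * E.h + 1) + 2 * E.h with hq
    have h1 : E.announcement (j + 1) y ∈ (E.node (stageTime E.h q + 1) y).known := by
      rw [node_stage hh hp hC (by omega), idealStage, level_mod j (by omega),
        level_div j (by omega), if_neg (lt_irrefl _)]
      exact Finset.mem_insert_self _ _
    have h2 := known_spread hinj (below_active hinj hh hp hC (j := j + 1) (q := q)
      (by rw [hlast]) (by omega)) (within_of_cluster_eq hy hx) (Nat.le_succ (stageTime E.h q))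
      (by omega) h1
    exact (node_mono (by omega) (by omega)).1 h2

lemma exists_join_eq_none {j : ℕ} (hy : E.cluster j y = none) :
    ∃ j' < j, ∃ w, E.cluster j' y = some w ∧ E.join j' w = none := by
  induction j with
  | zero => exact absurd hy (by simp [cluster])
  | succ j ih =>
    rcases h : E.cluster j y with _ | w
    · obtain ⟨j', hj', h'⟩ := ih h
      exact ⟨j', by omega, h'⟩
    · exact ⟨j, by omega, w, h, by rw [← cluster_succ_eq h, hy]⟩

lemma exists_cluster_of_le {j j' : ℕ} {v : V} (hj : j' ≤ j) (hx : E.cluster j x = some v) :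
    ∃ v', E.cluster j' x = some v' := by
  rcases h : E.cluster j' x with _ | v'
  · rw [cluster_eq_none_of_le hj h] at hx
    exact absurd hx (by simp)
  · exact ⟨v', rfl⟩

/-- At the beginning of a level, the vertices of a cluster know which of their neighbours are in no
cluster: when such a neighbour was dropped, its cluster had found an edge to theirs. -/
lemma knows_dropped (hinj : Set.InjOn E.ident E.graph.edgeSet) (hh : 1 ≤ E.h) (hp : p ≤ E.stages)
    (hC : E.CorrectBefore p) (hE : E.Good) {j : ℕ} (hjk : j ≤ E.k) (hj : j * (2 * E.h + 1) ≤ p)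
    {v z : V} (hz : E.cluster j z = some v) (hx : E.cluster j x = some v) (hxy : E.graph.Adj x y)
    (hy : E.cluster j y = none) : ∃ j' ≤ j, E.cluster j' y = none ∧
      E.announcement j' y ∈ (E.node (stageTime E.h (j * (2 * E.h + 1))) z).known := by
  have hR := stageTime_add_two_le (k := E.k) hh (hj.trans hp)
  obtain ⟨j', hj', w, hw, hjoin⟩ := exists_join_eq_none hy
  obtain ⟨j, rfl⟩ : ∃ j₁, j = j₁ + 1 := ⟨j - 1, by omega⟩
  refine ⟨j' + 1, hj', by rw [cluster_succ_eq hw, hjoin], ?_⟩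
  have hlast : (j + 1) * (2 * E.h + 1) = j * (2 * E.h + 1) + 2 * E.h + 1 := by ring
  rw [hlast] at hj hR ⊢
  have hT := stageTime_succ j (show 2 * E.h < 2 * E.h + 1 by omega)
  -- a cluster that is dropped has explored all its edges
  obtain ⟨u, hu⟩ := exists_cluster_of_le hj'.le hx
  obtain ⟨u', hu'⟩ := exists_cluster_of_le hj' hx
  have huw : u ≠ w := by
    rintro rfl
    rw [cluster_succ_eq hu, hjoin] at hu'
    exact absurd hu' (by simp)
  have hfound := exists_found (hE.explored_of_join_eq_none (by omega) hjoin) hxy.symm hw hu huw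
  have hyx := (within_of_exists_found hfound hw hu).mono (below_mono (show j' + 1 ≤ j + 1 from hj'))
    (show 4 * radius j' + 1 ≤ 4 * radius j + 1 by
      have h1 := two_mul_radius j
      have h2 := two_mul_radius j'
      have h3 : 3 ^ j' ≤ 3 ^ j := Nat.pow_le_pow_right (by norm_num) (by omega)
      omega)
  have hyz := hyx.trans (within_of_cluster_eq hx hz)
  have hrad := two_mul_radius j
  rw [radius] at hyz
  set q := j * (2 * E.h + 1) + 2 * E.h with hq
  set q' := j' * (2 * E.h + 1) + 2 * E.h with hq'
  have hqq : q' ≤ q := by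
    have : j' * (2 * E.h + 1) ≤ j * (2 * E.h + 1) := Nat.mul_le_mul_right _ (by omega)
    omega
  have hTT := (stageTime_strictMono E.h).monotone hqq
  have h1 : E.announcement (j' + 1) y ∈ (E.node (stageTime E.h q' + 1) y).known := by
    rw [node_stage hh hp hC (by omega), idealStage, level_mod j' (by omega),
      level_div j' (by omega), if_neg (lt_irrefl _)]
    exact Finset.mem_insert_self _ _
  have h2 := (node_mono (show stageTime E.h q' + 1 ≤ stageTime E.h q + 1 by omega) (by omega)).1 h1
  have h3 := known_spread hinj (below_active hinj hh hp hC (j := j + 1) (q := q)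
    (by rw [hlast]) (by omega)) hyz (Nat.le_succ (stageTime E.h q)) (by omega) h2
  exact (node_mono (by omega) (by omega)).1 h3

/-- After a trial, the vertices of a cluster know the vertices of the clusters to which its query
edges lead. -/
lemma knows_neighbour (hinj : Set.InjOn E.ident E.graph.edgeSet) (hh : 1 ≤ E.h) (hp : p ≤ E.stages)
    (hC : E.CorrectBefore p) {j i : ℕ} (hi : i < 2 * E.h) (hq : j * (2 * E.h + 1) + i < p)
    {v u z : V} {e : Sym2 V} (hz : E.cluster j z = some v) (he : e ∈ E.queries j v i)
    (hu : E.leads j v e = some u) (hy : E.cluster j y = some u) :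
    E.announcement j y ∈ (E.node (stageTime E.h p) z).known := by
  have hR := stageTime_add_two_le (k := E.k) hh hp
  obtain ⟨-, x', y', hadj, rfl, hx', hy'⟩ := exists_of_leads hu
  have hT := stageTime_succ j (show i < 2 * E.h + 1 by omega)
  have hTp := (stageTime_strictMono E.h).monotone (show j * (2 * E.h + 1) + i + 1 ≤ p from hq)
  have hrad := two_mul_radius j
  have h0 := (stageTime_strictMono E.h).monotone
    (show j * (2 * E.h + 1) ≤ j * (2 * E.h + 1) + i by omega)
  have h1 := knows_own hinj hh hp hC (show j * (2 * E.h + 1) ≤ p by omega) hy' hy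
  have hact := queries_active hinj hh hp hC hi hq he (Sym2.mem_mk_right x' y')
  have hbelow := below_active hinj hh hp hC (j := j) (q := j * (2 * E.h + 1) + i) (by omega)
    (by omega)
  set q := j * (2 * E.h + 1) + i with hq'
  have h2 := (node_mono (show stageTime E.h (j * (2 * E.h + 1)) ≤ stageTime E.h q + 2 by omega)
    (by omega)).1 h1
  have h3 := known_transfer hinj (by omega) hadj.symm (by rwa [Sym2.eq_swap]) h2
  have h4 := known_spread hinj hbelow (within_of_cluster_eq hx' hz)
    (show stageTime E.h q ≤ stageTime E.h q + 2 + 1 by omega) (by omega) h3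
  exact (node_mono (by omega) (by omega)).1 h4

lemma correctBefore_succ (hinj : Set.InjOn E.ident E.graph.edgeSet)
    (hname : Function.Injective E.name) (hh : 1 ≤ E.h) (hE : E.Good) (hp : p < E.stages)
    (hC : E.CorrectBefore p) : E.CorrectBefore (p + 1) := by
  intro q hq x
  rcases Nat.lt_succ_iff_lt_or_eq.1 hq with hq | rfl
  · exact hC q hq x
  have hR := stageTime_add_two_le (k := E.k) hh hp.le
  have hcl : (E.pre (stageTime E.h q) x).cluster =
      (E.cluster (q / (2 * E.h + 1)) x).map E.name := cluster_node hh hp.le hC le_rfl x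
  obtain ⟨hpn, hps⟩ := E.pre_fixed (x := x) (show stageTime E.h q ≤ rounds E.k E.h by omega)
  obtain ⟨j, i, hi, rfl⟩ := exists_level_eq E.h q
  set T := stageTime E.h (j * (2 * E.h + 1) + i) with hT
  have hj : j ≤ E.k := by
    by_contra hj
    have h1 : (E.k + 1) * (2 * E.h + 1) ≤ j * (2 * E.h + 1) := Nat.mul_le_mul_right _ (by omega)
    rw [stages] at hp
    omega
  have hTj := (stageTime_strictMono E.h).monotone
    (show j * (2 * E.h + 1) ≤ j * (2 * E.h + 1) + i by omega)
  have hsub : (E.node (stageTime E.h (j * (2 * E.h + 1))) x).known ⊆ (E.pre T x).known :=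
    (node_mono hTj (by omega)).1.trans node_subset_pre.1
  have hK : ∀ v, E.cluster j x = some v → E.Knows (E.pre T x).known j v i := by
    intro v hv
    refine ⟨?_, fun y hy => hsub (knows_own hinj hh hp.le hC (by omega) hv hy), ?_, ?_⟩
    · intro r hr
      rcases (mem_known_pre hinj (by omega)).1 hr with h | ⟨y, -, -, h⟩
      · exact announcement_sound hinj hh hp.le hC h
      · exact announcement_sound hinj hh hp.le hC h
    · intro x' y hx' hadj hy
      obtain ⟨j', hj', h1, h2⟩ := knows_dropped hinj hh hp.le hC hE hj (by omega) hv hx' hadj hy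
      exact ⟨j', hj', h1, hsub h2⟩
    · intro i' hi' e he u hu y hy
      exact node_subset_pre.1
        (knows_neighbour hinj hh hp.le hC (by omega) (by omega) hv he hu hy)
  rw [level_div j hi] at hcl
  unfold performStage idealStage
  rw [level_div j hi, level_mod j hi, hcl, hpn, hps]
  rcases hv : E.cluster j x with _ | v
  · have hv' : E.cluster (j + 1) x = none := cluster_eq_none_of_le (Nat.le_succ j) hv
    simp [hv', announcement]
  · have hcv := cluster_center hv
    split_ifs with hi'
    · simp only [Option.map_some, Option.elim_some, viewQueries_eq hinj hname (hK v hv) hcv]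
    · obtain rfl : i = 2 * E.h := by omega
      simp only [Option.map_some, Option.elim_some, Option.bind_some,
        viewFound_eq hinj hname (hK v hv) hcv, viewJoin_eq hinj hname (hK v hv) hcv,
        cluster_succ_eq hv, announcement]

/-- In a good execution, the implementation follows the simulation. -/
theorem Good.correct (hE : E.Good) (hinj : Set.InjOn E.ident E.graph.edgeSet)
    (hname : Function.Injective E.name) (hh : 1 ≤ E.h) : E.CorrectBefore E.stages := by
  have key : ∀ p ≤ E.stages, E.CorrectBefore p := by
    intro p
    induction p with
    | zero => exact fun _ q hq => absurd hq (Nat.not_lt_zero q)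
    | succ p ih => exact fun hp => correctBefore_succ hinj hname hh hE hp (ih (by omega))
  exact key _ le_rfl

/-- In a good execution, only query edges become active. -/
lemma Good.exists_of_mem_active (hE : E.Good) (hinj : Set.InjOn E.ident E.graph.edgeSet)
    (hname : Function.Injective E.name) (hh : 1 ≤ E.h) (ht : t ≤ rounds E.k E.h) (x : V) :
    ∀ a ∈ (E.node t x).active, ∃ e ∈ E.allQueries, E.ident e = a := by
  refine node_induction (P := fun x s => ∀ a ∈ s.active, ∃ e ∈ E.allQueries, E.ident e = a) hh
    le_rfl (hE.correct hinj hname hh) ?_ ?_ ?_ ht (fun q hq _ => hq) x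
  · intro x a ha
    simp [node_zero] at ha
  · intro t ht ih x a ha
    rcases (mem_active_pre hinj ht).1 ha with h | ⟨y, -, -, h⟩
    · exact ih x a h
    · exact ih y a h
  · intro q hq x ih a ha
    obtain ⟨j, i, hi, rfl⟩ := exists_level_eq E.h q
    have hj := level_lt_of_stage_lt hq
    unfold idealStage at ha
    rw [level_div j hi, level_mod j hi] at ha
    rcases hv : E.cluster j x with _ | v
    · rw [hv] at ha
      split_ifs at ha <;> simp at ha <;> exact ih a ha
    · rw [hv] at ha
      split_ifs at ha with hi'
      · rcases Finset.mem_union.1 ha with ha | ha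
        · exact ih a ha
        · obtain ⟨e, he, rfl⟩ := Finset.mem_image.1 (Finset.mem_inter.1 ha).1
          exact ⟨e, mem_allQueries (by omega) hi' he, rfl⟩
      · rcases Finset.mem_union.1 ha with ha | ha
        · exact ih a ha
        · obtain ⟨e, he, rfl⟩ := List.mem_map.1 (List.mem_toFinset.1 (Finset.mem_inter.1 ha).1)
          obtain ⟨i', hi', hmem⟩ := exists_queries_of_mem_state he
          exact ⟨e, mem_allQueries (by omega) hi' hmem, rfl⟩

/-- In a good execution, only spanner edges are selected. -/
lemma Good.exists_of_mem_selected (hE : E.Good) (hinj : Set.InjOn E.ident E.graph.edgeSet)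
    (hname : Function.Injective E.name) (hh : 1 ≤ E.h) (ht : t ≤ rounds E.k E.h) (x : V) :
    ∀ a ∈ (E.node t x).selected, ∃ e ∈ E.spanner, E.ident e = a := by
  refine node_induction (P := fun x s => ∀ a ∈ s.selected, ∃ e ∈ E.spanner, E.ident e = a) hh le_rfl
    (hE.correct hinj hname hh) ?_ ?_ ?_ ht (fun q hq _ => hq) x
  · intro x a ha
    simp [node_zero] at ha
  · intro t ht ih x a ha
    rcases (mem_selected_pre hinj ht).1 ha with h | ⟨y, -, -, -, h⟩
    · exact ih x a h
    · exact ih y a h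
  · intro q hq x ih a ha
    obtain ⟨j, i, hi, rfl⟩ := exists_level_eq E.h q
    have hj := level_lt_of_stage_lt hq
    unfold idealStage at ha
    rw [level_div j hi, level_mod j hi] at ha
    split_ifs at ha with hi'
    · exact ih a ha
    · rcases Finset.mem_union.1 ha with ha | ha
      · exact ih a ha
      · have ha := (Finset.mem_inter.1 ha).1
        rcases hv : E.cluster j x with _ | v
        · rw [hv] at ha
          simp at ha
        · rw [hv] at ha
          obtain ⟨e, he, rfl⟩ := List.mem_map.1 (List.mem_toFinset.1 ha)
          exact ⟨e, mem_spanner.2 ⟨j, hj, v, he⟩, rfl⟩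

/-- In a good execution, the implementation returns the spanner of the simulation. -/
theorem Good.result_eq (hE : E.Good) (hinj : Set.InjOn E.ident E.graph.edgeSet)
    (hname : Function.Injective E.name) (hh : 1 ≤ E.h) :
    (algorithm E.c (Fintype.card V) E.k E.h).result E.graph E.ident (rounds E.k E.h) E.seed =
      E.spanner := by
  have hsub := (hE.isSpanner le_rfl).1
  ext e
  rw [mem_result]
  constructor
  · rintro ⟨he, x, hx, hsel⟩
    obtain ⟨e', he', h⟩ := hE.exists_of_mem_selected hinj hname hh le_rfl x _ hsel
    rwa [← hinj (hsub he') he h]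
  · intro he
    refine ⟨hsub he, ?_⟩
    obtain ⟨j, hj, v, he⟩ := mem_spanner.1 he
    obtain ⟨u, -, -, x, y, hxy, rfl, hx, -⟩ := exists_of_mem_found he
    have hq : j * (2 * E.h + 1) + 2 * E.h < E.stages := by
      have h1 : (j + 1) * (2 * E.h + 1) ≤ E.stages := Nat.mul_le_mul_right _ hj
      rw [add_mul] at h1
      omega
    have hR := stageTime_add_two_le (k := E.k) hh hq.le
    refine ⟨x, Sym2.mem_mk_left x y,
      (node_mono (t := stageTime E.h (j * (2 * E.h + 1) + 2 * E.h) + 1) (by omega) le_rfl).2.2 ?_⟩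
    rw [node_stage hh le_rfl (hE.correct hinj hname hh) hq, idealStage, level_mod j (by omega),
      level_div j (by omega), if_neg (lt_irrefl _), hx]
    exact Finset.mem_union_right _ (Finset.mem_inter.2
      ⟨List.mem_toFinset.2 (List.mem_map.2 ⟨_, he, rfl⟩), ident_mem_name hxy⟩)

lemma send_eq_none {c : ℝ} {n k h : ℕ} {s : NodeState} {i : ℕ} (hi : i ∉ s.active) :
    (algorithm c n k h).send s i = none := if_neg hi

/-- In a good execution, messages are sent over query edges only: at most two per edge and round. -/
lemma Good.messages_le (hE : E.Good) (hinj : Set.InjOn E.ident E.graph.edgeSet)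
    (hname : Function.Injective E.name) (hh : 1 ≤ E.h) :
    (algorithm E.c (Fintype.card V) E.k E.h).messages E.graph E.ident E.seed (rounds E.k E.h) ≤
      rounds E.k E.h * (2 * E.allQueries.card) := by
  have hround : ∀ t ∈ Finset.range (rounds E.k E.h),
      (algorithm E.c (Fintype.card V) E.k E.h).roundMessages E.graph E.ident
        ((algorithm E.c (Fintype.card V) E.k E.h).run E.graph E.ident E.seed t) ≤
          2 * E.allQueries.card := by
    intro t ht
    rw [Finset.mem_range] at ht
    have hedge : ∀ e ∈ E.allQueries, e ∈ E.graph.edgeSet := by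
      intro e he
      simp only [allQueries, Finset.mem_biUnion] at he
      obtain ⟨j, -, v, -, i, -, he⟩ := he
      exact edgesAt_subset _ _ (E.queries_subset j v i he)
    have hmaps : ∀ q : V × V, E.graph.Adj q.1 q.2 ∧
        ((algorithm E.c (Fintype.card V) E.k E.h).outgoing
          ((algorithm E.c (Fintype.card V) E.k E.h).run E.graph E.ident E.seed t q.1)
          (E.ident s(q.1, q.2))).isSome → s(q.1, q.2) ∈ E.allQueries := by
      rintro ⟨x, y⟩ ⟨hxy, hout⟩
      have hact : E.ident s(x, y) ∈ (E.node t x).active := by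
        by_contra hact
        unfold LocalAlgorithm.outgoing at hout
        split_ifs at hout
        · simp at hout
        · exact Bool.noConfusion
            (hout.symm.trans (congrArg Option.isSome (send_eq_none (s := E.node t x) hact)))
      obtain ⟨e, he, h⟩ := hE.exists_of_mem_active hinj hname hh ht.le x _ hact
      rwa [← hinj (hedge e he) hxy h]
    unfold LocalAlgorithm.roundMessages
    refine (Finset.card_le_mul_card_image_of_maps_to (f := fun q : V × V => s(q.1, q.2))
      (t := E.allQueries) (fun q hq => hmaps q (Finset.mem_filter.1 hq).2) 2 fun e _ => ?_)
    obtain ⟨x, y⟩ := e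
    refine (Finset.card_le_card (t := {(x, y), (y, x)}) ?_).trans Finset.card_le_two
    rintro ⟨x', y'⟩ hq
    rw [Finset.mem_filter] at hq
    rcases Sym2.eq_iff.1 hq.2 with ⟨h1, h2⟩ | ⟨h1, h2⟩ <;> simp_all
  refine (Finset.sum_le_card_nsmul _ _ _ hround).trans ?_
  rw [Finset.card_range, smul_eq_mul]

end Execution

/-! ### Sizes -/

section

variable {n k h j : ℕ}

lemma four_le_of_le_logb_logb (hk : 1 ≤ k) (hkn : (k : ℝ) ≤ Real.logb 2 (Real.logb 2 n)) :
    4 ≤ n := by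
  have hk1 : (1 : ℝ) ≤ k := by exact_mod_cast hk
  have h2 : (1 : ℝ) < 2 := one_lt_two
  by_contra hn
  have hn' : (n : ℝ) ≤ 3 := by exact_mod_cast (by omega : n ≤ 3)
  rcases Nat.eq_zero_or_pos n with rfl | hpos
  · simp at hkn
    omega
  have hn0 : (1 : ℝ) ≤ n := by exact_mod_cast hpos
  have hL0 : 0 ≤ Real.logb 2 n := Real.logb_nonneg h2 hn0
  have hL : Real.logb 2 n < 2 := by
    rw [Real.logb_lt_iff_lt_rpow h2 (by linarith)]
    norm_num
    linarith
  rcases hL0.eq_or_lt with h0 | h0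
  · rw [← h0, Real.logb_zero] at hkn
    linarith
  · have : Real.logb 2 (Real.logb 2 n) < 1 := by
      rw [Real.logb_lt_iff_lt_rpow h2 h0]
      simpa using hL
    linarith

lemma two_pow_le_logb (hn : 4 ≤ n) (hkn : (k : ℝ) ≤ Real.logb 2 (Real.logb 2 n)) :
    (2 : ℝ) ^ k ≤ Real.logb 2 n := by
  rwa [Real.le_logb_iff_rpow_le one_lt_two (by linarith [two_le_logb hn]),
    Real.rpow_natCast] at hkn

lemma succ_le_logb (hn : 4 ≤ n) (hkn : (k : ℝ) ≤ Real.logb 2 (Real.logb 2 n)) :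
    (k : ℝ) + 1 ≤ Real.logb 2 n := by
  refine le_trans ?_ (two_pow_le_logb hn hkn)
  exact_mod_cast Nat.lt_two_pow_self (n := k)

lemma logb_le_self : Real.logb 2 n ≤ n := by
  rcases Nat.eq_zero_or_pos n with rfl | hpos
  · simp
  · rw [Real.logb_le_iff_le_rpow one_lt_two (by exact_mod_cast hpos), Real.rpow_natCast]
    exact_mod_cast (Nat.lt_two_pow_self (n := n)).le

lemma three_pow_le (hn : 4 ≤ n) (hkn : (k : ℝ) ≤ Real.logb 2 (Real.logb 2 n)) :
    (3 : ℝ) ^ k ≤ Real.logb 2 n ^ 2 :=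
  calc (3 : ℝ) ^ k ≤ (2 ^ 2) ^ k := pow_le_pow_left₀ (by norm_num) (by norm_num) k
    _ = (2 ^ k) ^ 2 := pow_right_comm 2 2 k
    _ ≤ _ := pow_le_pow_left₀ (by positivity) (two_pow_le_logb hn hkn) 2

/-- The expected number of nodes of a cluster graph balances the growing powers of `n` in the
targets and in the numbers of queries. -/
lemma expectedNodes_mul_rpow (hn : 4 ≤ n) (x : ℝ) :
    expectedNodes n k j * (n : ℝ) ^ ((2 : ℝ) ^ j * delta k + x) = (n : ℝ) ^ (1 + delta k + x) := by
  rw [expectedNodes, ← Real.rpow_add (by exact_mod_cast (by omega : 0 < n))]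
  ring_nf

lemma target_add_one_le {c : ℝ} (hn : 4 ≤ n) (hc : 1 ≤ c) :
    target c n k j + 1 ≤ 2 * c * Real.logb 2 n * (n : ℝ) ^ ((2 : ℝ) ^ j * delta k) := by
  have h1 := mul_logb_le_target (k := k) (j := j) hn hc
  have h2 : 1 * 2 ≤ c * Real.logb 2 n :=
    mul_le_mul hc (two_le_logb hn) (by norm_num) (by linarith)
  have h3 : target c n k j = c * (n : ℝ) ^ ((2 : ℝ) ^ j * delta k) * Real.logb 2 n := rfl
  linarith

lemma numQueries_le {c : ℝ} (hn : 4 ≤ n) (hc : 1 ≤ c) :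
    (numQueries c n k h j : ℝ) ≤
      2 * c ^ 2 * Real.logb 2 n ^ 3 * (n : ℝ) ^ ((2 : ℝ) ^ j * delta k + 1 / (h : ℝ)) := by
  have hL := two_le_logb hn
  have h1 : (1 : ℝ) ≤ (n : ℝ) ^ ((2 : ℝ) ^ j * delta k + 1 / (h : ℝ)) :=
    Real.one_le_rpow (by exact_mod_cast (by omega : 1 ≤ n))
      (add_nonneg (mul_nonneg (by positivity) delta_pos.le) (by positivity))
  have h2 : 1 ≤ c ^ 2 * (n : ℝ) ^ ((2 : ℝ) ^ j * delta k + 1 / (h : ℝ)) * Real.logb 2 n ^ 3 :=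
    one_le_mul_of_one_le_of_one_le (one_le_mul_of_one_le_of_one_le (one_le_pow₀ hc) h1)
      (one_le_pow₀ (by linarith))
  have h3 := (Nat.ceil_lt_add_one (zero_le_one.trans h2)).le
  rw [numQueries]
  linarith

end

namespace Execution

variable {V : Type} [Fintype V] [Nonempty V] {E : Execution V}

lemma Good.card_spanner_le_mul_rpow (hE : E.Good) (hc : 1 ≤ E.c) (hn : 4 ≤ Fintype.card V)
    (hk : (E.k : ℝ) + 1 ≤ Real.logb 2 (Fintype.card V)) :
    (E.spanner.card : ℝ) ≤ 2 * E.c ^ 2 * Real.logb 2 (Fintype.card V) ^ 3 *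
      (Fintype.card V : ℝ) ^ (1 + delta E.k) := by
  set L := Real.logb 2 (Fintype.card V) with hL
  have hL2 : 2 ≤ L := two_le_logb hn
  have hg : ∀ j, 0 ≤ E.goal j := fun j =>
    le_trans (by positivity) (mul_logb_le_target hn hc)
  have hlevel : ∀ j ∈ Finset.range (E.k + 1), (E.marked j).card * (E.goal j + 1) ≤
      2 * E.c ^ 2 * L ^ 2 * (Fintype.card V : ℝ) ^ (1 + delta E.k) := by
    intro j hj
    have h1 := (hE.few j (by simpa [Nat.lt_succ_iff] using hj)).le
    have h2 := expectedNodes_mul_rpow (k := E.k) (j := j) hn 0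
    rw [add_zero, add_zero] at h2
    calc (E.marked j).card * (E.goal j + 1)
        ≤ (E.c * L * expectedNodes (Fintype.card V) E.k j) *
          (2 * E.c * L * (Fintype.card V : ℝ) ^ ((2 : ℝ) ^ j * delta E.k)) :=
          mul_le_mul h1 (target_add_one_le hn hc) (by linarith [hg j])
            ((Nat.cast_nonneg _).trans h1)
      _ = 2 * E.c ^ 2 * L ^ 2 * (expectedNodes (Fintype.card V) E.k j *
          (Fintype.card V : ℝ) ^ ((2 : ℝ) ^ j * delta E.k)) := by ring
      _ = _ := by rw [h2]
  refine (card_spanner_le E hg).trans ((Finset.sum_le_card_nsmul _ _ _ hlevel).trans ?_)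
  rw [Finset.card_range, nsmul_eq_mul]
  push_cast
  calc ((E.k : ℝ) + 1) * (2 * E.c ^ 2 * L ^ 2 * (Fintype.card V : ℝ) ^ (1 + delta E.k))
      ≤ L * (2 * E.c ^ 2 * L ^ 2 * (Fintype.card V : ℝ) ^ (1 + delta E.k)) :=
        mul_le_mul_of_nonneg_right hk (by positivity)
    _ = _ := by ring

lemma Good.card_allQueries_le_mul_rpow (hE : E.Good) (hc : 1 ≤ E.c) (hn : 4 ≤ Fintype.card V)
    (hk : (E.k : ℝ) + 1 ≤ Real.logb 2 (Fintype.card V))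
    (hh : (E.h : ℝ) ≤ Real.logb 2 (Fintype.card V)) :
    (E.allQueries.card : ℝ) ≤ 4 * E.c ^ 3 * Real.logb 2 (Fintype.card V) ^ 6 *
      (Fintype.card V : ℝ) ^ (1 + delta E.k + 1 / (E.h : ℝ)) := by
  set L := Real.logb 2 (Fintype.card V) with hL
  have hL2 : 2 ≤ L := two_le_logb hn
  have hlevel : ∀ j ∈ Finset.range (E.k + 1), (((E.marked j).card *
      (2 * E.h * numQueries E.c (Fintype.card V) E.k E.h j) : ℕ) : ℝ) ≤
      4 * E.c ^ 3 * L ^ 5 * (Fintype.card V : ℝ) ^ (1 + delta E.k + 1 / (E.h : ℝ)) := by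
    intro j hj
    have h1 := (hE.few j (by simpa [Nat.lt_succ_iff] using hj)).le
    have h2 := expectedNodes_mul_rpow (k := E.k) (j := j) hn (1 / (E.h : ℝ))
    push_cast
    calc ((E.marked j).card : ℝ) * (2 * E.h * numQueries E.c (Fintype.card V) E.k E.h j)
        ≤ (E.c * L * expectedNodes (Fintype.card V) E.k j) * (2 * L * (2 * E.c ^ 2 * L ^ 3 *
          (Fintype.card V : ℝ) ^ ((2 : ℝ) ^ j * delta E.k + 1 / (E.h : ℝ)))) := by
          refine mul_le_mul h1 (mul_le_mul (by linarith) (numQueries_le hn hc) (by positivity)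
            (by positivity)) (by positivity) ((Nat.cast_nonneg _).trans h1)
      _ = 4 * E.c ^ 3 * L ^ 5 * (expectedNodes (Fintype.card V) E.k j *
          (Fintype.card V : ℝ) ^ ((2 : ℝ) ^ j * delta E.k + 1 / (E.h : ℝ))) := by ring
      _ = _ := by rw [h2]
  have hsum : (E.allQueries.card : ℝ) ≤ ((∑ j ∈ Finset.range (E.k + 1), (E.marked j).card *
      (2 * E.h * numQueries E.c (Fintype.card V) E.k E.h j) : ℕ) : ℝ) := by
    exact_mod_cast card_allQueries_le E
  rw [Nat.cast_sum] at hsum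
  refine hsum.trans ((Finset.sum_le_card_nsmul _ _ _ hlevel).trans ?_)
  rw [Finset.card_range, nsmul_eq_mul]
  push_cast
  calc ((E.k : ℝ) + 1) *
        (4 * E.c ^ 3 * L ^ 5 * (Fintype.card V : ℝ) ^ (1 + delta E.k + 1 / (E.h : ℝ)))
      ≤ L * (4 * E.c ^ 3 * L ^ 5 * (Fintype.card V : ℝ) ^ (1 + delta E.k + 1 / (E.h : ℝ))) :=
        mul_le_mul_of_nonneg_right hk (by positivity)
    _ = _ := by ring

lemma Good.messages_le_mul_rpow (hE : E.Good) (hinj : Set.InjOn E.ident E.graph.edgeSet)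
    (hname : Function.Injective E.name) (hh1 : 1 ≤ E.h) (hc : 1 ≤ E.c) (hn : 4 ≤ Fintype.card V)
    (hk : (E.k : ℝ) ≤ Real.logb 2 (Real.logb 2 (Fintype.card V)))
    (hh : (E.h : ℝ) ≤ Real.logb 2 (Fintype.card V)) :
    ((algorithm E.c (Fintype.card V) E.k E.h).messages E.graph E.ident E.seed
      (rounds E.k E.h) : ℝ) ≤ 192 * E.c ^ 3 * Real.logb 2 (Fintype.card V) ^ 9 *
        (Fintype.card V : ℝ) ^ (1 + delta E.k + 1 / (E.h : ℝ)) := by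
  have h1 : ((algorithm E.c (Fintype.card V) E.k E.h).messages E.graph E.ident E.seed
      (rounds E.k E.h) : ℝ) ≤ ((rounds E.k E.h * (2 * E.allQueries.card) : ℕ) : ℝ) :=
    Nat.cast_le.2 (hE.messages_le hinj hname hh1)
  have h2 := hE.card_allQueries_le_mul_rpow hc hn (succ_le_logb hn hk) hh
  have h3 := three_pow_le hn hk
  have hL2 := two_le_logb hn
  set L := Real.logb 2 (Fintype.card V) with hL
  refine h1.trans ?_
  rw [rounds]
  push_cast
  calc (24 : ℝ) * 3 ^ E.k * E.h * (2 * E.allQueries.card)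
      ≤ 24 * L ^ 2 * L * (2 * (4 * E.c ^ 3 * L ^ 6 *
        (Fintype.card V : ℝ) ^ (1 + delta E.k + 1 / (E.h : ℝ)))) := by
        gcongr
    _ = _ := by ring

end Execution

end Sampler

end

theorem theorem1 :
    ∃ A b : ℕ, ∀ d : ℝ, ∃ c₀ : ℝ, ∀ c : ℝ, c₀ ≤ c → ∃ B : ℝ,
      ∀ n k h : ℕ, 1 ≤ k → (k : ℝ) ≤ Real.logb 2 (Real.logb 2 n) →
        1 ≤ h → (h : ℝ) ≤ Real.logb 2 n →
      ∃ 𝒜 : LocalAlgorithm,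
        ∀ (V : Type) [Fintype V] (G : SimpleGraph V) (ident : Sym2 V → ℕ),
          Fintype.card V = n → G.Connected → Set.InjOn ident G.edgeSet →
          -- the edge set of Sampler is a sparse spanner whp
          (Sampler.output G c k h).HoldsUpTo ((n : ℝ) ^ (-d)) (fun S =>
            IsSpanner G (A * 3 ^ k) S ∧
            (S.card : ℝ) ≤ B * Real.logb 2 n ^ b * (n : ℝ) ^ (1 + 1 / ((2 : ℝ) ^ (k + 1) - 1))) ∧
          -- the LOCAL algorithm implements Sampler in O(3^k h) rounds
          (∀ ω : V → 𝒜.Seed, 𝒜.HaltsBy G ident (A * 3 ^ k * h) ω) ∧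
          ((𝒜.seeds V).map (𝒜.result G ident (A * 3 ^ k * h))).CloseTo
            (Sampler.output G c k h) ((n : ℝ) ^ (-d)) ∧
          -- whp its output is a sparse spanner and it sends few messages
          (𝒜.seeds V).HoldsUpTo ((n : ℝ) ^ (-d)) (fun ω =>
            IsSpanner G (A * 3 ^ k) (𝒜.result G ident (A * 3 ^ k * h) ω) ∧
            ((𝒜.result G ident (A * 3 ^ k * h) ω).card : ℝ) ≤
              B * Real.logb 2 n ^ b * (n : ℝ) ^ (1 + 1 / ((2 : ℝ) ^ (k + 1) - 1)) ∧
            (𝒜.messages G ident ω (A * 3 ^ k * h) : ℝ) ≤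
              B * Real.logb 2 n ^ b *
                (n : ℝ) ^ (1 + 1 / ((2 : ℝ) ^ (k + 1) - 1) + 1 / (h : ℝ))) := by
  -- `rounds` is `24 * 3 ^ k * h`, and the factors in `messages_le_mul_rpow` amount to `log n ^ 9`
  refine ⟨24, 9, fun d => ⟨max (d + 4) 2, fun c hc => ⟨192 * c ^ 3, ?_⟩⟩⟩
  intro n k h hk1 hkn hh1 hhn
  refine ⟨Sampler.algorithm c n k h, ?_⟩
  intro V _ G ident hcard hconn hinj
  subst hcard
  have : Nonempty V := hconn.nonempty
  have hcd : d + 4 ≤ c := (le_max_left _ _).trans hc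
  have hc2 : 2 ≤ c := (le_max_right _ _).trans hc
  have hc1 : 1 ≤ c := one_le_two.trans hc2
  have hn := Sampler.four_le_of_le_logb_logb hk1 hkn
  have hL := Sampler.two_le_logb hn
  have hkL := Sampler.succ_le_logb hn hkn
  have hk : k + 1 ≤ Fintype.card V := by exact_mod_cast hkL.trans Sampler.logb_le_self
  have hh : h ≤ Fintype.card V := by exact_mod_cast hhn.trans Sampler.logb_le_self
  have hgood := Sampler.holdsUpTo_good (G := G) hinj hn hc2 hcd hk hh1 hh
  have hspanner : ∀ ω, (Sampler.Execution.mk G ident c k h ω).Good →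
      IsSpanner G (24 * 3 ^ k) (Sampler.Execution.mk G ident c k h ω).spanner ∧
      ((Sampler.Execution.mk G ident c k h ω).spanner.card : ℝ) ≤
        192 * c ^ 3 * Real.logb 2 (Fintype.card V) ^ 9 *
          (Fintype.card V : ℝ) ^ (1 + 1 / ((2 : ℝ) ^ (k + 1) - 1)) := by
    intro ω hE
    refine ⟨hE.isSpanner (Nat.mul_le_mul_right _ (by norm_num)),
      (hE.card_spanner_le_mul_rpow hc1 hn hkL).trans ?_⟩
    refine mul_le_mul_of_nonneg_right (mul_le_mul ?_ ?_ (by positivity) (by positivity))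
      (by positivity)
    · exact mul_le_mul (by norm_num) (pow_le_pow_right₀ hc1 (by norm_num)) (by positivity)
        (by norm_num)
    · exact pow_le_pow_right₀ (by linarith) (by norm_num)
  have hresult : ∀ ω, (Sampler.Execution.mk G ident c k h ω).Good →
      (Sampler.algorithm c (Fintype.card V) k h).result G ident (24 * 3 ^ k * h) ω =
        (Sampler.Execution.mk G ident c k h ω).spanner := fun ω hE =>
    hE.result_eq hinj (Sampler.Execution.name_injective hinj hconn (by omega)) hh1
  refine ⟨?_, fun ω => Sampler.Execution.haltsBy (E := ⟨G, ident, c, k, h, ω⟩) hinj hh1, ?_, ?_⟩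
  · rw [← Sampler.map_simulate_seedLaw hinj]
    refine PMF.HoldsUpTo.map (hgood.mono fun ω hE => ?_)
    rw [Sampler.simulate_eq_spanner]
    exact hspanner ω hE
  · rw [← Sampler.map_simulate_seedLaw hinj]
    refine PMF.closeTo_map _ _ _ _ (by positivity) (hgood.mono fun ω hE => ?_)
    rw [Sampler.simulate_eq_spanner]
    exact hresult ω hE
  · refine hgood.mono fun ω hE => ?_
    rw [hresult ω hE]
    exact ⟨(hspanner ω hE).1, (hspanner ω hE).2, hE.messages_le_mul_rpow hinj
      (Sampler.Execution.name_injective hinj hconn (by omega)) hh1 hc1 hn hkn hhn⟩
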